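/- Let $k$ be a field and let $Q$ be a strongly locally finite quiver, that is, every vertex of $Q$ is the starting point of only finitely many arrows and the ending point of only finitely many arrows, and for any two vertices $x,y$ there are only finitely many paths from $x$ to $y$. For a vertex $a$ let $P_a$ be the $k$-representation of $Q$ whose space at $x$ has the paths from $a$ to $x$ as a basis, with arrows acting by composition. Let $\mathrm{rep}^+(Q)$ be the category of finitely presented representations of $Q$, that is, the representations $M$ admitting a short exact sequence $0\to P_1\to P_0\to M\to 0$ in which $P_0,P_1$ are locally finite dimensional and are finite direct sums of representations $P_a\otimes_k U$ with $a$ a vertex and $U$ a $k$-vector space; it is an abelian category. Let $D^b(\mathrm{rep}^+(Q))$ be its bounded derived category. An exact triangle $X\xrightarrow{f}Y\xrightarrow{g}Z\to X[1]$ is almost split if $f$ is minimal left almost split and $g$ is minimal right almost split; here $f$ is left almost split if it is not a section and every morphism from $X$ which is not a section factors through $f$, it is left minimal if every endomorphism $h$ of $Y$ with $hf=f$ is an automorphism, and right almost split and right minimal are defined dually. One says that $D^b(\mathrm{rep}^+(Q))$ has left (respectively, right) almost split triangles if each of its indecomposable objects is the starting term $X$ (respectively, the ending term $Z$) of an almost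 split triangle, and that it has almost split triangles if it has both left and right almost split triangles. A right infinite path in $Q$ is an infinite path $x_0\to x_1\to x_2\to\cdots$, a left infinite path is an infinite path $\cdots\to x_2\to x_1\to x_0$, and an infinite path is a right infinite, left infinite or double infinite ($\cdots\to x_{-1}\to x_0\to x_1\to\cdots$) path. Then: (1) $D^b(\mathrm{rep}^+(Q))$ has left almost split triangles if and only if $Q$ has no right infinite path; (2) $D^b(\mathrm{rep}^+(Q))$ has right almost split triangles if and only if $Q$ has no left infinite path; (3) $D^b(\mathrm{rep}^+(Q))$ has almost split triangles if and only if $Q$ has no infinite path. -/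

import Mathlib

open CategoryTheory Limits Pretriangulated

universe u

noncomputable section

section Quivers

/-- A quiver is strongly locally finite if every vertex is the starting point of finitely many
arrows and the ending point of finitely many arrows, and if there are only finitely many paths
between any two given vertices. -/
class StronglyLocallyFinite (Q : Type u) [Quiver.{u} Q] : Prop where
  finite_out (x : Q) : Finite (Σ y : Q, x ⟶ y)
  finite_in (x : Q) : Finite (Σ y : Q, y ⟶ x)
  finite_path (x y : Q) : Finite (Quiver.Path x y)

/-- A right infinite path `x₀ ⟶ x₁ ⟶ x₂ ⟶ ⋯` (it has a starting point). -/
structure RightInfinitePath (Q : Type u) [Quiver.{u} Q] where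
  vertex : ℕ → Q
  arrow (n : ℕ) : vertex n ⟶ vertex (n + 1)

/-- A left infinite path `⋯ ⟶ x₂ ⟶ x₁ ⟶ x₀` (it has an ending point). -/
structure LeftInfinitePath (Q : Type u) [Quiver.{u} Q] where
  vertex : ℕ → Q
  arrow (n : ℕ) : vertex (n + 1) ⟶ vertex n

/-- A double infinite path `⋯ ⟶ x₋₁ ⟶ x₀ ⟶ x₁ ⟶ ⋯`. -/
structure DoubleInfinitePath (Q : Type u) [Quiver.{u} Q] where
  vertex : ℤ → Q
  arrow (n : ℤ) : vertex n ⟶ vertex (n + 1)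

/-- An infinite path is a right infinite, a left infinite or a double infinite path. -/
def HasInfinitePath (Q : Type u) [Quiver.{u} Q] : Prop :=
  Nonempty (RightInfinitePath Q) ∨ Nonempty (LeftInfinitePath Q) ∨ Nonempty (DoubleInfinitePath Q)

end Quivers

section AlmostSplit

variable {C : Type*} [Category C]

def IsLeftMinimal {X Y : C} (f : X ⟶ Y) : Prop :=
  ∀ h : Y ⟶ Y, f ≫ h = f → IsIso h

def IsRightMinimal {X Y : C} (f : X ⟶ Y) : Prop :=
  ∀ h : X ⟶ X, h ≫ f = f → IsIso h

/-- `f` is not a section, and every morphism from its source which is not a section factors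
through `f`. -/
def IsLeftAlmostSplit {X Y : C} (f : X ⟶ Y) : Prop :=
  ¬ IsSplitMono f ∧ ∀ ⦃Z : C⦄ (g : X ⟶ Z), ¬ IsSplitMono g → ∃ h : Y ⟶ Z, f ≫ h = g

/-- `f` is not a retraction, and every morphism to its target which is not a retraction factors
through `f`. -/
def IsRightAlmostSplit {X Y : C} (f : X ⟶ Y) : Prop :=
  ¬ IsSplitEpi f ∧ ∀ ⦃Z : C⦄ (g : Z ⟶ Y), ¬ IsSplitEpi g → ∃ h : Z ⟶ X, h ≫ f = g

def IsMinimalLeftAlmostSplit {X Y : C} (f : X ⟶ Y) : Prop :=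
  IsLeftMinimal f ∧ IsLeftAlmostSplit f

def IsMinimalRightAlmostSplit {X Y : C} (f : X ⟶ Y) : Prop :=
  IsRightMinimal f ∧ IsRightAlmostSplit f

variable (C) [Preadditive C] [HasZeroObject C] [HasShift C ℤ]
  [∀ n : ℤ, (shiftFunctor C n).Additive] [Pretriangulated C]

variable {C} in
/-- An exact triangle `X ⟶ Y ⟶ Z ⟶ X⟦1⟧` is almost split if its first morphism is minimal left
almost split and its second morphism is minimal right almost split. -/
def IsAlmostSplitTriangle (T : Triangle C) : Prop :=
  T ∈ distTriang C ∧ IsMinimalLeftAlmostSplit T.mor₁ ∧ IsMinimalRightAlmostSplit T.mor₂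

/-- Every indecomposable object is the starting term of an almost split triangle. -/
def HasLeftAlmostSplitTriangles : Prop :=
  ∀ X : C, Indecomposable X →
    ∃ (Y Z : C) (f : X ⟶ Y) (g : Y ⟶ Z) (h : Z ⟶ X⟦(1 : ℤ)⟧),
      IsAlmostSplitTriangle (Triangle.mk f g h)

/-- Every indecomposable object is the ending term of an almost split triangle. -/
def HasRightAlmostSplitTriangles : Prop :=
  ∀ Z : C, Indecomposable Z →
    ∃ (X Y : C) (f : X ⟶ Y) (g : Y ⟶ Z) (h : Z ⟶ X⟦(1 : ℤ)⟧),
      IsAlmostSplitTriangle (Triangle.mk f g h)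

def HasAlmostSplitTriangles : Prop :=
  HasLeftAlmostSplitTriangles C ∧ HasRightAlmostSplitTriangles C

end AlmostSplit

/-- The category of `k`-representations of the quiver `Q`, i.e. of functors from the free category
on `Q` (vertices as objects, paths as morphisms) to `k`-vector spaces. -/
abbrev QuiverRep (k Q : Type u) [Field k] [Quiver.{u} Q] := Paths Q ⥤ ModuleCat.{u} k

namespace QuiverRep

section Definitions

variable {k Q : Type u} [Field k] [Quiver.{u} Q]

/-- The representation `P_a`: its space at `x` has the paths from `a` to `x` as a basis, and arrows
act by composition of paths. -/
def P (k : Type u) {Q : Type u} [Field k] [Quiver.{u} Q] (a : Paths Q) : QuiverRep k Q :=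
  coyoneda.obj (Opposite.op a) ⋙ ModuleCat.free k

/-- The representation `M ⊗ U`, with `(M ⊗ U)(x) = M(x) ⊗ U`, for a vector space `U`. -/
def tens (M : QuiverRep k Q) (U : ModuleCat.{u} k) : QuiverRep k Q :=
  M ⋙ MonoidalCategory.tensorRight U

/-- The objects of `Proj(Q)`: the finite direct sums of representations `P_a ⊗ U`. -/
def IsProj : ObjectProperty (QuiverRep k Q) := fun M =>
  ∃ (n : ℕ) (a : Fin n → Paths Q) (U : Fin n → ModuleCat.{u} k),
    Nonempty (M ≅ ∐ fun i => tens (P k (a i)) (U i))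

def IsLocallyFiniteDimensional : ObjectProperty (QuiverRep k Q) := fun M =>
  ∀ x, Module.Finite k (M.obj x)

/-- A representation `M` is finitely presented if there is a short exact sequence
`0 ⟶ P₁ ⟶ P₀ ⟶ M ⟶ 0` with `P₁`, `P₀` locally finite dimensional objects of `Proj(Q)`. -/
def IsFinitelyPresented (k Q : Type u) [Field k] [Quiver.{u} Q] : ObjectProperty (QuiverRep k Q) :=
  fun M => ∃ (P₁ P₀ : QuiverRep k Q) (i : P₁ ⟶ P₀) (p : P₀ ⟶ M) (w : i ≫ p = 0),
    (ShortComplex.mk i p w).ShortExact ∧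
      (IsProj P₁ ∧ IsLocallyFiniteDimensional P₁) ∧ (IsProj P₀ ∧ IsLocallyFiniteDimensional P₀)

end Definitions

/-! ### Finitely presented representations form an abelian category

A finitely generated subrepresentation of a finite direct sum of representations `P_a` is again
such a direct sum; closure under kernels and cokernels follows. -/

section Free

variable (k : Type u) {Q : Type u} [Field k] [Quiver.{u} Q]

/-- closed paths are trivial -/
theorem path_eq_nil [StronglyLocallyFinite Q] {a : Q} (p : Quiver.Path a a) : p = .nil := by
  by_contra hp
  have hl : 0 < p.length := by
    rcases Nat.eq_zero_or_pos p.length with h | h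
    · exact absurd (Quiver.Path.eq_nil_of_length_zero p h) hp
    · exact h
  let f : ℕ → Quiver.Path a a := fun n => Nat.rec .nil (fun _ q => q.comp p) n
  have hf : ∀ n, (f n).length = n * p.length := by
    intro n
    induction n with
    | zero => simp [f]
    | succ n ih =>
      have : f (n+1) = (f n).comp p := rfl
      rw [this, Quiver.Path.length_comp, ih]; ring
  have := StronglyLocallyFinite.finite_path a a
  refine not_injective_infinite_finite f fun m n h => ?_
  have := hf m
  rw [h, hf] at this
  exact (Nat.eq_of_mul_eq_mul_right hl this).symm

def FreeRep {J : Type} (b : J → Paths Q) : QuiverRep k Q where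
  obj x := ModuleCat.of k ((Σ j, b j ⟶ x) →₀ k)
  map {x y} p := ModuleCat.ofHom (Finsupp.lmapDomain k k
    (fun s : Σ j, b j ⟶ x => (⟨s.1, s.2 ≫ p⟩ : Σ j, b j ⟶ y)))
  map_id x := by
    ext : 1
    apply Finsupp.lhom_ext
    intro s c
    simp [Finsupp.mapDomain_single]
  map_comp {x y z} p q := by
    ext : 1
    apply Finsupp.lhom_ext
    intro s c
    simp [Finsupp.mapDomain_single]

variable {k}
variable {J : Type} {b : J → Paths Q}

def gen (b : J → Paths Q) {x : Paths Q} (j : J) (p : b j ⟶ x) : (FreeRep k b).obj x :=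
  Finsupp.single (⟨j, p⟩ : Σ j, b j ⟶ x) (1 : k)

theorem map_gen {x y : Paths Q} (j : J) (p : b j ⟶ x) (q : x ⟶ y) :
    (FreeRep k b).map q (gen b j p) = gen b j (p ≫ q) :=
  Finsupp.mapDomain_single

theorem Fr_app_ext {x : Paths Q} {N : ModuleCat.{u} k} {f g : (FreeRep k b).obj x ⟶ N}
    (h : ∀ j p, f (gen b j p) = g (gen b j p)) : f = g := by
  apply ModuleCat.hom_ext
  apply Finsupp.lhom_ext'
  rintro ⟨j, p⟩
  apply LinearMap.ext_ring
  exact h j p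

def descApp {M : QuiverRep k Q} (m : ∀ j, M.obj (b j)) (x : Paths Q) : (FreeRep k b).obj x ⟶ M.obj x :=
  ModuleCat.ofHom (Finsupp.lift (M.obj x) k (Σ j, b j ⟶ x) (fun s => M.map s.2 (m s.1)))

theorem descApp_gen {M : QuiverRep k Q} (m : ∀ j, M.obj (b j)) {x : Paths Q} (j : J)
    (p : b j ⟶ x) : descApp m x (gen b j p) = M.map p (m j) := by
  dsimp only [descApp, gen]
  refine Eq.trans (Finsupp.lift_apply _ _ _ _ _) ?_
  rw [Finsupp.sum_single_index] <;> simp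

/-- morphism out of FreeRep -/
def desc {M : QuiverRep k Q} (m : ∀ j, M.obj (b j)) : FreeRep k b ⟶ M where
  app x := descApp m x
  naturality x y p := by
    apply Fr_app_ext
    intro j q
    simp only [ModuleCat.comp_apply]
    rw [map_gen, descApp_gen, descApp_gen, M.map_comp, ModuleCat.comp_apply]

theorem desc_gen {M : QuiverRep k Q} (m : ∀ j, M.obj (b j)) {x : Paths Q} (j : J)
    (p : b j ⟶ x) :
    (desc m).app x (gen b j p) = M.map p (m j) := descApp_gen m j p

theorem Fr_hom_app {M : QuiverRep k Q} (f : FreeRep k b ⟶ M) {x : Paths Q} (j : J)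
    (p : b j ⟶ x) :
    f.app x (gen b j p) = M.map p (f.app (b j) (gen b j (𝟙 _))) := by
  have := NatTrans.naturality_apply f p (gen b j (𝟙 _))
  rwa [map_gen, Category.id_comp] at this

theorem Fr_hom_ext {M : QuiverRep k Q} {f g : FreeRep k b ⟶ M}
    (h : ∀ j, f.app (b j) (gen b j (𝟙 _)) = g.app (b j) (gen b j (𝟙 _))) : f = g := by
  ext x : 2
  apply Fr_app_ext
  intro j p
  exact (Fr_hom_app f j p).trans ((congrArg _ (h j)).trans (Fr_hom_app g j p).symm)

theorem desc_gen_nil {M : QuiverRep k Q} (m : ∀ j, M.obj (b j)) (j : J) :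
    (desc m).app (b j) (gen b j (𝟙 _)) = m j := by
  rw [desc_gen, M.map_id, ModuleCat.id_apply]

theorem app_surj {M N : QuiverRep k Q} (f : M ⟶ N) [Epi f] (x : Paths Q) :
    Function.Surjective (f.app x) :=
  (ModuleCat.epi_iff_surjective _).1 ((NatTrans.epi_iff_epi_app f).1 inferInstance x)

theorem app_inj {M N : QuiverRep k Q} (f : M ⟶ N) [Mono f] (x : Paths Q) :
    Function.Injective (f.app x) :=
  (ModuleCat.mono_iff_injective _).1 ((NatTrans.mono_iff_mono_app f).1 inferInstance x)

instance : Projective (FreeRep k b) where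
  factors {E X} f e _ := by
    choose m hm using fun j => app_surj e (b j) (f.app (b j) (gen b j (𝟙 _)))
    refine ⟨desc m, Fr_hom_ext fun j => ?_⟩
    rw [NatTrans.comp_app, ModuleCat.comp_apply]
    rw [desc_gen_nil, hm]

/-- an arrow as a path -/
def arrowPath {z x : Paths Q} (α : Quiver.Hom (V := Q) z x) : z ⟶ x := Quiver.Hom.toPath (V := Q) α

def len {z x : Paths Q} (p : z ⟶ x) : ℕ := Quiver.Path.length (V := Q) p

theorem comp_ar_inj {a z z' x : Paths Q} {α : Quiver.Hom (V := Q) z x}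
    {β : Quiver.Hom (V := Q) z' x} {p : a ⟶ z} {p' : a ⟶ z'} (h : p ≫ arrowPath α = p' ≫ arrowPath β) :
    (⟨z, α⟩ : Σ z : Q, Quiver.Hom (V := Q) z x) = ⟨z', β⟩ ∧ HEq p p' := by
  have h' : Quiver.Path.cons (V := Q) p α = Quiver.Path.cons (V := Q) p' β := h
  obtain rfl := Quiver.Path.obj_eq_of_cons_eq_cons h'
  obtain rfl := eq_of_heq (Quiver.Path.heq_of_cons_eq_cons h')
  obtain rfl := eq_of_heq (Quiver.Path.hom_heq_of_cons_eq_cons h')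
  exact ⟨rfl, HEq.rfl⟩

theorem cons_inj (b : J → Paths Q) {z x : Paths Q} (α : Quiver.Hom (V := Q) z x) :
    Function.Injective (fun s : Σ j, b j ⟶ z => (⟨s.1, s.2 ≫ arrowPath α⟩ : Σ j, b j ⟶ x)) := by
  rintro ⟨j, p⟩ ⟨j', p'⟩ h
  simp only [Sigma.mk.injEq] at h
  obtain ⟨rfl, h⟩ := h
  have := (comp_ar_inj (eq_of_heq h)).2
  simpa using this

/-- the part of a vector which ends with a given arrow -/
def divArrow (b : J → Paths Q) {z x : Paths Q} (α : Quiver.Hom (V := Q) z x) :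
    (FreeRep k b).obj x →ₗ[k] (FreeRep k b).obj z :=
  Finsupp.lcomapDomain (M := k) (R := k)
    (fun s : Σ j, b j ⟶ z => (⟨s.1, s.2 ≫ arrowPath α⟩ : Σ j, b j ⟶ x)) (cons_inj b α)

theorem dv_map {z x : Paths Q} (α : Quiver.Hom (V := Q) z x) (w : (FreeRep k b).obj z) :
    divArrow b α ((FreeRep k b).map (arrowPath α) w) = w :=
  Finsupp.comapDomain_mapDomain _ (cons_inj b α) w

theorem dv_map_ne {z z' x : Paths Q} (α : Quiver.Hom (V := Q) z x) (β : Quiver.Hom (V := Q) z' x)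
    (h : (⟨z, α⟩ : Σ z : Q, Quiver.Hom (V := Q) z x) ≠ ⟨z', β⟩) (w : (FreeRep k b).obj z') :
    divArrow b α ((FreeRep k b).map (arrowPath β) w) = 0 := by
  refine Finsupp.ext ?_
  rintro ⟨j, p⟩
  refine Finsupp.mapDomain_of_notMem_range (M := k) w _ ?_
  rintro ⟨⟨j', p'⟩, h'⟩
  simp only [Sigma.mk.injEq] at h'
  obtain ⟨rfl, h'⟩ := h'
  exact h (comp_ar_inj (eq_of_heq h')).1.symm

theorem exists_cons {a x : Paths Q} (p : a ⟶ x) (hp : len p ≠ 0) :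
    ∃ (z : Paths Q) (q : a ⟶ z) (β : Quiver.Hom (V := Q) z x), p = q ≫ arrowPath β := by
  change Quiver.Path (V := Q) a x at p
  cases p with
  | nil => exact absurd rfl hp
  | cons q β => exact ⟨_, q, β, rfl⟩

theorem sum_gen {x : Paths Q} (v : (Σ j, b j ⟶ x) →₀ k) :
    v = ∑ s ∈ v.support, v s • (gen b s.1 s.2 : (FreeRep k b).obj x) := by
  conv_lhs => rw [← Finsupp.sum_single v]
  refine Finset.sum_congr rfl fun s _ => ?_
  change _ = v s • Finsupp.single s (1 : k)
  simp

theorem app_sum_gen {M : QuiverRep k Q} (φ : FreeRep k b ⟶ M) {x : Paths Q}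
    (v : (Σ j, b j ⟶ x) →₀ k) :
    φ.app x v = ∑ s ∈ v.support, v s • φ.app x (gen b s.1 s.2) := by
  conv_lhs => rw [sum_gen v]
  change (φ.app x).hom _ = _
  simp only [map_sum, map_smul]

theorem dv_nat {J' : Type} {a : J' → Paths Q} (φ : FreeRep k b ⟶ FreeRep k a) {z x : Paths Q}
    (α : Quiver.Hom (V := Q) z x) (v : (Σ j, b j ⟶ x) →₀ k)
    (hv : ∀ s ∈ v.support, len s.2 ≠ 0) :
    divArrow a α (φ.app x v) = φ.app z (divArrow b α v) := by
  have key : ∀ s ∈ v.support, divArrow a α (φ.app x (gen b s.1 s.2)) = φ.app z (divArrow b α (gen b s.1 s.2)) := by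
    rintro ⟨j, p⟩ hs
    obtain ⟨z', q, β, rfl⟩ := exists_cons p (hv _ hs)
    dsimp only
    rw [← map_gen, NatTrans.naturality_apply]
    by_cases h : (⟨z, α⟩ : Σ z : Q, Quiver.Hom (V := Q) z x) = ⟨z', β⟩
    · cases h
      rw [dv_map, dv_map]
    · rw [dv_map_ne _ _ h, dv_map_ne _ _ h, map_zero]
  rw [sum_gen v]
  change divArrow a α ((φ.app x).hom _) = (φ.app z).hom _
  simp only [map_sum, map_smul]
  exact Finset.sum_congr rfl fun s hs => congrArg _ (key s hs)

/-- The key step: a surjection from a free representation whose relations have no trivial term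
is injective as soon as its target embeds in a free representation. -/
theorem inj_of_no_nil {J' : Type} {a : J' → Paths Q} (φ : FreeRep k b ⟶ FreeRep k a)
    (h0 : ∀ (x : Paths Q) (v : (Σ j, b j ⟶ x) →₀ k), φ.app x v = 0 → ∀ s ∈ v.support, len s.2 ≠ 0)
    (N : ℕ) : ∀ (x : Paths Q) (v : (Σ j, b j ⟶ x) →₀ k), φ.app x v = 0 →
      (∀ s ∈ v.support, len s.2 < N) → v = 0 := by
  induction N with
  | zero =>
    intro x v _ hN
    ext s
    by_contra hs
    exact absurd (hN s (by simpa using hs)) (by simp)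
  | succ N ih =>
    intro x v hv hN
    ext ⟨j, p⟩
    by_contra hs
    have hs' : (⟨j, p⟩ : Σ j, b j ⟶ x) ∈ v.support := by simpa using hs
    obtain ⟨z, q, β, rfl⟩ := exists_cons p (h0 x v hv _ hs')
    have h1 : φ.app z (divArrow b β v) = 0 := by
      rw [← dv_nat φ β v (h0 x v hv), hv, map_zero]
    have h2 := ih z (divArrow b β v) h1 (fun s hs => by
      have : (⟨s.1, s.2 ≫ arrowPath β⟩ : Σ j, b j ⟶ x) ∈ v.support :=
        Finsupp.mem_support_iff.2 fun h => (Finsupp.mem_support_iff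
          (f := (divArrow b β v : (Σ j, b j ⟶ z) →₀ k))).1 hs h
      have := hN _ this
      have hl : len (s.2 ≫ arrowPath β) = len s.2 + 1 := Quiver.Path.length_comp (V := Q) s.2 _
      dsimp only at this
      omega)
    exact hs (DFunLike.congr_fun h2 (⟨j, q⟩ : Σ j, b j ⟶ z))

theorem inj_of_no_nil' {J' : Type} {a : J' → Paths Q} (φ : FreeRep k b ⟶ FreeRep k a)
    (h0 : ∀ (x : Paths Q) (v : (Σ j, b j ⟶ x) →₀ k), φ.app x v = 0 → ∀ s ∈ v.support, len s.2 ≠ 0) :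
    Mono φ := by
  refine (NatTrans.mono_iff_mono_app φ).2 fun x => (ModuleCat.mono_iff_injective _).2 ?_
  refine (injective_iff_map_eq_zero (φ.app x).hom).2 fun v hv => ?_
  exact inj_of_no_nil φ h0 ((Finsupp.support (α := Σ j, b j ⟶ x) (M := k) v).sup (fun s => len s.2) + 1) x v hv
    (fun s hs => Nat.lt_succ_of_le (Finset.le_sup (f := fun s : Σ j, b j ⟶ x => len s.2) hs))

/-- finitely generated subs of free are free -/
theorem exists_free [StronglyLocallyFinite Q] {J' : Type} {a : J' → Paths Q} {X : QuiverRep k Q} (i : X ⟶ FreeRep k a) [Mono i]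
    {n : ℕ} {b : Fin n → Paths Q} (π : FreeRep k b ⟶ X) [Epi π] :
    ∃ (m : ℕ) (c : Fin m → Paths Q), Nonempty (X ≅ FreeRep k c) := by
  classical
  have hex : ∃ (n : ℕ) (b : Fin n → Paths Q) (π : FreeRep k b ⟶ X), Epi π := ⟨n, b, π, inferInstance⟩
  obtain ⟨b, π, hπ⟩ := Nat.find_spec hex
  have hmin := fun m => Nat.find_min hex (m := m)
  generalize Nat.find hex = n at b π hπ hmin
  suffices Mono π by
    have := isIso_of_mono_of_epi π
    exact ⟨n, b, ⟨(asIso π).symm⟩⟩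
  suffices Mono (π ≫ i) from mono_of_mono π i
  apply inj_of_no_nil'
  rintro x v hv ⟨j, p⟩ hs hl
  replace hv : i.app x (π.app x v) = 0 := hv
  replace hv : π.app x v = 0 := app_inj i x (by rw [hv, map_zero])
  obtain rfl : b j = x := Quiver.Path.eq_of_length_zero (V := Q) p hl
  obtain rfl : p = 𝟙 _ := path_eq_nil (Q := Q) p
  obtain ⟨n, rfl⟩ : ∃ m, n = m + 1 := ⟨n - 1, by have := j.pos; omega⟩
  -- the generator `j` is superfluous
  let b' : Fin n → Paths Q := fun l => b (j.succAbove l)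
  let e : FreeRep k b' ⟶ FreeRep k b := desc fun l => gen b (j.succAbove l) (𝟙 _)
  have he : ∀ (y : Paths Q) (l : Fin (n + 1)) (q : b l ⟶ y), l ≠ j → ∃ w, e.app y w = gen b l q := by
    intro y l q hl
    obtain ⟨l, rfl⟩ := Fin.exists_succAbove_eq hl
    refine ⟨gen b' l q, ?_⟩
    rw [desc_gen, map_gen, Category.id_comp]
  refine hmin n (Nat.lt_succ_self n) ⟨b', e ≫ π, ?_⟩
  have hj : ∃ w, (e ≫ π).app (b j) w = π.app (b j) (gen b j (𝟙 _)) := by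
    have hc := Finsupp.mem_support_iff.1 hs
    change π.app (b j) (gen b j (𝟙 _)) ∈ LinearMap.range ((e ≫ π).app (b j)).hom
    rw [app_sum_gen, ← Finset.add_sum_erase _ _ hs] at hv
    refine (Submodule.smul_mem_iff _ hc).1 ?_
    rw [eq_neg_of_add_eq_zero_left hv]
    refine Submodule.neg_mem _ (Submodule.sum_mem _ fun s hs' => Submodule.smul_mem _ _ ?_)
    obtain ⟨l, q⟩ := s
    have hl : l ≠ j := by
      rintro rfl
      obtain rfl : q = 𝟙 _ := path_eq_nil (Q := Q) q
      simp at hs'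
    obtain ⟨w, hw⟩ := he _ l q hl
    exact ⟨w, congrArg (π.app (b j)) hw⟩
  refine (NatTrans.epi_iff_epi_app _).2 fun y => (ModuleCat.epi_iff_surjective _).2 fun t => ?_
  obtain ⟨v, rfl⟩ : ∃ v : (Σ j, b j ⟶ y) →₀ k, π.app y v = t := app_surj π y t
  change π.app y v ∈ LinearMap.range ((e ≫ π).app y).hom
  rw [app_sum_gen]
  refine Submodule.sum_mem _ fun s hs' => Submodule.smul_mem _ _ ?_
  obtain ⟨l, q⟩ := s
  by_cases hl : l = j
  · subst hl
    obtain ⟨w, hw⟩ := hj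
    refine ⟨(FreeRep k b').map q w, ?_⟩
    have h1 := NatTrans.naturality_apply (e ≫ π) q w
    rw [hw] at h1
    exact h1.trans (Fr_hom_app π l q).symm
  · obtain ⟨w, hw⟩ := he _ l q hl
    exact ⟨w, congrArg (π.app y) hw⟩


def pgen {a x : Paths Q} (p : a ⟶ x) : (P k a).obj x := Finsupp.single p (1 : k)

theorem P_map_gen {a x y : Paths Q} (p : a ⟶ x) (q : x ⟶ y) :
    (P k a).map q (pgen p) = pgen (p ≫ q) :=
  Finsupp.mapDomain_single

theorem P_app_ext {a x : Paths Q} {N : ModuleCat.{u} k} {f g : (P k a).obj x ⟶ N}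
    (h : ∀ p, f (pgen p) = g (pgen p)) : f = g := by
  apply ModuleCat.hom_ext
  apply Finsupp.lhom_ext'
  intro p
  apply LinearMap.ext_ring
  exact h p

theorem P_hom_app {a : Paths Q} {M : QuiverRep k Q} (f : P k a ⟶ M) {x : Paths Q} (p : a ⟶ x) :
    f.app x (pgen p) = M.map p (f.app a (pgen (𝟙 _))) := by
  have := NatTrans.naturality_apply f p (pgen (𝟙 _))
  rwa [P_map_gen, Category.id_comp] at this

theorem P_hom_ext {a : Paths Q} {M : QuiverRep k Q} {f g : P k a ⟶ M}
    (h : f.app a (pgen (𝟙 _)) = g.app a (pgen (𝟙 _))) : f = g := by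
  ext x : 2
  apply P_app_ext
  intro p
  exact (P_hom_app f p).trans ((congrArg _ h).trans (P_hom_app g p).symm)

def frInjApp (b : J → Paths Q) (j : J) (x : Paths Q) : (P k (b j)).obj x ⟶ (FreeRep k b).obj x :=
  ModuleCat.ofHom (Finsupp.lmapDomain k k (fun p : b j ⟶ x => (⟨j, p⟩ : Σ j, b j ⟶ x)))

theorem frInjApp_gen (b : J → Paths Q) (j : J) {x : Paths Q} (p : b j ⟶ x) :
    frInjApp b j x (pgen (k := k) p) = gen b j p := Finsupp.mapDomain_single

def frInj (b : J → Paths Q) (j : J) : P k (b j) ⟶ FreeRep k b where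
  app x := frInjApp b j x
  naturality x y q := by
    apply P_app_ext
    intro p
    rw [ModuleCat.comp_apply, ModuleCat.comp_apply, P_map_gen, frInjApp_gen, frInjApp_gen, map_gen]

theorem frInj_gen (b : J → Paths Q) (j : J) {x : Paths Q} (p : b j ⟶ x) :
    (frInj b j).app x (pgen (k := k) p) = gen b j p := frInjApp_gen b j p

def frColim (b : J → Paths Q) : IsColimit (Cofan.mk (FreeRep k b) (frInj b)) :=
  Cofan.IsColimit.mk _ (fun s => desc fun j => (s.inj j).app (b j) (pgen (𝟙 _)))
    (fun s j => P_hom_ext ((congrArg ((desc fun j => (s.inj j).app (b j) (pgen (𝟙 _))).app (b j))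
      (frInj_gen b j (𝟙 _))).trans (desc_gen_nil _ j)))
    (fun s m hm => Fr_hom_ext fun j => by
      rw [desc_gen_nil, ← hm j, ← frInj_gen]
      rfl)

def frIso [Finite J] (b : J → Paths Q) : FreeRep k b ≅ ∐ fun j => P k (b j) :=
  (frColim b).coconePointUniqueUpToIso (coproductIsCoproduct _)

/-- finite free -/
def IsFree : ObjectProperty (QuiverRep k Q) := fun M =>
  ∃ (n : ℕ) (b : Fin n → Paths Q), Nonempty (M ≅ FreeRep k b)

theorem isFree_of_iso {J : Type} [Finite J] (b : J → Paths Q) {M : QuiverRep k Q}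
    (e : M ≅ ∐ fun j => P k (b j)) : IsFree M := by
  obtain ⟨n, ⟨f⟩⟩ := Finite.exists_equiv_fin J
  exact ⟨n, fun i => b (f.symm i), ⟨e ≪≫ (Sigma.reindex f.symm (fun j => P k (b j))).symm ≪≫ (frIso _).symm⟩⟩

def tensF (a : Paths Q) : ModuleCat.{u} k ⥤ QuiverRep k Q :=
  MonoidalCategory.tensoringRight (ModuleCat.{u} k) ⋙
    (Functor.whiskeringLeft (Paths Q) _ _).obj (P k a)

instance (a : Paths Q) : (tensF (k := k) a).Additive where
  map_add {U V f g} := by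
    ext x : 2
    exact MonoidalPreadditive.whiskerLeft_add _ _

def tensUnit (a : Paths Q) : tens (P k a) (MonoidalCategoryStruct.tensorUnit (ModuleCat.{u} k)) ≅ P k a :=
  Functor.isoWhiskerLeft (P k a) (MonoidalCategory.rightUnitorNatIso (ModuleCat.{u} k)) ≪≫
    Functor.rightUnitor _

def unitPow (U : ModuleCat.{u} k) [Module.Finite k U] :
    U ≅ ⨁ fun _ : Fin (Module.finrank k U) => MonoidalCategoryStruct.tensorUnit (ModuleCat.{u} k) :=
  (Module.finBasis k U).equivFun.toModuleIso ≪≫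
   (ModuleCat.biproductIsoPi (fun _ : Fin (Module.finrank k U) => MonoidalCategoryStruct.tensorUnit (ModuleCat.{u} k))).symm

attribute [local instance] HasFiniteBiproducts.of_hasFiniteProducts

def tensIso (a : Paths Q) (U : ModuleCat.{u} k) [Module.Finite k U] :
    tens (P k a) U ≅ ∐ fun _ : Fin (Module.finrank k U) => P k a :=
  (tensF a).mapIso (unitPow U) ≪≫
    (Functor.mapBiproduct (tensF a) (fun _ : Fin (Module.finrank k U) => MonoidalCategoryStruct.tensorUnit (ModuleCat.{u} k))) ≪≫
    biproduct.isoCoproduct _ ≪≫ Sigma.mapIso (fun _ => tensUnit a)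

theorem finite_of_lfd {a : Paths Q} {U : ModuleCat.{u} k}
   (h : Module.Finite k ((tens (P k a) U).obj a)) : Module.Finite k U := by
  change Module.Finite k (TensorProduct k ((P k a).obj a) U) at h
  let f : U →ₗ[k] TensorProduct k ((P k a).obj a) U := TensorProduct.mk k _ _ (pgen (𝟙 a))
  let g : TensorProduct k ((P k a).obj a) U →ₗ[k] U :=
    (TensorProduct.lid k U).toLinearMap ∘ₗ
    LinearMap.rTensor U (Finsupp.lapply (M := k) (R := k) (𝟙 a) : ((a ⟶ a) →₀ k) →ₗ[k] k)
  have : ∀ u, g (f u) = u := by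
    intro u
    have : (Finsupp.single (𝟙 a) (1 : k)) (𝟙 a) • u = u := by simp
    exact this
  exact Module.Finite.of_surjective g (fun u => ⟨f u, this u⟩)

theorem isFree_of_isProj {M : QuiverRep k Q} (h : IsProj M) (h' : IsLocallyFiniteDimensional M) : IsFree M := by
  obtain ⟨n, a, U, ⟨e⟩⟩ := h
  have : ∀ i, Module.Finite k (U i) := fun i => finite_of_lfd (a := a i) (by
    let s : tens (P k (a i)) (U i) ⟶ M := Sigma.ι (fun i => tens (P k (a i)) (U i)) i ≫ e.inv
    have : Mono s := inferInstance
    have := h' (a i)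
    exact Module.Finite.of_injective (s.app (a i)).hom (app_inj s (a i)))
  exact isFree_of_iso (fun j : Σ i, Fin (Module.finrank k (U i)) => a j.1)
    (e ≪≫ Sigma.mapIso (fun i => tensIso (a i) (U i)) ≪≫
      sigmaSigmaIso _ (fun i (_ : Fin (Module.finrank k (U i))) => P k (a i)))

theorem isFree_iff [StronglyLocallyFinite Q] {M : QuiverRep k Q} : IsFree M ↔ IsProj M ∧ IsLocallyFiniteDimensional M := by
  refine ⟨?_, fun h => isFree_of_isProj h.1 h.2⟩
  rintro ⟨n, b, ⟨e⟩⟩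
  refine ⟨⟨n, b, fun _ => MonoidalCategoryStruct.tensorUnit (ModuleCat.{u} k), ⟨e ≪≫ frIso b ≪≫ Sigma.mapIso fun j => (tensUnit _).symm⟩⟩, fun x => ?_⟩
  have : ∀ j, Finite (b j ⟶ x) := fun j => StronglyLocallyFinite.finite_path (Q := Q) (b j) x
  have : Module.Finite k ((FreeRep k b).obj x) :=
    inferInstanceAs (Module.Finite k ((Σ j, b j ⟶ x) →₀ k))
  exact Module.Finite.of_injective (e.hom.app x).hom (app_inj e.hom x)

end Free

section Presentations

variable {A : Type*} [Category A] [Abelian A] (R : ObjectProperty A)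

/-- Quotients of objects in `R`. -/
def FG : ObjectProperty A := fun M => ∃ (F : A) (π : F ⟶ M), R F ∧ Epi π

/-- Objects with a presentation by objects in `R`. -/
def Pres : ObjectProperty A := fun M => ∃ (F : A) (π : F ⟶ M), R F ∧ Epi π ∧ FG R (kernel π)

/-- A class of projective objects closed under finite direct sums and under finitely generated
subobjects. -/
structure Good : Prop where
  proj : ∀ X, R X → Projective X
  sum : ∀ X Y, R X → R Y → R (X ⊞ Y)
  zero : ∃ Z, IsZero Z ∧ R Z
  sub : ∀ {X F F' : A} (i : X ⟶ F) (π : F' ⟶ X), Mono i → Epi π → R F → R F' → R X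

variable {R}

theorem FG.quot {M N : A} (h : FG R M) (f : M ⟶ N) [Epi f] : FG R N := by
  obtain ⟨F, π, hF, hπ⟩ := h
  exact ⟨F, π ≫ f, hF, inferInstance⟩

theorem FG.quot' {M N : A} (h : FG R M) (f : M ⟶ N) (s : N ⟶ M) (hs : s ≫ f = 𝟙 _) : FG R N := by
  have : IsSplitEpi f := ⟨⟨⟨s, hs⟩⟩⟩
  exact h.quot f

theorem FG.sum (hR : Good R) {M N : A} (h : FG R M) (h' : FG R N) : FG R (M ⊞ N) := by
  obtain ⟨F, π, hF, hπ⟩ := h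
  obtain ⟨F', π', hF', hπ'⟩ := h'
  exact ⟨F ⊞ F', biprod.map π π', hR.sum _ _ hF hF', inferInstance⟩

theorem FG.ext (hR : Good R) {M N : A} (f : M ⟶ N) [Epi f] (h : FG R (kernel f)) (h' : FG R N) :
    FG R M := by
  obtain ⟨F, π, hF, hπ⟩ := h
  obtain ⟨F', π', hF', hπ'⟩ := h'
  have := hR.proj _ hF'
  refine ⟨F ⊞ F', biprod.desc (π ≫ kernel.ι f) (Projective.factorThru π' f), hR.sum _ _ hF hF',
    Preadditive.epi_of_cancel_zero _ fun {T} g hg => ?_⟩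
  have h1 : kernel.ι f ≫ g = 0 := by
    have := biprod.inl ≫= hg
    rw [biprod.inl_desc_assoc, comp_zero, Category.assoc] at this
    exact (cancel_epi π).1 (by rw [this, comp_zero])
  have h2 : Projective.factorThru π' f ≫ g = 0 := by
    have := biprod.inr ≫= hg
    rwa [biprod.inr_desc_assoc, comp_zero] at this
  obtain ⟨l, hl⟩ := CokernelCofork.IsColimit.desc' (Abelian.epiIsCokernelOfKernel _ (kernelIsKernel f)) g h1
  have hl : f ≫ l = g := hl
  rw [← hl, Projective.factorThru_comp_assoc] at h2
  rw [← hl, (cancel_epi π').1 (h2.trans comp_zero.symm), comp_zero]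

theorem fg_kernel_snd {P M G : A} (p : P ⟶ M) (g : G ⟶ M) (h : FG R (kernel p)) :
    FG R (kernel (pullback.snd p g)) :=
  h.quot' (kernel.lift _ (pullback.lift (kernel.ι p) 0 (by simp)) (pullback.lift_snd _ _ _))
    (kernel.lift _ (kernel.ι _ ≫ pullback.fst p g) (by
      rw [Category.assoc, pullback.condition, kernel.condition_assoc, zero_comp])) (by
    rw [← cancel_mono (kernel.ι _), Category.assoc, kernel.lift_ι, Category.id_comp]
    apply pullback.hom_ext
    · rw [Category.assoc, pullback.lift_fst, kernel.lift_ι]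
    · rw [Category.assoc, pullback.lift_snd, comp_zero, kernel.condition])

theorem fg_pullback (hR : Good R) {P M G : A} (p : P ⟶ M) [Epi p] (g : G ⟶ M) (h : FG R (kernel p))
    (h' : FG R G) : FG R (pullback p g) :=
  FG.ext hR (pullback.snd p g) (fg_kernel_snd p g h) h'

theorem Pres.fg {M : A} (h : Pres R M) : FG R M := by
  obtain ⟨F, π, hF, hπ, _⟩ := h
  exact ⟨F, π, hF, hπ⟩

theorem Pres.fg_kernel (hR : Good R) {M G : A} (h : Pres R M) (g : G ⟶ M) [Epi g] (hG : FG R G) :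
    FG R (kernel g) := by
  obtain ⟨P, p, hP, hp, hk⟩ := h
  have hE := fg_pullback hR p g hk hG
  have := hR.proj _ hP
  let s : P ⟶ pullback p g := pullback.lift (𝟙 _) (Projective.factorThru p g) (by simp)
  refine hE.quot' (kernel.lift _ ((𝟙 _ - pullback.fst p g ≫ s) ≫ pullback.snd p g) ?_)
    (pullback.lift 0 (kernel.ι g) (by rw [zero_comp, kernel.condition])) ?_
  · simp only [Preadditive.sub_comp, Category.id_comp, Category.assoc]
    rw [pullback.lift_snd_assoc, Projective.factorThru_comp, pullback.condition, sub_self]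
  · rw [← cancel_mono (kernel.ι g), Category.assoc, kernel.lift_ι]
    simp only [Preadditive.sub_comp, Preadditive.comp_sub, Category.id_comp]
    rw [Category.assoc, pullback.lift_fst_assoc, pullback.lift_snd, zero_comp, sub_zero]

theorem Pres.cokernel (hR : Good R) {M N : A} (f : M ⟶ N) (hM : FG R M) (hN : Pres R N) :
    Pres R (cokernel f) := by
  obtain ⟨P, p, hP, hp, hk⟩ := hN
  refine ⟨P, p ≫ cokernel.π f, hP, inferInstance, ?_⟩
  have hI : FG R (Abelian.image f) := hM.quot (Abelian.factorThruImage f)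
  have hE := fg_pullback hR p (Abelian.image.ι f) hk hI
  refine hE.quot' (kernel.lift _ (pullback.fst _ _) ?_)
    (pullback.lift (kernel.ι _) (kernel.lift (cokernel.π f) (kernel.ι _ ≫ p) ?_) ?_) ?_
  · rw [pullback.condition_assoc, kernel.condition, comp_zero]
  · rw [Category.assoc, kernel.condition]
  · exact (kernel.lift_ι _ _ _).symm
  · rw [← cancel_mono (kernel.ι _), Category.assoc, Category.id_comp]
    exact (congrArg _ (kernel.lift_ι _ _ _)).trans (pullback.lift_fst _ _ _)

theorem Pres.sub (hR : Good R) {I N : A} (m : I ⟶ N) [Mono m] (hI : FG R I) (hN : Pres R N) :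
    Pres R I := by
  obtain ⟨P, p, hP, hp, hk⟩ := hN
  obtain ⟨F, π, hF, hπ⟩ := fg_pullback hR p m hk hI
  exact ⟨pullback p m, pullback.snd p m, hR.sub (pullback.fst p m) π inferInstance hπ hP hF,
    inferInstance, fg_kernel_snd p m hk⟩

theorem Pres.kernel (hR : Good R) {M N : A} (f : M ⟶ N) (hM : Pres R M) (hN : Pres R N) :
    Pres R (kernel f) := by
  have hI : Pres R (Abelian.image f) :=
    Pres.sub hR (Abelian.image.ι f) (hM.fg.quot (Abelian.factorThruImage f)) hN
  refine Pres.sub hR (kernel.ι f) ?_ hM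
  refine (hI.fg_kernel hR (Abelian.factorThruImage f) hM.fg).quot'
    (kernel.lift _ (kernel.ι _) ?_) (kernel.lift _ (kernel.ι f) ?_) ?_
  · exact (congrArg _ (Abelian.image.fac f).symm).trans
      (by rw [kernel.condition_assoc, zero_comp])
  · rw [← cancel_mono (Abelian.image.ι f), Category.assoc, Abelian.image.fac, kernel.condition,
      zero_comp]
  · rw [← cancel_mono (kernel.ι _), Category.assoc, Category.id_comp]
    exact (congrArg _ (kernel.lift_ι _ _ _)).trans (kernel.lift_ι _ _ _)

theorem Pres.sum (hR : Good R) {M N : A} (hM : Pres R M) (hN : Pres R N) : Pres R (M ⊞ N) := by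
  obtain ⟨P, p, hP, hp, hk⟩ := hM
  obtain ⟨P', p', hP', hp', hk'⟩ := hN
  refine ⟨P ⊞ P', biprod.map p p', hR.sum _ _ hP hP', inferInstance, ?_⟩
  refine (hk.sum hR hk').quot' (kernel.lift _ (biprod.map (kernel.ι p) (kernel.ι p')) ?_)
    (biprod.lift (kernel.lift _ (kernel.ι _ ≫ biprod.fst) ?_)
      (kernel.lift _ (kernel.ι _ ≫ biprod.snd) ?_)) ?_
  · ext <;> simp
  · rw [Category.assoc, ← biprod.map_fst, kernel.condition_assoc, zero_comp]
  · rw [Category.assoc, ← biprod.map_snd, kernel.condition_assoc, zero_comp]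
  · rw [← cancel_mono (kernel.ι _), Category.assoc, kernel.lift_ι, Category.id_comp]
    apply biprod.hom_ext <;> simp

theorem Pres.of_iso {M N : A} (e : M ≅ N) (hM : Pres R M) : Pres R N := by
  obtain ⟨P, p, hP, hp, hk⟩ := hM
  refine ⟨P, p ≫ e.hom, hP, inferInstance, hk.quot' (kernel.lift _ (kernel.ι p) ?_)
    (kernel.lift _ (kernel.ι _) ?_) ?_⟩
  · rw [kernel.condition_assoc, zero_comp]
  · rw [← cancel_mono e.hom, Category.assoc, kernel.condition, zero_comp]
  · rw [← cancel_mono (kernel.ι _), Category.assoc, kernel.lift_ι, kernel.lift_ι,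
      Category.id_comp]

theorem Pres.zero (hR : Good R) : ∃ Z, IsZero Z ∧ Pres R Z := by
  obtain ⟨Z, hZ, h⟩ := hR.zero
  refine ⟨Z, hZ, Z, 𝟙 Z, h, inferInstance, Z, 0, h, ?_⟩
  have : IsZero (Limits.kernel (𝟙 Z)) := IsZero.of_mono (kernel.ι _) hZ
  exact ⟨fun _ _ _ => this.eq_of_src _ _⟩

theorem Pres.of_le {R' : ObjectProperty A} (hR : Good R) (hR' : R' = Pres R) :
    R'.ContainsZero ∧ R'.IsClosedUnderKernels ∧ R'.IsClosedUnderCokernels ∧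
      R'.IsClosedUnderFiniteProducts := by
  subst hR'
  have h1 : (Pres R).ContainsZero := ⟨Pres.zero hR⟩
  have h2 : (Pres R).IsClosedUnderIsomorphisms := ⟨fun e h => h.of_iso e⟩
  have h3 : (Pres R).IsClosedUnderKernels := ⟨by
    rintro _ ⟨f, c, hc, hf⟩
    exact (Pres.kernel hR f hf.1 hf.2).of_iso ((kernelIsKernel f).conePointUniqueUpToIso hc)⟩
  have h4 : (Pres R).IsClosedUnderCokernels := ⟨by
    rintro _ ⟨f, c, hc, hf⟩
    exact (Pres.cokernel hR f hf.1.fg hf.2).of_iso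
      ((cokernelIsCokernel f).coconePointUniqueUpToIso hc)⟩
  have h5 : (Pres R).IsClosedUnderBinaryProducts := ⟨by
    rintro X ⟨p⟩
    refine (Pres.sum hR (p.prop_diag_obj (.mk .left)) (p.prop_diag_obj (.mk .right))).of_iso ?_
    exact IsLimit.conePointUniqueUpToIso (BinaryBiproduct.isLimit _ _)
      ((IsLimit.postcomposeHomEquiv (diagramIsoPair p.diag) _).2 p.isLimit)⟩
  exact ⟨h1, h3, h4, .mk'⟩

end Presentations

section Abelian

variable {k Q : Type u} [Field k] [Quiver.{u} Q]

theorem isFree_sum {n m : ℕ} (b : Fin n → Paths Q) (c : Fin m → Paths Q) :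
    IsFree (FreeRep k b ⊞ FreeRep k c) := by
  let d : Fin n ⊕ Fin m → Paths Q := Sum.elim b c
  let f : FreeRep k d ⟶ FreeRep k b ⊞ FreeRep k c := desc fun j => match j with
    | .inl j => (biprod.inl : FreeRep k b ⟶ FreeRep k b ⊞ FreeRep k c).app (b j) (gen b j (𝟙 _))
    | .inr j => (biprod.inr : FreeRep k c ⟶ FreeRep k b ⊞ FreeRep k c).app (c j) (gen c j (𝟙 _))
  let g₁ : FreeRep k b ⟶ FreeRep k d := desc fun j => gen d (.inl j) (𝟙 _)
  let g₂ : FreeRep k c ⟶ FreeRep k d := desc fun j => gen d (.inr j) (𝟙 _)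
  have h₁ : g₁ ≫ f = biprod.inl := Fr_hom_ext fun j =>
    (congrArg (f.app (b j)) (desc_gen_nil _ j)).trans (desc_gen_nil _ (Sum.inl j : Fin n ⊕ Fin m))
  have h₂ : g₂ ≫ f = biprod.inr := Fr_hom_ext fun j =>
    (congrArg (f.app (c j)) (desc_gen_nil _ j)).trans (desc_gen_nil _ (Sum.inr j : Fin n ⊕ Fin m))
  have h₃ : f ≫ biprod.desc g₁ g₂ = 𝟙 _ := Fr_hom_ext fun j => by
    refine (congrArg ((biprod.desc g₁ g₂).app (d j)) (desc_gen_nil _ j)).trans ?_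
    rcases j with j | j
    · exact (congrArg (fun h : FreeRep k b ⟶ FreeRep k d => h.app (b j) (gen b j (𝟙 _)))
        (biprod.inl_desc g₁ g₂)).trans
        (desc_gen_nil (M := FreeRep k d) (fun j => gen d (.inl j) (𝟙 (b j))) j)
    · exact (congrArg (fun h : FreeRep k c ⟶ FreeRep k d => h.app (c j) (gen c j (𝟙 _)))
        (biprod.inr_desc g₁ g₂)).trans
        (desc_gen_nil (M := FreeRep k d) (fun j => gen d (.inr j) (𝟙 (c j))) j)
  let e : FreeRep k d ≅ FreeRep k b ⊞ FreeRep k c := ⟨f, biprod.desc g₁ g₂, h₃, by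
    apply biprod.hom_ext'
    · rw [biprod.inl_desc_assoc, h₁, Category.comp_id]
    · rw [biprod.inr_desc_assoc, h₂, Category.comp_id]⟩
  exact isFree_of_iso d (e.symm ≪≫ frIso d)

theorem good_isFree [StronglyLocallyFinite Q] : Good (IsFree (k := k) (Q := Q)) where
  proj := by
    rintro X ⟨n, b, ⟨e⟩⟩
    exact Projective.of_iso e.symm inferInstance
  sum := by
    rintro X Y ⟨n, b, ⟨e⟩⟩ ⟨m, c, ⟨e'⟩⟩
    obtain ⟨l, d, ⟨e''⟩⟩ := isFree_sum (k := k) b c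
    exact ⟨l, d, ⟨biprod.mapIso e e' ≪≫ e''⟩⟩
  zero := by
    refine ⟨FreeRep k Fin.elim0, ?_, 0, Fin.elim0, ⟨Iso.refl _⟩⟩
    rw [IsZero.iff_id_eq_zero]
    exact Fr_hom_ext fun j => j.elim0
  sub := by
    rintro X F F' i π hi hπ ⟨n, b, ⟨e⟩⟩ ⟨m, c, ⟨e'⟩⟩
    have : Epi (e'.inv ≫ π) := inferInstance
    exact exists_free (i ≫ e.hom) (e'.inv ≫ π)

theorem isFinitelyPresented_eq [StronglyLocallyFinite Q] : IsFinitelyPresented k Q = Pres IsFree := by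
  ext M
  constructor
  · rintro ⟨P₁, P₀, i, p, w, hS, h₁, h₀⟩
    have := hS.epi_g
    have := hS.mono_f
    refine ⟨P₀, p, isFree_iff.2 h₀, hS.epi_g, P₁, kernel.lift p i w, isFree_iff.2 h₁, ?_⟩
    exact hS.exact.epi_kernelLift
  · rintro ⟨F, π, hF, hπ, F', π', hF', hπ'⟩
    have := good_isFree.sub (kernel.ι π) π' inferInstance hπ' hF hF'
    exact ⟨kernel π, F, kernel.ι π, π, kernel.condition π,
      { exact := ShortComplex.exact_kernel π }, isFree_iff.1 this, isFree_iff.1 hF⟩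

variable (k Q)

instance [StronglyLocallyFinite Q] : (IsFinitelyPresented k Q).ContainsZero :=
  (Pres.of_le good_isFree isFinitelyPresented_eq).1

instance [StronglyLocallyFinite Q] : (IsFinitelyPresented k Q).IsClosedUnderKernels :=
  (Pres.of_le good_isFree isFinitelyPresented_eq).2.1

instance [StronglyLocallyFinite Q] : (IsFinitelyPresented k Q).IsClosedUnderCokernels :=
  (Pres.of_le good_isFree isFinitelyPresented_eq).2.2.1

instance [StronglyLocallyFinite Q] : (IsFinitelyPresented k Q).IsClosedUnderFiniteProducts :=
  (Pres.of_le good_isFree isFinitelyPresented_eq).2.2.2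

end Abelian

end QuiverRep

/-- The category `rep⁺(Q)` of finitely presented representations, as a full subcategory of the
category of all representations. It is abelian by the closure properties above. -/
abbrev RepPlus (k Q : Type u) [Field k] [Quiver.{u} Q] :=
  (QuiverRep.IsFinitelyPresented k Q).FullSubcategory

instance (k Q : Type u) [Field k] [Quiver.{u} Q] [StronglyLocallyFinite Q] :
    HasDerivedCategory (RepPlus k Q) :=
  HasDerivedCategory.standard _

/-- The bounded derived category `D^b(rep⁺(Q))`. -/
abbrev DbRepPlus (k Q : Type u) [Field k] [Quiver.{u} Q] [StronglyLocallyFinite Q] :=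
  DerivedCategory.Bounded (RepPlus k Q)

end

/-! Resolutions of length one by finite direct sums of the `P_a` make `rep⁺(Q)` hereditary and
Hom-finite. Hence every object of the bounded derived category is a finite direct sum of shifted
representations (`isSumOfSingles_of_amplitude`), and indecomposable representations have local
endomorphism rings (`localEnd_of_indecomposable`). An almost split triangle is encoded by its
connecting morphism `Z ⟶ X⟦1⟧`: a nonzero morphism annihilated by the non-retractions to its source
and by the non-sections from its target. When both ends have local endomorphism rings, each of these
two conditions implies the other. So it suffices to find, for each indecomposable representation
`M`, one morphism from `M` (or to `M`) satisfying one of them.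

Such morphisms come from duality, applied to a functional on `End M` that is 1 at the identity and 0
at all non-isomorphisms. Without left infinite paths the injective representations `I_b` are finite
dimensional, hence lie in `rep⁺(Q)`, and `Hom(-, I_b)` is dual to `Hom(P_b, -)`. Transposing a
resolution `P₁ ⟶ P₀` of `M` gives `I₁ ⟶ I₀`, whose cone receives the wanted morphism from `M`
(`exists_dual_right`). Without right infinite paths every `M` has finite support, and `Hom(W, M)` is
dual, through traces, to the cokernel of `Hom(F₁, W) ⟶ Hom(F₀, W)` for a suitable `F₀ ⟶ F₁` between
free objects (`exists_dual_presentation`); the cocone of this morphism maps to `M` as required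
(`exists_dual_left`).

Conversely, the connecting morphism of an almost split triangle starting at `P_{x₀}` factors through
every nonzero `P_{xₙ}⟦1⟧ ⟶ P_{x₀}⟦1⟧`, and that of one ending at `P_{x₀}` through every nonzero
`P_{x₀} ⟶ P_{xₙ}`. Along an infinite path such maps exist for all `n`, so the opposite end of the
triangle would have nonzero morphisms to, or from, infinitely many `P_{xₙ}` in a fixed degree.
Finite presentation and the finiteness of the sets of paths forbid this (`finite_nonzero_homs_to`,
`finite_nonzero_homs_from`). -/

noncomputable section

/-! ### Local endomorphism rings. -/

section LocalEndomorphisms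

variable {C : Type*} [Category C] [Preadditive C]

/-- Every endomorphism `e` of `X` is invertible, or `1 - e` is. -/
def LocalEnd (X : C) : Prop := ∀ e : X ⟶ X, IsIso e ∨ IsIso (𝟙 X - e)

/-- If `u` inverts `1 - fp`, then `1 + p u f` inverts `1 - pf`. This moves invertibility from an
outer term of a triangle to the middle one. -/
theorem isIso_one_sub_swap {X Y : C} (f : X ⟶ Y) (p : Y ⟶ X) (h : IsIso (𝟙 X - f ≫ p)) :
    IsIso (𝟙 Y - p ≫ f) := by
  have h1 : f ≫ p ≫ inv (𝟙 X - f ≫ p) = inv (𝟙 X - f ≫ p) - 𝟙 X := by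
    have := IsIso.hom_inv_id (𝟙 X - f ≫ p)
    rw [Preadditive.sub_comp, Category.id_comp, Category.assoc] at this
    exact eq_sub_of_add_eq' (sub_eq_iff_eq_add.1 this).symm
  have h2 : inv (𝟙 X - f ≫ p) ≫ f ≫ p = inv (𝟙 X - f ≫ p) - 𝟙 X := by
    have := IsIso.inv_hom_id (𝟙 X - f ≫ p)
    rw [Preadditive.comp_sub, Category.comp_id] at this
    exact eq_sub_of_add_eq' (sub_eq_iff_eq_add.1 this).symm
  refine ⟨𝟙 Y + p ≫ inv (𝟙 X - f ≫ p) ≫ f, ?_, ?_⟩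
  · have : p ≫ f ≫ p ≫ inv (𝟙 X - f ≫ p) ≫ f = p ≫ inv (𝟙 X - f ≫ p) ≫ f - p ≫ f := by
      rw [reassoc_of% h1]; simp
    simp [this]
  · have : p ≫ inv (𝟙 X - f ≫ p) ≫ f ≫ p ≫ f = p ≫ inv (𝟙 X - f ≫ p) ≫ f - p ≫ f := by
      rw [reassoc_of% h2]; simp
    simp [this]

theorem LocalEnd.of_map {D : Type*} [Category D] [Preadditive D] (F : C ⥤ D) [F.Full]
    [F.Additive] {X : C} (h : LocalEnd X) : LocalEnd (F.obj X) := by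
  intro e
  obtain ⟨e, rfl⟩ := F.map_surjective e
  rcases h e with h | h
  · exact .inl inferInstance
  · right
    have : IsIso (F.map (𝟙 X - e)) := inferInstance
    simpa using this

theorem LocalEnd.of_iso {X Y : C} (i : X ≅ Y) (h : LocalEnd X) : LocalEnd Y := by
  intro e
  have h1 : e = i.inv ≫ (i.hom ≫ e ≫ i.inv) ≫ i.hom := by simp
  have h2 : 𝟙 Y - e = i.inv ≫ (𝟙 X - i.hom ≫ e ≫ i.inv) ≫ i.hom := by simp
  rcases h (i.hom ≫ e ≫ i.inv) with h | h
  · left; rw [h1]; infer_instance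
  · right; rw [h2]; infer_instance

omit [Preadditive C] in
theorem isSplitMono_of_isIso_comp {X Y Z : C} (f : X ⟶ Y) (g : Y ⟶ Z) (h : IsIso (f ≫ g)) :
    IsSplitMono f := ⟨⟨⟨g ≫ inv (f ≫ g), by rw [← Category.assoc, IsIso.hom_inv_id]⟩⟩⟩

omit [Preadditive C] in
theorem isSplitEpi_of_isIso_comp {X Y Z : C} (f : X ⟶ Y) (g : Y ⟶ Z) (h : IsIso (f ≫ g)) :
    IsSplitEpi g := ⟨⟨⟨inv (f ≫ g) ≫ f, by rw [Category.assoc, IsIso.inv_hom_id]⟩⟩⟩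

variable [HasBinaryBiproducts C]

/-- For a decomposition, the idempotent onto one summand or its complement is invertible, and the
projection it annihilates must vanish. Zero objects satisfy `LocalEnd`, so they are excluded
separately. -/
theorem LocalEnd.indecomposable {X : C} (h : LocalEnd X) (h0 : ¬ IsZero X) :
    Indecomposable X := by
  refine ⟨h0, fun Y Z a => ?_⟩
  have h1 : LocalEnd (Y ⊞ Z) := h.of_iso a
  rcases h1 (biprod.fst ≫ biprod.inl) with h2 | h2
  · right
    rw [IsZero.iff_id_eq_zero]
    have : (biprod.fst ≫ biprod.inl : Y ⊞ Z ⟶ Y ⊞ Z) ≫ biprod.snd = 0 := by simp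
    have h3 : (biprod.snd : Y ⊞ Z ⟶ Z) = 0 := by
      rw [← cancel_epi (biprod.fst ≫ biprod.inl : Y ⊞ Z ⟶ Y ⊞ Z), this, comp_zero]
    rw [← biprod.inr_snd (X := Y), h3, comp_zero]
  · left
    rw [IsZero.iff_id_eq_zero]
    have : (𝟙 (Y ⊞ Z) - biprod.fst ≫ biprod.inl : Y ⊞ Z ⟶ Y ⊞ Z) ≫ biprod.fst = 0 := by simp
    have h3 : (biprod.fst : Y ⊞ Z ⟶ Y) = 0 := by
      rw [← cancel_epi (𝟙 (Y ⊞ Z) - biprod.fst ≫ biprod.inl : Y ⊞ Z ⟶ Y ⊞ Z), this, comp_zero]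
    rw [← biprod.inl_fst (Y := Z), h3, comp_zero]

theorem Indecomposable.of_iso {X Y : C} (h : Indecomposable X) (e : X ≅ Y) : Indecomposable Y :=
  ⟨fun hY => h.1 (hY.of_iso e), fun A B a => h.2 A B (e ≪≫ a)⟩

end LocalEndomorphisms

/-! ### Morphisms annihilated by non-retractions or by non-sections. -/

section Killing

variable {C : Type*} [Category C] [Preadditive C]

/-- A nonzero morphism annihilated by all non-retractions to its source. -/
def KillsNonRetractions {Z Y : C} (h : Z ⟶ Y) : Prop :=
  h ≠ 0 ∧ ∀ ⦃W : C⦄ (v : W ⟶ Z), ¬ IsSplitEpi v → v ≫ h = 0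

/-- A nonzero morphism annihilated by all non-sections from its target. -/
def KillsNonSections {Z Y : C} (h : Z ⟶ Y) : Prop :=
  h ≠ 0 ∧ ∀ ⦃W : C⦄ (v : Y ⟶ W), ¬ IsSplitMono v → h ≫ v = 0

theorem KillsNonRetractions.comp {Z Y Y' : C} {h : Z ⟶ Y} (hh : KillsNonRetractions h)
    (p : Y ⟶ Y') (hp : h ≫ p ≠ 0) : KillsNonRetractions (h ≫ p) :=
  ⟨hp, fun W v hv => by rw [← Category.assoc, hh.2 v hv, zero_comp]⟩

theorem KillsNonSections.comp {Z Z' Y : C} {h : Z ⟶ Y} (hh : KillsNonSections h)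
    (p : Z' ⟶ Z) (hp : p ≫ h ≠ 0) : KillsNonSections (p ≫ h) :=
  ⟨hp, fun W v hv => by rw [Category.assoc, hh.2 v hv, comp_zero]⟩

theorem KillsNonRetractions.iso_comp {Z Z' Y : C} {h : Z ⟶ Y} (hh : KillsNonRetractions h)
    (i : Z' ≅ Z) : KillsNonRetractions (i.hom ≫ h) :=
  ⟨fun h0 => hh.1 (by rw [← cancel_epi i.hom, h0, comp_zero]), fun W v hv => by
    rw [← Category.assoc]
    refine hh.2 _ fun h => hv ?_
    obtain ⟨⟨s, hs⟩⟩ := h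
    exact ⟨⟨⟨i.hom ≫ s, by rw [← cancel_mono i.hom]; simpa using congrArg (i.hom ≫ ·) hs⟩⟩⟩⟩

theorem KillsNonSections.comp_iso {Z Y Y' : C} {h : Z ⟶ Y} (hh : KillsNonSections h)
    (i : Y ≅ Y') : KillsNonSections (h ≫ i.hom) :=
  ⟨fun h0 => hh.1 (by rw [← cancel_mono i.hom, h0, zero_comp]), fun W v hv => by
    rw [Category.assoc]
    refine hh.2 _ fun h => hv ?_
    obtain ⟨⟨s, hs⟩⟩ := h
    exact ⟨⟨⟨s ≫ i.hom, by rw [← cancel_epi i.hom]; simpa using congrArg (· ≫ i.hom) hs⟩⟩⟩⟩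

variable {D : Type*} [Category D] [Preadditive D] (F : C ⥤ D) [F.IsEquivalence] [F.Additive]

theorem KillsNonRetractions.map {Z Y : C} {h : Z ⟶ Y} (hh : KillsNonRetractions h) :
    KillsNonRetractions (F.map h) := by
  refine ⟨fun h0 => hh.1 (F.map_injective (by rw [h0, F.map_zero])), fun W v hv => ?_⟩
  let i := F.objObjPreimageIso W
  obtain ⟨v', hv'⟩ := F.map_surjective (i.hom ≫ v)
  have : F.map v' ≫ F.map h = 0 := by
    rw [← F.map_comp, hh.2 v', F.map_zero]
    rintro ⟨⟨s, hs⟩⟩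
    refine hv ⟨⟨⟨F.map s ≫ i.hom, ?_⟩⟩⟩
    rw [Category.assoc, ← hv', ← F.map_comp, hs, F.map_id]
  rwa [hv', Category.assoc, Preadditive.IsIso.comp_left_eq_zero] at this

theorem KillsNonSections.map {Z Y : C} {h : Z ⟶ Y} (hh : KillsNonSections h) :
    KillsNonSections (F.map h) := by
  refine ⟨fun h0 => hh.1 (F.map_injective (by rw [h0, F.map_zero])), fun W v hv => ?_⟩
  let i := F.objObjPreimageIso W
  obtain ⟨v', hv'⟩ := F.map_surjective (v ≫ i.inv)
  have : F.map h ≫ F.map v' = 0 := by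
    rw [← F.map_comp, hh.2 v', F.map_zero]
    rintro ⟨⟨s, hs⟩⟩
    refine hv ⟨⟨⟨i.inv ≫ F.map s, ?_⟩⟩⟩
    rw [← Category.assoc, ← hv', ← F.map_comp, hs, F.map_id]
  rwa [hv', ← Category.assoc, Preadditive.IsIso.comp_right_eq_zero] at this

end Killing

/-! ### Almost split triangles through their connecting morphisms. -/

section AlmostSplitTriangles

variable {C : Type*} [Category C] [Preadditive C] [HasZeroObject C] [HasShift C ℤ]
  [∀ n : ℤ, (shiftFunctor C n).Additive] [Pretriangulated C]
  {X Y Z : C} {f : X ⟶ Y} {g : Y ⟶ Z} {h : Z ⟶ X⟦(1 : ℤ)⟧}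

theorem exists_comp_mor₁_eq (hT : Triangle.mk f g h ∈ distTriang C) {W : C} (v : W ⟶ Y)
    (hv : v ≫ g = 0) : ∃ s : W ⟶ X, v = s ≫ f :=
  Triangle.coyoneda_exact₂ _ hT v hv

theorem exists_comp_mor₂_eq (hT : Triangle.mk f g h ∈ distTriang C) {W : C} (v : W ⟶ Z)
    (hv : v ≫ h = 0) : ∃ s : W ⟶ Y, v = s ≫ g :=
  Triangle.coyoneda_exact₃ _ hT v hv

theorem exists_mor₂_comp_eq (hT : Triangle.mk f g h ∈ distTriang C) {W : C} (v : Y ⟶ W)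
    (hv : f ≫ v = 0) : ∃ s : Z ⟶ W, v = g ≫ s :=
  Triangle.yoneda_exact₂ _ hT v hv

theorem exists_mor₁_comp_eq (hT : Triangle.mk f g h ∈ distTriang C) {W : C} (v : X ⟶ W)
    (hv : h ≫ v⟦(1 : ℤ)⟧' = 0) : ∃ s : Y ⟶ W, v = f ≫ s := by
  obtain ⟨s, hs⟩ := Triangle.yoneda_exact₂ _ (rot_of_distTriang _ (rot_of_distTriang _ hT))
    (v⟦(1 : ℤ)⟧') hv
  replace hs : v⟦(1 : ℤ)⟧' = (-(f⟦(1 : ℤ)⟧')) ≫ s := hs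
  obtain ⟨s, rfl⟩ : ∃ s' : Y ⟶ W, s'⟦(1 : ℤ)⟧' = s := (shiftFunctor C (1 : ℤ)).map_surjective s
  -- Rotating twice turns `f` into `-f⟦1⟧`, and the sign is absorbed here.
  refine ⟨-s, (shiftFunctor C (1 : ℤ)).map_injective (hs.trans ?_)⟩
  rw [(shiftFunctor C (1 : ℤ)).map_comp, (shiftFunctor C (1 : ℤ)).map_neg, Preadditive.comp_neg]
  exact Preadditive.neg_comp _ _

theorem not_isSplitEpi_of_distTriang (hT : Triangle.mk f g h ∈ distTriang C) (h0 : h ≠ 0) :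
    ¬ IsSplitEpi g := fun _ =>
  h0 ((Triangle.mor₃_eq_zero_iff_epi₂ _ hT).2 (inferInstanceAs (Epi g)))

theorem not_isSplitMono_of_distTriang (hT : Triangle.mk f g h ∈ distTriang C) (h0 : h ≠ 0) :
    ¬ IsSplitMono f := fun _ =>
  h0 ((Triangle.mor₃_eq_zero_iff_mono₁ _ hT).2 (inferInstanceAs (Mono f)))

/-- If `t ≫ g = g`, then `1 - t = p ≫ f` for some `p`. Since `f` is not a section, `f ≫ p` is not
invertible, so locality makes `1 - f ≫ p` invertible, and with it `t = 1 - p ≫ f`. -/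
theorem isRightMinimal_of_localEnd (hT : Triangle.mk f g h ∈ distTriang C) (hX : LocalEnd X)
    (h0 : h ≠ 0) : IsRightMinimal g := by
  intro t ht
  obtain ⟨p, hp⟩ := exists_comp_mor₁_eq hT (𝟙 Y - t)
    (by rw [Preadditive.sub_comp, ht, Category.id_comp, sub_self])
  have h1 : ¬ IsIso (f ≫ p) := fun h1 =>
    not_isSplitMono_of_distTriang hT h0 (isSplitMono_of_isIso_comp f p h1)
  have h2 := isIso_one_sub_swap f p ((hX (f ≫ p)).resolve_left h1)
  rwa [← hp, sub_sub_cancel] at h2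

theorem isLeftMinimal_of_localEnd (hT : Triangle.mk f g h ∈ distTriang C) (hZ : LocalEnd Z)
    (h0 : h ≠ 0) : IsLeftMinimal f := by
  intro t ht
  obtain ⟨p, hp⟩ := exists_mor₂_comp_eq hT (𝟙 Y - t)
    (by rw [Preadditive.comp_sub, ht, Category.comp_id, sub_self])
  have h1 : ¬ IsIso (p ≫ g) := fun h1 =>
    not_isSplitEpi_of_distTriang hT h0 (isSplitEpi_of_isIso_comp p g h1)
  have h2 := isIso_one_sub_swap p g ((hZ (p ≫ g)).resolve_left h1)
  rwa [← hp, sub_sub_cancel] at h2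

theorem isRightAlmostSplit_of_kills (hT : Triangle.mk f g h ∈ distTriang C)
    (hk : KillsNonRetractions h) : IsRightAlmostSplit g := by
  refine ⟨not_isSplitEpi_of_distTriang hT hk.1, fun W v hv => ?_⟩
  obtain ⟨s, hs⟩ := exists_comp_mor₂_eq hT v (hk.2 v hv)
  exact ⟨s, hs.symm⟩

theorem isLeftAlmostSplit_of_kills (hT : Triangle.mk f g h ∈ distTriang C)
    (hk : KillsNonSections h) : IsLeftAlmostSplit f := by
  refine ⟨not_isSplitMono_of_distTriang hT hk.1, fun W v hv => ?_⟩
  have h1 : h ≫ v⟦(1 : ℤ)⟧' = 0 := hk.2 _ fun h2 => hv (by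
    obtain ⟨⟨s, hs⟩⟩ := h2
    obtain ⟨s, rfl⟩ := (shiftFunctor C (1 : ℤ)).map_surjective s
    exact ⟨⟨⟨s, (shiftFunctor C (1 : ℤ)).map_injective (by simpa using hs)⟩⟩⟩)
  obtain ⟨s, hs⟩ := exists_mor₁_comp_eq hT v h1
  exact ⟨s, hs.symm⟩

/-- Nonzero morphisms ending in `X⟦1⟧` divide the connecting morphism on the left. -/
theorem IsLeftAlmostSplit.exists_comp_eq (hT : Triangle.mk f g h ∈ distTriang C)
    (hf : IsLeftAlmostSplit f) {W : C} (w : W ⟶ X⟦(1 : ℤ)⟧) (hw : w ≠ 0) :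
    ∃ s : Z ⟶ W, s ≫ w = h := by
  -- As `w ≠ 0`, the map `a : X ⟶ E` is not a section, so it factors through `f`; completing to a
  -- morphism of triangles that is the identity on `X` gives the divisor.
  obtain ⟨E, a, b, hE⟩ := distinguished_cocone_triangle₂ w
  obtain ⟨t, ht⟩ := hf.2 a (not_isSplitMono_of_distTriang hE hw)
  obtain ⟨s, -, hs⟩ := complete_distinguished_triangle_morphism _ _ hT hE (𝟙 X) t
    (ht.trans (Category.id_comp a).symm)
  refine ⟨s, hs.symm.trans ?_⟩
  change h ≫ (𝟙 X)⟦(1 : ℤ)⟧' = h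
  rw [CategoryTheory.Functor.map_id, Category.comp_id]

/-- Nonzero morphisms starting in `Z` divide the connecting morphism on the right. -/
theorem IsRightAlmostSplit.exists_comp_eq (hT : Triangle.mk f g h ∈ distTriang C)
    (hg : IsRightAlmostSplit g) {W : C} (w : Z ⟶ W) (hw : w ≠ 0) :
    ∃ s : W ⟶ X⟦(1 : ℤ)⟧, w ≫ s = h := by
  obtain ⟨E, a, b, hE⟩ := distinguished_cocone_triangle₁ w
  have ha : ¬ IsSplitEpi a := fun _ => hw ((Triangle.mor₂_eq_zero_iff_epi₁ _ hE).2
    (inferInstanceAs (Epi a)))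
  obtain ⟨t, ht⟩ := hg.2 a ha
  have h1 : a ≫ h = 0 := by
    rw [← ht, Category.assoc]
    have : g ≫ h = 0 := comp_distTriang_mor_zero₂₃ _ hT
    rw [this, comp_zero]
  obtain ⟨s, hs⟩ := exists_mor₂_comp_eq hE h h1
  exact ⟨s, hs.symm⟩

/-- Suppose `h ≫ v ≠ 0`. The first map `a` of a triangle over `h ≫ v` is not a retraction, so it
annihilates `h`, whence `h = h ≫ v ≫ s`. If `v` is not a section then `v ≫ s` is not invertible, so
`1 - v ≫ s` is, and it annihilates `h`. -/
theorem KillsNonRetractions.killsNonSections {Z Y : C} {h : Z ⟶ Y} (hk : KillsNonRetractions h)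
    (hY : LocalEnd Y) : KillsNonSections h := by
  refine ⟨hk.1, fun W v hv => ?_⟩
  by_contra h1
  obtain ⟨E, a, b, hE⟩ := distinguished_cocone_triangle₁ (h ≫ v)
  have ha : ¬ IsSplitEpi a := fun _ => h1 ((Triangle.mor₂_eq_zero_iff_epi₁ _ hE).2
    (inferInstanceAs (Epi a)))
  obtain ⟨s, hs⟩ := exists_mor₂_comp_eq hE h (hk.2 a ha)
  rw [Category.assoc] at hs
  have h2 : ¬ IsIso (v ≫ s) := fun h2 => hv (isSplitMono_of_isIso_comp v s h2)
  have h3 := (hY (v ≫ s)).resolve_left h2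
  apply hk.1
  rw [← cancel_mono (𝟙 Y - v ≫ s), zero_comp, Preadditive.comp_sub, Category.comp_id,
    ← hs, sub_self]

theorem KillsNonSections.killsNonRetractions {Z Y : C} {h : Z ⟶ Y} (hk : KillsNonSections h)
    (hZ : LocalEnd Z) : KillsNonRetractions h := by
  refine ⟨hk.1, fun W v hv => ?_⟩
  by_contra h1
  obtain ⟨E, a, b, hE⟩ := distinguished_cocone_triangle (v ≫ h)
  have ha : ¬ IsSplitMono a := fun _ => h1 ((Triangle.mor₁_eq_zero_iff_mono₂ _ hE).2
    (inferInstanceAs (Mono a)))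
  obtain ⟨s, hs⟩ := exists_comp_mor₁_eq hE h (hk.2 a ha)
  have h2 : ¬ IsIso (s ≫ v) := fun h2 => hv (isSplitEpi_of_isIso_comp s v h2)
  have h3 := (hZ (s ≫ v)).resolve_left h2
  apply hk.1
  rw [← cancel_epi (𝟙 Z - s ≫ v), comp_zero, Preadditive.sub_comp, Category.id_comp,
    Category.assoc, ← hs, sub_self]

theorem exists_isAlmostSplitTriangle {X Z : C} {h : Z ⟶ X⟦(1 : ℤ)⟧} (h1 : KillsNonSections h)
    (h2 : KillsNonRetractions h) (hX : LocalEnd X) (hZ : LocalEnd Z) :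
    ∃ (Y : C) (f : X ⟶ Y) (g : Y ⟶ Z), IsAlmostSplitTriangle (Triangle.mk f g h) := by
  obtain ⟨Y, f, g, hT⟩ := distinguished_cocone_triangle₂ h
  exact ⟨Y, f, g, hT, ⟨isLeftMinimal_of_localEnd hT hZ h1.1, isLeftAlmostSplit_of_kills hT h1⟩,
    isRightMinimal_of_localEnd hT hX h1.1, isRightAlmostSplit_of_kills hT h2⟩

theorem exists_isAlmostSplitTriangle_starting {X W : C} (hX : LocalEnd X) (hW : LocalEnd W)
    {h : W ⟶ X⟦(1 : ℤ)⟧} (hk : KillsNonSections h) :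
    ∃ (Y Z : C) (f : X ⟶ Y) (g : Y ⟶ Z) (h : Z ⟶ X⟦(1 : ℤ)⟧),
      IsAlmostSplitTriangle (Triangle.mk f g h) := by
  obtain ⟨Y, f, g, hT⟩ := exists_isAlmostSplitTriangle hk (hk.killsNonRetractions hW) hX hW
  exact ⟨Y, W, f, g, h, hT⟩

theorem exists_isAlmostSplitTriangle_ending {Z W : C} (hZ : LocalEnd Z) (hW : LocalEnd W)
    {h : Z ⟶ W} (hk : KillsNonRetractions h) :
    ∃ (X Y : C) (f : X ⟶ Y) (g : Y ⟶ Z) (h : Z ⟶ X⟦(1 : ℤ)⟧),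
      IsAlmostSplitTriangle (Triangle.mk f g h) := by
  let X := (shiftFunctor C (1 : ℤ)).objPreimage W
  let i : X⟦(1 : ℤ)⟧ ≅ W := (shiftFunctor C (1 : ℤ)).objObjPreimageIso W
  have hX1 : LocalEnd (X⟦(1 : ℤ)⟧) := hW.of_iso i.symm
  have hX : LocalEnd X := (hX1.of_map (shiftFunctor C (-1 : ℤ))).of_iso
    ((shiftShiftNeg X (1 : ℤ)))
  have hk' : KillsNonRetractions (h ≫ i.inv) := hk.comp i.inv fun h0 =>
    hk.1 (by rw [← cancel_mono i.inv, h0, zero_comp])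
  obtain ⟨Y, f, g, hT⟩ := exists_isAlmostSplitTriangle (hk'.killsNonSections hX1) hk' hX hZ
  exact ⟨X, Y, f, g, _, hT⟩

end AlmostSplitTriangles

universe w

/-! ### Stalk complexes in the bounded derived category. -/

section BoundedDerived

open DerivedCategory TStructure

variable {A : Type*} [Category A] [Abelian A] [HasDerivedCategory A]

variable (A) in
/-- Objects of `A` as complexes concentrated in degree zero. -/
def boundedSingle : A ⥤ Bounded A :=
  (t : Triangulated.TStructure (DerivedCategory A)).bounded.lift (singleFunctor A 0)
    fun _ => ⟨⟨0, inferInstance⟩, ⟨0, inferInstance⟩⟩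

def boundedSingleCompι : boundedSingle A ⋙ Bounded.ι ≅ singleFunctor A 0 := Iso.refl _

instance : (boundedSingle A).Faithful := Functor.Faithful.of_comp_iso boundedSingleCompι
instance : (boundedSingle A).Full := Functor.Full.of_comp_faithful_iso boundedSingleCompι
instance : (boundedSingle A).Additive where
  map_add := Bounded.ι.map_injective ((singleFunctor A 0).map_add)

def ιShiftSingle (M : A) (n : ℤ) :
    Bounded.ι.obj (((boundedSingle A).obj M)⟦n⟧) ≅ (singleFunctor A (-n)).obj M :=
  (Bounded.ι.commShiftIso n).app _ ≪≫
    ((singleFunctors A).shiftIso n (-n) 0 (by lia)).app M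

instance (M : A) (n : ℤ) : (Bounded.ι.obj (((boundedSingle A).obj M)⟦n⟧)).IsGE (-n) :=
  t.isGE_of_iso (ιShiftSingle M n).symm (-n)

/-- The triangle exists in the full derived category, and its connecting map descends because the
inclusion of the bounded part is fully faithful and reflects distinguished triangles. -/
theorem boundedSingle_distinguished {S : ShortComplex A} (hS : S.ShortExact) :
    ∃ δ, Triangle.mk ((boundedSingle A).map S.f) ((boundedSingle A).map S.g) δ ∈
      distTriang (Bounded A) := by
  let δ' : Bounded.ι.obj ((boundedSingle A).obj S.X₃) ⟶
    (Bounded.ι.obj ((boundedSingle A).obj S.X₁))⟦(1 : ℤ)⟧ := hS.singleδ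
  obtain ⟨δ, hδ⟩ := Bounded.ι.map_surjective
    (δ' ≫ ((Bounded.ι.commShiftIso (1 : ℤ)).app ((boundedSingle A).obj S.X₁)).inv)
  refine ⟨δ, (Bounded.ι.map_distinguished_iff _).1 ?_⟩
  refine isomorphic_distinguished _ hS.singleTriangle_distinguished _ ?_
  refine Triangle.isoMk _ _ (Iso.refl _) (Iso.refl _) (Iso.refl _)
    ((Category.comp_id _).trans (Category.id_comp _).symm)
    ((Category.comp_id _).trans (Category.id_comp _).symm) ?_
  have h1 : Bounded.ι.map δ ≫ ((Bounded.ι.commShiftIso (1 : ℤ)).app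
      ((boundedSingle A).obj S.X₁)).hom = δ' := by rw [hδ]; simp
  have h2 : (𝟙 (Bounded.ι.obj ((boundedSingle A).obj S.X₁)))⟦(1 : ℤ)⟧' = 𝟙 _ :=
    (shiftFunctor (DerivedCategory A) (1 : ℤ)).map_id _
  exact (congrArg₂ (· ≫ ·) h1 h2).trans ((Category.comp_id _).trans (Category.id_comp _).symm)

theorem shiftedHom_eq_zero_of_ext [HasExt.{w} A] {M N : A} {n : ℕ}
    (h : ∀ e : Abelian.Ext M N n, e = 0)
    (f : (boundedSingle A).obj M ⟶ ((boundedSingle A).obj N)⟦(n : ℤ)⟧) : f = 0 := by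
  let e := (Bounded.ι.commShiftIso (n : ℤ)).app ((boundedSingle A).obj N)
  let x : ShiftedHom ((singleFunctor A 0).obj M) ((singleFunctor A 0).obj N) (n : ℤ) :=
    Bounded.ι.map f ≫ e.hom
  have hx : x = 0 := by
    obtain ⟨y, hy⟩ := Abelian.Ext.homEquiv.surjective x
    rw [← hy, h y]
    exact Abelian.Ext.zero_hom M N n
  apply Bounded.ι.map_injective
  rw [Functor.map_zero, ← cancel_mono e.hom, zero_comp]
  exact hx

theorem shiftedHom_eq_zero_of_neg {M N : A} {n : ℤ} (hn : n < 0)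
    (f : (boundedSingle A).obj M ⟶ ((boundedSingle A).obj N)⟦n⟧) : f = 0 := by
  apply Bounded.ι.map_injective
  rw [Functor.map_zero]
  have : (Bounded.ι.obj ((boundedSingle A).obj M)).IsLE 0 :=
    inferInstanceAs (((singleFunctor A 0).obj M).IsLE 0)
  exact t.zero _ 0 (-n) (by lia)

end BoundedDerived

/-! ### Vanishing of morphisms under shifts. -/

section Shift

variable {C : Type*} [Category C] [Preadditive C] [HasShift C ℤ]
  [∀ n : ℤ, (shiftFunctor C n).Additive]

theorem shift_hom_eq_zero {X Y : C} {n : ℤ} (h : ∀ f : X ⟶ Y⟦n⟧, f = 0) {i j : ℤ}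
    (hij : n + i = j) (f : X⟦i⟧ ⟶ Y⟦j⟧) : f = 0 := by
  obtain ⟨g, hg⟩ := (shiftFunctor C i).map_surjective (f ≫ (shiftFunctorAdd' C n i j hij).hom.app Y)
  rw [h g, Functor.map_zero] at hg
  rw [← cancel_mono ((shiftFunctorAdd' C n i j hij).hom.app Y), ← hg, zero_comp]

end Shift
-- Splitting bounded complexes over a hereditary category.
section Decomposition

open DerivedCategory TStructure

variable {A : Type*} [Category A] [Abelian A] [HasDerivedCategory A]

/-- Finite direct sums of objects of `A` placed in degrees at least `a`. -/
inductive IsSumOfSingles (a : ℤ) : Bounded A → Prop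
  | zero {W : Bounded A} (h : IsZero W) : IsSumOfSingles a W
  | single (M : A) (n : ℤ) (h : a ≤ n) {W : Bounded A}
      (e : W ≅ ((boundedSingle A).obj M)⟦-n⟧) : IsSumOfSingles a W
  | biprod {X Y W : Bounded A} (hX : IsSumOfSingles a X) (hY : IsSumOfSingles a Y)
      (e : W ≅ X ⊞ Y) : IsSumOfSingles a W

theorem IsSumOfSingles.mono {a b : ℤ} (h : a ≤ b) {W : Bounded A} (hW : IsSumOfSingles b W) :
    IsSumOfSingles a W := by
  induction hW with
  | zero h => exact .zero h
  | single M n hn e => exact .single M n (h.trans hn) e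
  | biprod _ _ e h1 h2 => exact .biprod h1 h2 e

theorem IsSumOfSingles.hom_eq_zero {a : ℤ} {W V : Bounded A} (hW : IsSumOfSingles a W)
    (h : ∀ (M : A) (n : ℤ) (_ : a ≤ n) (f : ((boundedSingle A).obj M)⟦-n⟧ ⟶ V), f = 0)
    (f : W ⟶ V) : f = 0 := by
  induction hW with
  | zero hW => exact hW.eq_of_src _ _
  | single M n hn e => rw [← cancel_epi e.inv, h M n hn (e.inv ≫ f), comp_zero]
  | biprod _ _ e h1 h2 =>
    rw [← cancel_epi e.inv, comp_zero]
    apply biprod.hom_ext'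
    · rw [comp_zero]; exact h1 _
    · rw [comp_zero]; exact h2 _

/-- In the bounded derived category of a hereditary abelian category every object is a finite
direct sum of shifts of objects of `A`. -/
theorem isSumOfSingles_of_amplitude
    (hA : ∀ (M N : A) (n : ℤ) (_ : 2 ≤ n)
      (f : (boundedSingle A).obj M ⟶ ((boundedSingle A).obj N)⟦n⟧), f = 0)
    (m : ℕ) : ∀ (a : ℤ) (W : Bounded A), (Bounded.ι.obj W).IsGE a →
      (Bounded.ι.obj W).IsLE (a + m - 1) → IsSumOfSingles a W := by
  induction m with
  | zero =>
    intro a W h1 h2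
    refine .zero ?_
    have : IsZero (Bounded.ι.obj W) := t.isZero _ (a + (0 : ℕ) - 1) a (by simp)
    rw [IsZero.iff_id_eq_zero] at this ⊢
    exact Bounded.ι.map_injective (by rw [CategoryTheory.Functor.map_id, this, Functor.map_zero])
  | succ m ih =>
    intro a W h1 h2
    -- Split off the lowest degree `a` by truncation; the rotated triangles bound `L` from below and
    -- `G` from above.
    obtain ⟨L, G, hL, hG, f, g, δ, hT⟩ := t.exists_triangle (Bounded.ι.obj W) a (a + 1) rfl
    replace hL : L.IsLE a := ⟨hL⟩
    replace hG : G.IsGE (a + 1) := ⟨hG⟩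
    have hG1 := t.isGE_shift G (a + 1) (-1) (a + 2)
    have hL1 := t.isLE_shift L a 1 (a - 1)
    have hL' : L.IsGE a := t.isGE₂ _ (inv_rot_of_distTriang _ hT) a
      (t.isGE_of_ge (G⟦(-1 : ℤ)⟧) a (a + 2)) h1
    have hG' : G.IsLE (a + (m + 1 : ℕ) - 1) := t.isLE₂ _ (rot_of_distTriang _ hT) _ h2
      (t.isLE_of_le (L⟦(1 : ℤ)⟧) (a - 1) (a + (m + 1 : ℕ) - 1))
    let L₁ : Bounded A := ⟨L, ⟨a, hL'⟩, ⟨a, hL⟩⟩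
    let G₁ : Bounded A := ⟨G, ⟨_, hG⟩, ⟨_, hG'⟩⟩
    have hG₁ : IsSumOfSingles (a + 1) G₁ := ih (a + 1) G₁ hG (by
      have : a + (m + 1 : ℕ) - 1 = a + 1 + m - 1 := by push_cast; ring
      rwa [this] at hG')
    obtain ⟨N, ⟨e⟩⟩ := exists_iso_singleFunctor_obj_of_isGE_of_isLE L a
    have hL₁ : Nonempty (L₁ ≅ ((boundedSingle A).obj N)⟦-a⟧) :=
      ⟨Bounded.ι.preimageIso (e ≪≫ (by
        have := (ιShiftSingle N (-a)).symm
        rwa [neg_neg] at this))⟩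
    obtain ⟨e⟩ := hL₁
    obtain ⟨f, rfl⟩ := Bounded.ι.map_surjective (X := L₁) (Y := W) f
    obtain ⟨g, rfl⟩ := Bounded.ι.map_surjective (X := W) (Y := G₁) g
    obtain ⟨δ', hδ⟩ := Bounded.ι.map_surjective (X := G₁) (Y := L₁⟦(1 : ℤ)⟧)
      (δ ≫ ((Bounded.ι.commShiftIso (1 : ℤ)).app L₁).inv)
    have hT' : Triangle.mk f g δ' ∈ distTriang (Bounded A) := by
      refine (Bounded.ι.map_distinguished_iff _).1 ?_
      refine isomorphic_distinguished _ hT _ ?_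
      refine Triangle.isoMk _ _ (Iso.refl _) (Iso.refl _) (Iso.refl _)
        ((Category.comp_id _).trans (Category.id_comp _).symm)
        ((Category.comp_id _).trans (Category.id_comp _).symm) ?_
      have h1 : Bounded.ι.map δ' ≫ ((Bounded.ι.commShiftIso (1 : ℤ)).app L₁).hom = δ := by
        rw [hδ, Category.assoc, Iso.inv_hom_id]
        exact Category.comp_id _
      have h2 : (𝟙 (Bounded.ι.obj L₁))⟦(1 : ℤ)⟧' = 𝟙 _ :=
        (shiftFunctor (DerivedCategory A) (1 : ℤ)).map_id _
      exact (congrArg₂ (· ≫ ·) h1 h2).trans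
        ((Category.comp_id _).trans (Category.id_comp _).symm)
    -- By induction `G` is a sum of stalks in degrees `n ≥ a + 1`, while `L⟦1⟧` is a stalk in degree
    -- `a - 1`. The components of the connecting map are thus extensions of degree `n - a + 1 ≥ 2`,
    -- and the triangle splits.
    have hδ0 : δ' = 0 := by
      refine hG₁.hom_eq_zero (fun M n hn f => ?_) δ'
      let i : L₁⟦(1 : ℤ)⟧ ≅ ((boundedSingle A).obj N)⟦-a + 1⟧ :=
        (shiftFunctor (Bounded A) (1 : ℤ)).mapIso e ≪≫
          ((shiftFunctorAdd' (Bounded A) (-a) 1 (-a + 1) rfl).app _).symm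
      rw [← cancel_mono i.hom, zero_comp]
      exact shift_hom_eq_zero (n := n - a + 1) (hA M N _ (by lia)) (by lia) _
    obtain ⟨i, -⟩ := exists_iso_binaryBiproduct_of_distTriang _ hT' hδ0
    exact .biprod (.single N a le_rfl e) (hG₁.mono (by lia)) i

/-- Induction principle: closure under finite direct sums suffices. -/
theorem bounded_induction
    (hA : ∀ (M N : A) (n : ℤ) (_ : 2 ≤ n)
      (f : (boundedSingle A).obj M ⟶ ((boundedSingle A).obj N)⟦n⟧), f = 0)
    (R : Bounded A → Prop) (h0 : ∀ W, IsZero W → R W)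
    (h1 : ∀ (M : A) (n : ℤ) (W : Bounded A) (_ : W ≅ ((boundedSingle A).obj M)⟦n⟧), R W)
    (h2 : ∀ (X Y W : Bounded A) (_ : W ≅ X ⊞ Y), R X → R Y → R W) (W : Bounded A) : R W := by
  obtain ⟨a, ha⟩ := W.property.1
  obtain ⟨b, hb⟩ := W.property.2
  -- For `b < a` the truncation in `toNat` gives length 0, and the object is zero.
  have hb' : (Bounded.ι.obj W).IsLE (a + (b - a + 1).toNat - 1) :=
    have : (Bounded.ι.obj W).IsLE b := hb
    t.isLE_of_le (Bounded.ι.obj W) b (a + (b - a + 1).toNat - 1)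
  have := isSumOfSingles_of_amplitude hA _ a W ha hb'
  clear ha hb hb'
  induction this with
  | zero h => exact h0 _ h
  | single M n hn e => exact h1 M (-n) _ e
  | biprod hX hY e h3 h4 => exact h2 _ _ _ e h3 h4

end Decomposition

/-! ### Finite sums of objects with local endomorphism ring. -/

section LocalSummands

variable {A : Type*} [Category A] [Preadditive A] [HasBinaryBiproducts A]

/-- Finite direct sums of objects with local endomorphism ring. -/
inductive IsSumOfLocal : A → Prop
  | zero {M : A} (h : IsZero M) : IsSumOfLocal M
  | ofLocal {M : A} (h : LocalEnd M) : IsSumOfLocal M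
  | biprod {X Y M : A} (hX : IsSumOfLocal X) (hY : IsSumOfLocal Y) (e : M ≅ X ⊞ Y) :
      IsSumOfLocal M

variable {C : Type*} [Category C] [Preadditive C] (F : A ⥤ C) [F.Additive]

theorem map_biprod_total {X Y M : A} (e : M ≅ X ⊞ Y) :
    F.map (e.hom ≫ biprod.fst) ≫ F.map (biprod.inl ≫ e.inv) +
      F.map (e.hom ≫ biprod.snd) ≫ F.map (biprod.inr ≫ e.inv) = 𝟙 (F.obj M) := by
  rw [← F.map_comp, ← F.map_comp, ← F.map_add, ← F.map_id]
  congr 1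
  have : e.hom ≫ (biprod.fst ≫ biprod.inl + biprod.snd ≫ biprod.inr) ≫ e.inv = 𝟙 M := by
    rw [biprod.total, Category.id_comp, e.hom_inv_id]
  rw [← this, Preadditive.add_comp, Preadditive.comp_add]
  simp only [Category.assoc]

theorem comp_map_biprod_ne_zero {X Y M : A} (e : M ≅ X ⊞ Y) {Z : C} {h : Z ⟶ F.obj M}
    (hh : h ≠ 0) : h ≫ F.map (e.hom ≫ biprod.fst) ≠ 0 ∨ h ≫ F.map (e.hom ≫ biprod.snd) ≠ 0 := by
  by_contra! h1
  apply hh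
  rw [← Category.comp_id h, ← map_biprod_total F e, Preadditive.comp_add, ← Category.assoc, h1.1,
    ← Category.assoc, h1.2, zero_comp, zero_comp, add_zero]

theorem map_biprod_comp_ne_zero {X Y M : A} (e : M ≅ X ⊞ Y) {Z : C} {h : F.obj M ⟶ Z}
    (hh : h ≠ 0) : F.map (biprod.inl ≫ e.inv) ≫ h ≠ 0 ∨ F.map (biprod.inr ≫ e.inv) ≫ h ≠ 0 := by
  by_contra! h1
  apply hh
  rw [← Category.id_comp h, ← map_biprod_total F e, Preadditive.add_comp, Category.assoc, h1.1,
    Category.assoc, h1.2, comp_zero, comp_zero, add_zero]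

/-- A nonzero morphism to a finite direct sum has a nonzero component. The functor `F` is present so
that this applies to shifted stalk complexes. -/
theorem IsSumOfLocal.exists_comp_ne_zero {M : A} (hM : IsSumOfLocal M) {Z : C} {h : Z ⟶ F.obj M}
    (hh : h ≠ 0) : ∃ (N : A) (p : M ⟶ N), LocalEnd N ∧ h ≫ F.map p ≠ 0 := by
  induction hM with
  | zero h0 => exact absurd ((F.map_isZero h0).eq_of_tgt _ _) hh
  | @ofLocal M hM => exact ⟨M, 𝟙 M, hM, by simpa using hh⟩
  | biprod _ _ e h1 h2 =>
    rcases comp_map_biprod_ne_zero F e hh with h3 | h3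
    · obtain ⟨N, p, hN, hp⟩ := h1 h3
      exact ⟨N, _, hN, by rwa [Category.assoc, ← F.map_comp] at hp⟩
    · obtain ⟨N, p, hN, hp⟩ := h2 h3
      exact ⟨N, _, hN, by rwa [Category.assoc, ← F.map_comp] at hp⟩

theorem IsSumOfLocal.exists_map_comp_ne_zero {M : A} (hM : IsSumOfLocal M) {Z : C}
    {h : F.obj M ⟶ Z} (hh : h ≠ 0) : ∃ (N : A) (p : N ⟶ M), LocalEnd N ∧ F.map p ≫ h ≠ 0 := by
  induction hM with
  | zero h0 => exact absurd ((F.map_isZero h0).eq_of_src _ _) hh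
  | @ofLocal M hM => exact ⟨M, 𝟙 M, hM, by simpa using hh⟩
  | biprod _ _ e h1 h2 =>
    rcases map_biprod_comp_ne_zero F e hh with h3 | h3
    · obtain ⟨N, p, hN, hp⟩ := h1 h3
      exact ⟨N, _, hN, by rwa [← Category.assoc, ← F.map_comp] at hp⟩
    · obtain ⟨N, p, hN, hp⟩ := h2 h3
      exact ⟨N, _, hN, by rwa [← Category.assoc, ← F.map_comp] at hp⟩

end LocalSummands

/-! ### Reduction from the derived category to the hereditary abelian category. -/

section Hereditary

open DerivedCategory TStructure

variable {A : Type*} [Category A] [Abelian A] [HasDerivedCategory A]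

variable (A) in
/-- Extensions of degree at least two vanish. -/
def HereditaryHoms : Prop := ∀ (M N : A) (n : ℤ) (_ : 2 ≤ n)
  (f : (boundedSingle A).obj M ⟶ ((boundedSingle A).obj N)⟦n⟧), f = 0

theorem exists_iso_shift_of_indecomposable (hA : HereditaryHoms A) (W : Bounded A)
    (hW : Indecomposable W) : ∃ (M : A) (n : ℤ),
      Nonempty (W ≅ ((boundedSingle A).obj M)⟦n⟧) ∧ Indecomposable M := by
  have key : ∃ (M : A) (n : ℤ), Nonempty (W ≅ ((boundedSingle A).obj M)⟦n⟧) := by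
    revert hW
    refine bounded_induction hA (fun W => Indecomposable W → ∃ (M : A) (n : ℤ),
      Nonempty (W ≅ ((boundedSingle A).obj M)⟦n⟧)) ?_ ?_ ?_ W
    · exact fun W h0 hW => absurd h0 hW.1
    · exact fun M n W e _ => ⟨M, n, ⟨e⟩⟩
    · intro X Y W e hX hY hW
      rcases hW.2 X Y e with h | h
      · let i : W ≅ Y := e ≪≫ (isoZeroBiprod h).symm
        obtain ⟨M, n, ⟨j⟩⟩ := hY (Indecomposable.of_iso hW i)
        exact ⟨M, n, ⟨i ≪≫ j⟩⟩
      · let i : W ≅ X := e ≪≫ (isoBiprodZero h).symm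
        obtain ⟨M, n, ⟨j⟩⟩ := hX (Indecomposable.of_iso hW i)
        exact ⟨M, n, ⟨i ≪≫ j⟩⟩
  obtain ⟨M, n, ⟨e⟩⟩ := key
  let F := boundedSingle A ⋙ shiftFunctor (Bounded A) n
  refine ⟨M, n, ⟨e⟩, fun hM => hW.1 ((F.map_isZero hM).of_iso e), fun Y Z a => ?_⟩
  have := preservesBinaryBiproducts_of_preservesBiproducts F
  -- By faithfulness `F` reflects zero objects, so a proper decomposition of `M` would yield one of
  -- `W`.
  have hF : ∀ V, IsZero (F.obj V) → IsZero V := fun V hV => by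
    rw [IsZero.iff_id_eq_zero] at hV ⊢
    exact F.map_injective (by rw [F.map_id, hV, F.map_zero])
  exact (hW.2 _ _ (e ≪≫ F.mapIso a ≪≫ F.mapBiprod Y Z)).imp (hF _) (hF _)

/-- This replaces the target of a morphism killing non-retractions by one with local endomorphism
ring, since the killing property survives any nonzero composite. -/
theorem exists_comp_ne_zero (hA : HereditaryHoms A) (hL : ∀ M : A, IsSumOfLocal M)
    {Z W : Bounded A} {h : Z ⟶ W} (hh : h ≠ 0) :
    ∃ (V : Bounded A) (p : W ⟶ V), LocalEnd V ∧ h ≫ p ≠ 0 := by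
  revert hh
  refine bounded_induction hA (fun W => ∀ h : Z ⟶ W, h ≠ 0 →
    ∃ (V : Bounded A) (p : W ⟶ V), LocalEnd V ∧ h ≫ p ≠ 0) ?_ ?_ ?_ W h
  · exact fun W h0 h hh => absurd (h0.eq_of_tgt _ _) hh
  · intro M n W e h hh
    let F := boundedSingle A ⋙ shiftFunctor (Bounded A) n
    have h1 : h ≫ e.hom ≠ 0 := fun h1 => hh (by rw [← cancel_mono e.hom, h1, zero_comp])
    obtain ⟨N, p, hN, hp⟩ := (hL M).exists_comp_ne_zero F h1
    exact ⟨F.obj N, e.hom ≫ F.map p, hN.of_map F, by rwa [Category.assoc] at hp⟩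
  · intro X Y W e hX hY h hh
    rcases comp_map_biprod_ne_zero (𝟭 _) e (h := h) hh with h1 | h1
    · obtain ⟨V, p, hV, hp⟩ := hX _ h1
      exact ⟨V, _, hV, by rwa [Category.assoc] at hp⟩
    · obtain ⟨V, p, hV, hp⟩ := hY _ h1
      exact ⟨V, _, hV, by rwa [Category.assoc] at hp⟩

theorem exists_comp_ne_zero' (hA : HereditaryHoms A) (hL : ∀ M : A, IsSumOfLocal M)
    {Z W : Bounded A} {h : W ⟶ Z} (hh : h ≠ 0) :
    ∃ (V : Bounded A) (p : V ⟶ W), LocalEnd V ∧ p ≫ h ≠ 0 := by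
  revert hh
  refine bounded_induction hA (fun W => ∀ h : W ⟶ Z, h ≠ 0 →
    ∃ (V : Bounded A) (p : V ⟶ W), LocalEnd V ∧ p ≫ h ≠ 0) ?_ ?_ ?_ W h
  · exact fun W h0 h hh => absurd (h0.eq_of_src _ _) hh
  · intro M n W e h hh
    let F := boundedSingle A ⋙ shiftFunctor (Bounded A) n
    have h1 : e.inv ≫ h ≠ 0 := fun h1 => hh (by rw [← cancel_epi e.inv, h1, comp_zero])
    obtain ⟨N, p, hN, hp⟩ := (hL M).exists_map_comp_ne_zero F h1
    exact ⟨F.obj N, F.map p ≫ e.inv, hN.of_map F, by rwa [← Category.assoc] at hp⟩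
  · intro X Y W e hX hY h hh
    rcases map_biprod_comp_ne_zero (𝟭 _) e (h := h) hh with h1 | h1
    · obtain ⟨V, p, hV, hp⟩ := hX _ h1
      exact ⟨V, _, hV, by rwa [← Category.assoc] at hp⟩
    · obtain ⟨V, p, hV, hp⟩ := hY _ h1
      exact ⟨V, _, hV, by rwa [← Category.assoc] at hp⟩

theorem hom_from_shift_eq_zero {X Y : Bounded A} {n : ℤ} (h : ∀ f : X ⟶ Y⟦-n⟧, f = 0)
    (f : X⟦n⟧ ⟶ Y) : f = 0 := by
  have := shift_hom_eq_zero h (neg_add_cancel n) (f ≫ (shiftFunctorZero (Bounded A) ℤ).inv.app Y)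
  rwa [← cancel_mono ((shiftFunctorZero (Bounded A) ℤ).inv.app Y), zero_comp]

/-- A morphism to `I₀` which does not lift along `ν : I₁ ⟶ I₀`, while its composites with
non-retractions do, yields a morphism killing non-retractions. -/
theorem exists_killsNonRetractions (hA : HereditaryHoms A) (hL : ∀ M : A, IsSumOfLocal M)
    {M I₁ I₀ : A} (ν : I₁ ⟶ I₀) (θ : M ⟶ I₀)
    (hI : ∀ (N : A) (n : ℤ) (_ : n ≠ 0)
      (f : (boundedSingle A).obj N ⟶ ((boundedSingle A).obj I₀)⟦n⟧), f = 0)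
    (h1 : ¬ ∃ w : M ⟶ I₁, w ≫ ν = θ)
    (h2 : ∀ (N : A) (v : N ⟶ M), ¬ IsSplitEpi v → ∃ w : N ⟶ I₁, w ≫ ν = v ≫ θ) :
    ∃ (W : Bounded A) (h : (boundedSingle A).obj M ⟶ W), LocalEnd W ∧ KillsNonRetractions h := by
  let S := boundedSingle A
  obtain ⟨E, c, δ, hE⟩ := distinguished_cocone_triangle (S.map ν)
  have hc : S.map ν ≫ c = 0 := comp_distTriang_mor_zero₁₂ _ hE
  -- The composite with the cone of `ν` vanishes exactly on morphisms whose composite with `θ` lifts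
  -- along `ν`.
  have hk : KillsNonRetractions (S.map θ ≫ c) := by
    constructor
    · intro h0
      obtain ⟨w, hw⟩ := exists_comp_mor₁_eq hE (S.map θ) h0
      obtain ⟨w, rfl⟩ := S.map_surjective w
      exact h1 ⟨w, S.map_injective (by rw [hw, S.map_comp])⟩
    · intro W
      refine bounded_induction hA (fun W => ∀ v : W ⟶ S.obj M, ¬ IsSplitEpi v →
        v ≫ S.map θ ≫ c = 0) ?_ ?_ ?_ W
      · exact fun W h0 v _ => h0.eq_of_src _ _
      · intro N n W e v hv
        have hv' : ¬ IsSplitEpi (e.inv ≫ v) := fun h => hv (by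
          have : v = e.hom ≫ e.inv ≫ v := by simp
          rw [this]; infer_instance)
        rw [← cancel_epi e.inv, comp_zero, ← Category.assoc]
        generalize e.inv ≫ v = v at hv'
        -- In degree zero the lifting hypothesis `h2` applies; from any other degree there are no
        -- nonzero morphisms to `I₀`, by `hI`.
        by_cases hn : n = 0
        · subst hn
          let i := (shiftFunctorZero (Bounded A) ℤ).app (S.obj N)
          obtain ⟨v', hv1⟩ := S.map_surjective (i.inv ≫ v)
          have hv2 : ¬ IsSplitEpi v' := fun h => hv' (by
            have : v = i.hom ≫ S.map v' := by rw [hv1]; simp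
            rw [this]; infer_instance)
          obtain ⟨w, hw⟩ := h2 N v' hv2
          rw [← cancel_epi i.inv, comp_zero, ← Category.assoc, ← hv1, ← Category.assoc,
            ← S.map_comp, ← hw, S.map_comp, Category.assoc, hc, comp_zero]
        · rw [← Category.assoc, hom_from_shift_eq_zero (hI N (-n) (by lia)) (v ≫ S.map θ),
            zero_comp]
      · intro X Y W e hX hY v hv
        have h3 : ∀ {X' : Bounded A} (a : X' ⟶ W), ¬ IsSplitEpi (a ≫ v) := fun a h =>
          hv ⟨⟨⟨section_ (a ≫ v) ≫ a, by rw [Category.assoc, IsSplitEpi.id]⟩⟩⟩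
        rw [← cancel_epi e.inv, comp_zero]
        apply biprod.hom_ext'
        · rw [comp_zero]
          simpa using hX ((biprod.inl ≫ e.inv) ≫ v) (h3 _)
        · rw [comp_zero]
          simpa using hY ((biprod.inr ≫ e.inv) ≫ v) (h3 _)
  obtain ⟨V, p, hV, hp⟩ := exists_comp_ne_zero hA hL hk.1
  exact ⟨V, _, hV, hk.comp p hp⟩

/-- A morphism from `F₀` which does not extend along `d : F₀ ⟶ F₁`, while its composites with
non-sections do, yields a morphism killing non-sections. -/
theorem exists_killsNonSections (hA : HereditaryHoms A) (hL : ∀ M : A, IsSumOfLocal M)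
    {M F₀ F₁ : A} (d : F₀ ⟶ F₁) (θ : F₀ ⟶ M)
    (hF : ∀ (N : A) (n : ℤ) (_ : n ≠ 0)
      (f : (boundedSingle A).obj F₀ ⟶ ((boundedSingle A).obj N)⟦n⟧), f = 0)
    (h1 : ¬ ∃ w : F₁ ⟶ M, d ≫ w = θ)
    (h2 : ∀ (N : A) (v : M ⟶ N), ¬ IsSplitMono v → ∃ w : F₁ ⟶ N, d ≫ w = θ ≫ v) :
    ∃ (W : Bounded A) (h : W ⟶ (boundedSingle A).obj M), LocalEnd W ∧ KillsNonSections h := by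
  let S := boundedSingle A
  -- Dually, precomposition with the cocone of `d` annihilates exactly the morphisms from `F₀` that
  -- extend along `d`.
  obtain ⟨E, c, δ, hE⟩ := distinguished_cocone_triangle₁ (S.map d)
  have hc : c ≫ S.map d = 0 := comp_distTriang_mor_zero₁₂ _ hE
  have hk : KillsNonSections (c ≫ S.map θ) := by
    constructor
    · intro h0
      obtain ⟨w, hw⟩ := exists_mor₂_comp_eq hE (S.map θ) h0
      obtain ⟨w, rfl⟩ := S.map_surjective w
      exact h1 ⟨w, S.map_injective (by rw [hw, S.map_comp])⟩
    · intro W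
      refine bounded_induction hA (fun W => ∀ v : S.obj M ⟶ W, ¬ IsSplitMono v →
        (c ≫ S.map θ) ≫ v = 0) ?_ ?_ ?_ W
      · exact fun W h0 v _ => h0.eq_of_tgt _ _
      · intro N n W e v hv
        have hv' : ¬ IsSplitMono (v ≫ e.hom) := fun h => hv (by
          have : v = (v ≫ e.hom) ≫ e.inv := by simp
          rw [this]; infer_instance)
        rw [← cancel_mono e.hom, zero_comp, Category.assoc]
        generalize v ≫ e.hom = v at hv'
        by_cases hn : n = 0
        · subst hn
          let i := (shiftFunctorZero (Bounded A) ℤ).app (S.obj N)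
          obtain ⟨v', hv1⟩ := S.map_surjective (v ≫ i.hom)
          have hv2 : ¬ IsSplitMono v' := fun h => hv' (by
            have : v = S.map v' ≫ i.inv := by rw [hv1]; simp
            rw [this]; infer_instance)
          obtain ⟨w, hw⟩ := h2 N v' hv2
          rw [← cancel_mono i.hom, zero_comp, Category.assoc, ← hv1, Category.assoc,
            ← S.map_comp, ← hw, S.map_comp, ← Category.assoc, hc, zero_comp]
        · rw [Category.assoc, hF N n hn (S.map θ ≫ v), comp_zero]
      · intro X Y W e hX hY v hv
        have h3 : ∀ {X' : Bounded A} (a : W ⟶ X'), ¬ IsSplitMono (v ≫ a) := fun a h =>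
          hv ⟨⟨⟨a ≫ retraction (v ≫ a), by rw [← Category.assoc, IsSplitMono.id]⟩⟩⟩
        rw [← cancel_mono e.hom, zero_comp]
        apply biprod.hom_ext
        · rw [zero_comp]
          simpa using hX (v ≫ e.hom ≫ biprod.fst) (h3 _)
        · rw [zero_comp]
          simpa using hY (v ≫ e.hom ≫ biprod.snd) (h3 _)
  obtain ⟨V, p, hV, hp⟩ := exists_comp_ne_zero' hA hL hk.1
  exact ⟨V, _, hV, hk.comp p hp⟩

/-- Indecomposables are shifted representations and the shift is an equivalence, so degree zero
suffices. -/
theorem hasRightAlmostSplitTriangles_of_kills (hA : HereditaryHoms A)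
    (hl : ∀ M : A, Indecomposable M → LocalEnd M)
    (h : ∀ M : A, Indecomposable M → ∃ (W : Bounded A) (h : (boundedSingle A).obj M ⟶ W),
      LocalEnd W ∧ KillsNonRetractions h) : HasRightAlmostSplitTriangles (Bounded A) := by
  intro Z hZ
  obtain ⟨M, n, ⟨e⟩, hM⟩ := exists_iso_shift_of_indecomposable hA Z hZ
  obtain ⟨W, g, hW, hg⟩ := h M hM
  exact exists_isAlmostSplitTriangle_ending
    ((((hl M hM).of_map (boundedSingle A)).of_map (shiftFunctor _ n)).of_iso e.symm)
    (hW.of_map (shiftFunctor _ n)) ((hg.map (shiftFunctor _ n)).iso_comp e)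

theorem hasLeftAlmostSplitTriangles_of_kills (hA : HereditaryHoms A)
    (hl : ∀ M : A, Indecomposable M → LocalEnd M)
    (h : ∀ M : A, Indecomposable M → ∃ (W : Bounded A) (h : W ⟶ (boundedSingle A).obj M),
      LocalEnd W ∧ KillsNonSections h) : HasLeftAlmostSplitTriangles (Bounded A) := by
  intro X hX
  obtain ⟨M, n, ⟨e⟩, hM⟩ := exists_iso_shift_of_indecomposable hA X hX
  obtain ⟨W, g, hW, hg⟩ := h M hM
  let i : ((boundedSingle A).obj M)⟦n + 1⟧ ≅ X⟦(1 : ℤ)⟧ :=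
    (shiftFunctorAdd' (Bounded A) n 1 (n + 1) rfl).app _ ≪≫
      (shiftFunctor (Bounded A) (1 : ℤ)).mapIso e.symm
  exact exists_isAlmostSplitTriangle_starting
    ((((hl M hM).of_map (boundedSingle A)).of_map (shiftFunctor _ n)).of_iso e.symm)
    (hW.of_map (shiftFunctor _ (n + 1))) ((hg.map (shiftFunctor _ (n + 1))).comp_iso i)

end Hereditary

/-! ### Fitting's lemma and Krull-Schmidt decompositions. -/

section KrullSchmidt

/-- Fitting's lemma inside the commutative Artinian algebra `k[e]`: the powers of `x` stabilise, `x
^ (n + 1) * y = x ^ n`, and a power of `x * y` is the idempotent. -/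
theorem exists_idempotent_of_finite (k : Type*) {E : Type*} [Field k] [Ring E] [Algebra k E]
    [Module.Finite k E] (e : E) :
    ∃ f : E, f * f = f ∧ (f = 1 → IsUnit e) ∧ (f = 0 → IsNilpotent e) := by
  let S := Algebra.adjoin k {e}
  let : CommRing S := Algebra.adjoinCommRingOfComm k (by simp)
  have : IsArtinianRing S := IsArtinianRing.of_finite k S
  let x : S := ⟨e, Algebra.subset_adjoin rfl⟩
  obtain ⟨n, y, hy⟩ := IsArtinian.exists_pow_succ_smul_dvd (R := S) (M := S) x 1
  simp only [smul_eq_mul, mul_one] at hy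
  have h1 : ∀ m, x ^ n * (x * y) ^ m = x ^ n := by
    intro m
    induction m with
    | zero => simp
    | succ m ih => rw [pow_succ, ← mul_assoc, ih, ← mul_assoc, ← pow_succ, hy]
  have h2 : x ^ (n + 1) * (x * y) ^ (n + 1) = x ^ (n + 1) := by
    rw [pow_succ, mul_assoc, mul_comm x, ← mul_assoc, h1]
  -- The exponent `n + 1` keeps a factor `x` even for `n = 0`, so that `f = 1` exhibits an inverse
  -- of `x`.
  let f : S := (x * y) ^ (n + 1)
  have hf : f * f = f := by
    change (x * y) ^ (n + 1) * (x * y) ^ (n + 1) = (x * y) ^ (n + 1)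
    conv_lhs => lhs; rw [mul_pow, mul_comm]
    rw [mul_assoc, h2, mul_comm, mul_pow]
  refine ⟨(f : S), congrArg Subtype.val hf, fun h => ?_, fun h => ⟨n + 1, ?_⟩⟩
  · have h3 : f = 1 := Subtype.ext h
    have h4 : x * (y * (x * y) ^ n) = 1 := by rw [← mul_assoc, ← pow_succ']; exact h3
    exact (IsUnit.of_mul_eq_one _ h4).map S.val
  · have h3 : f = 0 := Subtype.ext h
    have h4 : x ^ (n + 1) = 0 := by rw [← h2]; change _ * f = 0; rw [h3, mul_zero]
    exact congrArg Subtype.val h4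

variable (k : Type*) [Field k] {A : Type*} [Category A] [Abelian A] [Linear k A]

/-- Splitting `p` and `1 - p` writes `M` as the direct sum of their images, one of which must be
zero. -/
theorem eq_zero_or_eq_id_of_idempotent {M : A} (hM : Indecomposable M) (p : M ⟶ M)
    (hp : p ≫ p = p) : p = 0 ∨ p = 𝟙 M := by
  obtain ⟨Y, i, e, h1, h2⟩ := IsIdempotentComplete.idempotents_split M p hp
  obtain ⟨Z, j, r, h3, h4⟩ := IsIdempotentComplete.idempotents_split M (𝟙 M - p) (by
    simp [hp])
  have h5 : i ≫ r = 0 := by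
    have : Mono j := (SplitMono.mk r h3).mono
    have : Epi e := (SplitEpi.mk i h1).epi
    rw [← cancel_mono j, ← cancel_epi e, Category.assoc, h4, ← Category.assoc, h2]
    simp [hp]
  have h6 : j ≫ e = 0 := by
    have : Mono i := (SplitMono.mk e h1).mono
    have : Epi r := (SplitEpi.mk j h3).epi
    rw [← cancel_mono i, ← cancel_epi r, Category.assoc, h2, ← Category.assoc, h4]
    simp [hp]
  let a : M ≅ Y ⊞ Z := ⟨biprod.lift e r, biprod.desc i j, by simp [h2, h4], by
    apply biprod.hom_ext' <;> apply biprod.hom_ext <;> simp [h1, h3, h5, h6]⟩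
  rcases hM.2 Y Z a with h | h
  · left; rw [← h2, h.eq_of_tgt e 0, zero_comp]
  · right
    have : 𝟙 M - p = 0 := by rw [← h4, h.eq_of_tgt r 0, zero_comp]
    exact (sub_eq_zero.1 this).symm

theorem localEnd_of_indecomposable {M : A} [Module.Finite k (M ⟶ M)] (hM : Indecomposable M) :
    LocalEnd M := by
  intro e
  have : Module.Finite k (End M) := ‹_›
  obtain ⟨f, h1, h2, h3⟩ := exists_idempotent_of_finite k (E := End M) e
  rcases eq_zero_or_eq_id_of_idempotent hM f h1 with h | h
  · right
    exact (isUnit_iff_isIso _).1 (h3 h).isUnit_one_sub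
  · left
    exact (isUnit_iff_isIso _).1 (h2 h)

/-- Block diagonal endomorphisms embed `End X × End Y` into `End M`, and `End Y` contains a nonzero
identity. This is the measure for the Krull-Schmidt induction. -/
theorem finrank_end_lt [∀ M N : A, Module.Finite k (M ⟶ N)] {X Y M : A} (e : M ≅ X ⊞ Y)
    (hY : ¬ IsZero Y) : Module.finrank k (X ⟶ X) < Module.finrank k (M ⟶ M) := by
  let f : (X ⟶ X) × (Y ⟶ Y) →ₗ[k] (M ⟶ M) :=
    { toFun := fun s => e.hom ≫ biprod.map s.1 s.2 ≫ e.inv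
      map_add' := fun s t => by
        rw [← Preadditive.comp_add, ← Preadditive.add_comp]
        congr 2
        apply biprod.hom_ext' <;> simp
      map_smul' := fun c s => by
        rw [RingHom.id_apply, ← Linear.comp_smul, ← Linear.smul_comp]
        congr 2
        apply biprod.hom_ext' <;> simp }
  have hf : Function.Injective f := by
    rw [injective_iff_map_eq_zero]
    intro s hs
    have h0 : biprod.map s.1 s.2 = 0 := by
      rw [← cancel_epi e.hom, ← cancel_mono e.inv]
      simpa [f] using hs
    have h1 := biprod.inl ≫= h0 =≫ biprod.fst
    have h2 := biprod.inr ≫= h0 =≫ biprod.snd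
    exact Prod.ext (by simpa using h1) (by simpa using h2)
  have h1 := LinearMap.finrank_le_finrank_of_injective hf
  rw [Module.finrank_prod] at h1
  have h2 : 0 < Module.finrank k (Y ⟶ Y) := by
    rw [Module.finrank_pos_iff_exists_ne_zero]
    exact ⟨𝟙 Y, fun h => hY ((IsZero.iff_id_eq_zero _).2 h)⟩
  omega

theorem isSumOfLocal_of_finite [∀ M N : A, Module.Finite k (M ⟶ N)] (M : A) :
    IsSumOfLocal M := by
  induction hn : Module.finrank k (M ⟶ M) using Nat.strong_induction_on generalizing M with
  | _ n ih =>
  subst hn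
  by_cases h0 : IsZero M
  · exact .zero h0
  by_cases hM : Indecomposable M
  · exact .ofLocal (localEnd_of_indecomposable k hM)
  obtain ⟨Y, Z, a, hY, hZ⟩ : ∃ (Y Z : A) (_ : M ≅ Y ⊞ Z), ¬ IsZero Y ∧ ¬ IsZero Z := by
    by_contra! h
    exact hM ⟨h0, fun Y Z a => or_iff_not_imp_left.2 (h Y Z a)⟩
  exact .biprod (ih _ (finrank_end_lt k a hZ) Y rfl)
    (ih _ (finrank_end_lt k (a ≪≫ biprod.braiding Y Z) hY) Z rfl) a

/-- A finite dimensional endomorphism algebra is Noetherian, so one-sided inverses are two-sided. -/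
theorem isIso_of_isSplitMono_of_finite {M : A} [Module.Finite k (M ⟶ M)] {e r : M ⟶ M}
    (h : e ≫ r = 𝟙 M) : IsIso r := by
  have : Module.Finite k (End M) := ‹_›
  have : IsNoetherianRing (End M) := isNoetherian_of_tower k inferInstance
  have h1 : (show End M from r) * (show End M from e) = 1 := h
  exact ⟨e, mul_eq_one_symm h1, h⟩

/-- A linear functional on a local endomorphism algebra, vanishing on the maximal ideal. -/
theorem exists_functional_of_localEnd {M : A} [Module.Finite k (M ⟶ M)] (hM : LocalEnd M)
    (h0 : ¬ IsZero M) : ∃ φ : (M ⟶ M) →ₗ[k] k, φ (𝟙 M) = 1 ∧ ∀ e, ¬ IsIso e → φ e = 0 := by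
  have hc : ∀ e r : M ⟶ M, ¬ IsIso e → ¬ IsIso (e ≫ r) := fun e r he h => he (by
    have h1 : e ≫ (r ≫ inv (e ≫ r)) = 𝟙 M := by rw [← Category.assoc, IsIso.hom_inv_id]
    have := isIso_of_isSplitMono_of_finite k h1
    have h2 : e = inv (r ≫ inv (e ≫ r)) := by rw [← cancel_mono (r ≫ inv (e ≫ r)), h1]; simp
    rw [h2]; infer_instance)
  -- In a local ring the non-units are closed under addition; a functional separating the identity
  -- from this subspace is then normalised.
  let m : Submodule k (M ⟶ M) :=
    { carrier := {e | ¬ IsIso e}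
      add_mem' := fun {a b} ha hb h => by
        have h1 : a ≫ inv (a + b) = 𝟙 M - b ≫ inv (a + b) := by
          rw [eq_sub_iff_add_eq, ← Preadditive.add_comp, IsIso.hom_inv_id]
        rcases hM (b ≫ inv (a + b)) with h2 | h2
        · exact hc b _ hb h2
        · rw [← h1] at h2
          exact hc a _ ha h2
      zero_mem' := fun h => h0 ((IsZero.iff_id_eq_zero _).2 (by
        rw [← cancel_epi (0 : M ⟶ M), zero_comp, zero_comp]))
      smul_mem' := fun c e he h => hc e (c • 𝟙 M) he (by simpa using h) }
  have h1 : 𝟙 M ∉ m := fun h => h inferInstance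
  obtain ⟨φ, hφ, hm⟩ := Submodule.exists_dual_map_eq_bot_of_notMem (p := m) h1 inferInstance
  refine ⟨(φ (𝟙 M))⁻¹ • φ, by simp [hφ], fun e he => ?_⟩
  have : φ e ∈ m.map φ := ⟨e, he, rfl⟩
  rw [hm, Submodule.mem_bot] at this
  simp [this]

end KrullSchmidt

/-! ### Dual functors and the Nakayama construction. -/

section Duality

variable {k : Type*} [Field k] {A : Type*} [Category A] [Abelian A] [Linear k A]

/-- `I` represents the `k`-dual of the functor corepresented by `P`. -/
def IsDualPair {P I : A} (tr : (P ⟶ I) →ₗ[k] k) : Prop :=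
  ∀ W : A, Function.Bijective (fun w : W ⟶ I => tr ∘ₗ Linear.rightComp k P w)

namespace IsDualPair

variable {P I : A} {tr : (P ⟶ I) →ₗ[k] k} (h : IsDualPair tr)
include h

theorem exists_hom {W : A} (g : (P ⟶ W) →ₗ[k] k) : ∃ w : W ⟶ I, ∀ s, tr (s ≫ w) = g s := by
  obtain ⟨w, hw⟩ := (h W).2 g
  exact ⟨w, fun s => LinearMap.congr_fun hw s⟩

theorem hom_ext {W : A} {v w : W ⟶ I} (hvw : ∀ s, tr (s ≫ v) = tr (s ≫ w)) : v = w :=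
  (h W).1 (LinearMap.ext hvw)

/-- `Hom(-, I)` is the dual of `Hom(P, -)`. A monomorphism induces an injection on `Hom(P, -)`,
whose dual is surjective; projectivity of `P` plays no role. -/
theorem injective : Injective I where
  factors {X Y} g f _ := by
    have hf : Function.Injective (Linear.rightComp k P f) := fun a b hab =>
      (cancel_mono f).1 hab
    obtain ⟨l, hl⟩ := LinearMap.dualMap_surjective_of_injective hf (tr ∘ₗ Linear.rightComp k P g)
    obtain ⟨w, hw⟩ := h.exists_hom l
    refine ⟨w, h.hom_ext fun s => ?_⟩
    rw [← Category.assoc, hw]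
    exact LinearMap.congr_fun hl s

end IsDualPair

/-- Through the trace forms, `ν` is the transpose of `d`, and `θ` represents a functional on
`Hom(P₀, M)` that extends `φ` along `π`. Lifting along `ν` means lying in the range of the transpose
of `d`, that is, vanishing on the morphisms killed by `d`. These come from `M`, where `φ` detects
the identity and ignores non-isomorphisms. -/
theorem exists_dual_right {P₁ P₀ M I₁ I₀ : A} {tr₁ : (P₁ ⟶ I₁) →ₗ[k] k} {tr₀ : (P₀ ⟶ I₀) →ₗ[k] k}
    (h₁ : IsDualPair tr₁) (h₀ : IsDualPair tr₀) (d : P₁ ⟶ P₀) (π : P₀ ⟶ M) [Epi π]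
    (hd : d ≫ π = 0) (hex : ∀ ⦃N : A⦄ (s : P₀ ⟶ N), d ≫ s = 0 → ∃ t, s = π ≫ t)
    [Module.Finite k (M ⟶ M)] (hM : LocalEnd M) (hM0 : ¬ IsZero M) :
    ∃ (ν : I₁ ⟶ I₀) (θ : M ⟶ I₀), (¬ ∃ w : M ⟶ I₁, w ≫ ν = θ) ∧
      ∀ (N : A) (v : N ⟶ M), ¬ IsSplitEpi v → ∃ w : N ⟶ I₁, w ≫ ν = v ≫ θ := by
  obtain ⟨φ, hφ1, hφ⟩ := exists_functional_of_localEnd k hM hM0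
  obtain ⟨ν, hν⟩ := h₀.exists_hom (tr₁ ∘ₗ Linear.leftComp k I₁ d)
  replace hν : ∀ s, tr₀ (s ≫ ν) = tr₁ (d ≫ s) := hν
  have hπ : Function.Injective (Linear.leftComp k M π) := fun a b hab => (cancel_epi π).1 hab
  obtain ⟨g, hg⟩ := LinearMap.dualMap_surjective_of_injective hπ φ
  replace hg : ∀ e : M ⟶ M, g (π ≫ e) = φ e := fun e => LinearMap.congr_fun hg e
  obtain ⟨θ, hθ⟩ := h₀.exists_hom g
  refine ⟨ν, θ, ?_, fun N v hv => ?_⟩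
  · rintro ⟨w, rfl⟩
    have h2 := hθ π
    rw [← Category.assoc, hν, ← Category.assoc, hd, zero_comp, map_zero] at h2
    have h3 := hg (𝟙 M)
    rw [Category.comp_id, ← h2, hφ1] at h3
    exact zero_ne_one h3
  · let D : (P₀ ⟶ N) →ₗ[k] (P₁ ⟶ N) := Linear.leftComp k N d
    let l : Module.Dual k (P₀ ⟶ N) := g ∘ₗ Linear.rightComp k P₀ v
    -- The range of a transpose is the annihilator of the kernel; a kernel element is `π ≫ t`, and
    -- `t ≫ v` is not invertible because `v` is not a retraction.
    have hl : l ∈ LinearMap.range D.dualMap := by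
      rw [LinearMap.range_dualMap_eq_dualAnnihilator_ker, Submodule.mem_dualAnnihilator]
      intro s hs
      obtain ⟨t, rfl⟩ := hex s hs
      change g ((π ≫ t) ≫ v) = 0
      rw [Category.assoc, hg]
      exact hφ _ fun h => hv (isSplitEpi_of_isIso_comp t v h)
    obtain ⟨ψ, hψ⟩ := hl
    obtain ⟨w, hw⟩ := h₁.exists_hom ψ
    refine ⟨w, h₀.hom_ext fun s => ?_⟩
    rw [← Category.assoc, hν, ← Category.assoc, hw, ← Category.assoc, hθ]
    exact LinearMap.congr_fun hψ s

/-- Pairing with `T` embeds `Hom(W, N)` in the dual of `Hom(F₀, W)`, and `hann` says that what this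
pairing annihilates extends along `d`. Choosing `θ` to induce `φ` on `End N` makes `θ ≫ v` such an
element for every non-section `v`, while `φ` is nonzero at the identity. -/
theorem exists_dual_left {F₀ F₁ N : A} (d : F₀ ⟶ F₁) (T : (F₀ ⟶ N) →ₗ[k] k)
    (hinj : ∀ ⦃W : A⦄ (f : W ⟶ N), (∀ β : F₀ ⟶ W, T (β ≫ f) = 0) → f = 0)
    (hT : ∀ γ : F₁ ⟶ N, T (d ≫ γ) = 0)
    (hann : ∀ ⦃W : A⦄ (β : F₀ ⟶ W), (∀ f : W ⟶ N, T (β ≫ f) = 0) → ∃ γ : F₁ ⟶ W, d ≫ γ = β)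
    [Module.Finite k (F₀ ⟶ N)] [Module.Finite k (N ⟶ N)] (hN : LocalEnd N) (hN0 : ¬ IsZero N) :
    ∃ θ : F₀ ⟶ N, (¬ ∃ w : F₁ ⟶ N, d ≫ w = θ) ∧
      ∀ (W : A) (v : N ⟶ W), ¬ IsSplitMono v → ∃ w : F₁ ⟶ W, d ≫ w = θ ≫ v := by
  obtain ⟨φ, hφ1, hφ⟩ := exists_functional_of_localEnd k hN hN0
  let Φ : (N ⟶ N) →ₗ[k] Module.Dual k (F₀ ⟶ N) :=
    { toFun := fun e => T ∘ₗ Linear.rightComp k F₀ e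
      map_add' := fun a b => LinearMap.ext fun β => by simp
      map_smul' := fun c a => LinearMap.ext fun β => by simp }
  have hΦ : Function.Injective Φ := by
    rw [injective_iff_map_eq_zero]
    exact fun e he => hinj e fun β => LinearMap.congr_fun he β
  obtain ⟨x, hx⟩ := LinearMap.dualMap_surjective_of_injective hΦ φ
  -- Finite dimensionality turns the functional on the dual space into evaluation at some `θ`.
  obtain ⟨θ, rfl⟩ := (Module.evalEquiv k (F₀ ⟶ N)).surjective x
  have hθ : ∀ e, T (θ ≫ e) = φ e := fun e => LinearMap.congr_fun hx e
  refine ⟨θ, ?_, fun W v hv => hann _ fun f => ?_⟩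
  · rintro ⟨w, rfl⟩
    have h := hθ (𝟙 N)
    rw [Category.comp_id, hT, hφ1] at h
    exact zero_ne_one h
  · rw [Category.assoc, hθ]
    exact hφ _ fun h => hv (isSplitMono_of_isIso_comp v f h)

end Duality

/-! ### Vanishing of extensions. -/

section ProjectiveHoms

open DerivedCategory

variable {A : Type*} [Category A] [Abelian A] [HasDerivedCategory A]

theorem hom_eq_zero_of_projective {P : A} [Projective P] (N : A) (n : ℤ) (hn : n ≠ 0)
    (f : (boundedSingle A).obj P ⟶ ((boundedSingle A).obj N)⟦n⟧) : f = 0 := by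
  let := HasExt.standard A
  rcases lt_or_gt_of_ne hn with h | h
  · exact shiftedHom_eq_zero_of_neg h f
  · obtain ⟨m, rfl⟩ : ∃ m : ℕ, n = (m + 1 : ℕ) := ⟨n.toNat - 1, by lia⟩
    exact shiftedHom_eq_zero_of_ext (fun e => Abelian.Ext.eq_zero_of_projective e) f

theorem hom_eq_zero_of_injective {I : A} [Injective I] (N : A) (n : ℤ) (hn : n ≠ 0)
    (f : (boundedSingle A).obj N ⟶ ((boundedSingle A).obj I)⟦n⟧) : f = 0 := by
  let := HasExt.standard A
  rcases lt_or_gt_of_ne hn with h | h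
  · exact shiftedHom_eq_zero_of_neg h f
  · obtain ⟨m, rfl⟩ : ∃ m : ℕ, n = (m + 1 : ℕ) := ⟨n.toNat - 1, by lia⟩
    exact shiftedHom_eq_zero_of_ext (fun e => Abelian.Ext.eq_zero_of_injective e) f

/-- Dimension shifting: a morphism `M ⟶ N⟦n⟧` vanishes on `P₀`, so it factors through `P₁⟦1⟧`, where
it has degree `n - 1 ≥ 1` and vanishes again. -/
theorem hereditaryHoms_of_resolutions
    (h : ∀ M : A, ∃ (P₁ P₀ : A) (d : P₁ ⟶ P₀) (π : P₀ ⟶ M) (w : d ≫ π = 0),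
      (ShortComplex.mk d π w).ShortExact ∧ Projective P₁ ∧ Projective P₀) :
    HereditaryHoms A := by
  intro M N n hn f
  obtain ⟨P₁, P₀, d, π, w, hS, h1, h0⟩ := h M
  obtain ⟨δ, hδ⟩ := boundedSingle_distinguished hS
  obtain ⟨s, hs⟩ := Triangle.yoneda_exact₃ _ hδ f
    (hom_eq_zero_of_projective N n (by lia) _)
  have h2 : s = 0 := shift_hom_eq_zero (n := n - 1)
    (hom_eq_zero_of_projective N (n - 1) (by lia)) (by lia) s
  rw [hs, h2]
  exact comp_zero

end ProjectiveHoms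

/-! ### Free representations on finite families. -/

namespace QuiverRep

variable {k Q : Type u} [Field k] [Quiver.{u} Q]

/-- `F` is free on the elements `g j` at the vertices `b j`. -/
def IsFreeOn {J : Type*} (b : J → Paths Q) (F : QuiverRep k Q) (g : ∀ j, F.obj (b j)) : Prop :=
  ∀ (M : QuiverRep k Q) (m : ∀ j, M.obj (b j)), ∃! φ : F ⟶ M, ∀ j, φ.app (b j) (g j) = m j

theorem map_eqToHom_congr {M : QuiverRep k Q} {J : Type*} {b : J → Paths Q}
    (m : ∀ j, M.obj (b j)) {i j : J} (h : i = j) :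
    M.map (eqToHom (congrArg b h)) (m i) = m j := by
  subst h
  simp

theorem exists_isFreeOn {J : Type*} [Finite J] (b : J → Paths Q) :
    ∃ (F : QuiverRep k Q) (g : ∀ j, F.obj (b j)), IsFree F ∧ IsFreeOn b F g := by
  obtain ⟨n, ⟨σ⟩⟩ := Finite.exists_equiv_fin J
  let c : Fin n → Paths Q := b ∘ σ.symm
  have hc : ∀ j, c (σ j) = b j := fun j => congrArg b (σ.symm_apply_apply j)
  refine ⟨FreeRep k c, fun j => gen c (σ j) (eqToHom (hc j)), ⟨n, c, ⟨Iso.refl _⟩⟩, fun M m => ?_⟩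
  refine ⟨desc fun i => m (σ.symm i), fun j => ?_, fun φ hφ => Fr_hom_ext fun i => ?_⟩
  · refine (desc_gen (fun i => m (σ.symm i)) (σ j) (eqToHom (hc j))).trans ?_
    exact map_eqToHom_congr m (σ.symm_apply_apply j)
  · refine Eq.trans ?_ (desc_gen_nil (fun i => m (σ.symm i)) i).symm
    obtain ⟨j, rfl⟩ := σ.surjective i
    have h1 := hφ j
    have h2 := Fr_hom_app φ (σ j) (eqToHom (hc j))
    rw [h1] at h2
    have h3 := congrArg (M.map (eqToHom (hc j).symm)) h2
    rw [← ModuleCat.comp_apply, ← M.map_comp, eqToHom_trans, eqToHom_refl, M.map_id,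
      ModuleCat.id_apply] at h3
    rw [← h3]
    exact map_eqToHom_congr m (σ.symm_apply_apply j).symm

variable [StronglyLocallyFinite Q]

theorem pres_of_isFree {M : QuiverRep k Q} (h : IsFree M) : Pres IsFree M := by
  refine ⟨M, 𝟙 M, h, inferInstance, ?_⟩
  obtain ⟨Z, hZ, hf⟩ := good_isFree (k := k) (Q := Q).zero
  have : IsZero (kernel (𝟙 M)) := isZero_kernel_of_mono _
  exact ⟨Z, 0, hf, ⟨fun _ _ _ => this.eq_of_src _ _⟩⟩

theorem isFinitelyPresented_iff_pres {M : QuiverRep k Q} :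
    IsFinitelyPresented k Q M ↔ Pres IsFree M := by
  rw [isFinitelyPresented_eq]

theorem isFinitelyPresented_of_isFree {M : QuiverRep k Q} (h : IsFree M) :
    IsFinitelyPresented k Q M :=
  isFinitelyPresented_iff_pres.2 (pres_of_isFree h)

end QuiverRep

/-! ### `rep⁺(Q)` is hereditary and Hom-finite. -/

namespace RepPlus

open QuiverRep

variable {k Q : Type u} [Field k] [Quiver.{u} Q] [StronglyLocallyFinite Q]

/-- Free representations as objects of `rep⁺(Q)`. -/
def free (k : Type u) {Q : Type u} [Field k] [Quiver.{u} Q] [StronglyLocallyFinite Q] {n : ℕ}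
    (b : Fin n → Paths Q) : RepPlus k Q :=
  ⟨FreeRep k b, isFinitelyPresented_of_isFree ⟨n, b, ⟨Iso.refl _⟩⟩⟩

/-- The cokernel taken among all representations is again finitely presented, so an epimorphism of
`rep⁺(Q)` already sees that it is zero. -/
theorem epi_hom {M N : RepPlus k Q} (f : M ⟶ N) [Epi f] : Epi f.hom := by
  let c : RepPlus k Q := ⟨cokernel f.hom, isFinitelyPresented_iff_pres.2
    (Pres.cokernel good_isFree f.hom (isFinitelyPresented_iff_pres.1 M.property).fg
      (isFinitelyPresented_iff_pres.1 N.property))⟩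
  let p : N ⟶ c := ObjectProperty.homMk (cokernel.π f.hom)
  have hp : p = 0 := by
    rw [← cancel_epi f, comp_zero]
    apply ObjectProperty.hom_ext
    exact cokernel.condition f.hom
  have hp' : cokernel.π f.hom = 0 := congrArg (fun x => x.hom) hp
  exact Preadditive.epi_of_cokernel_zero hp'

theorem projective_of_isFree {M : RepPlus k Q} (h : IsFree M.obj) : Projective M where
  factors {E X} f e _ := by
    have := epi_hom e
    have := good_isFree.proj _ h
    exact ⟨ObjectProperty.homMk (Projective.factorThru f.hom e.hom),
      ObjectProperty.hom_ext _ (Projective.factorThru_comp _ _)⟩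

instance {n : ℕ} (b : Fin n → Paths Q) : Projective (free k b) :=
  projective_of_isFree ⟨n, b, ⟨Iso.refl _⟩⟩

theorem shortExact_of_hom {M₁ M₂ M₃ : RepPlus k Q} (f : M₁ ⟶ M₂) (g : M₂ ⟶ M₃) (w : f ≫ g = 0)
    (w' : f.hom ≫ g.hom = 0) (h : (ShortComplex.mk f.hom g.hom w').ShortExact) :
    (ShortComplex.mk f g w).ShortExact := by
  have : Mono f := (IsFinitelyPresented k Q).ι.mono_of_mono_map h.mono_f
  have : Epi g := (IsFinitelyPresented k Q).ι.epi_of_epi_map h.epi_g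
  refine { exact := ShortComplex.exact_of_f_is_kernel _ ?_ }
  refine KernelFork.IsLimit.ofι' f w fun {W} x hx => ?_
  have hx' : x.hom ≫ g.hom = 0 := congrArg (fun y => y.hom) hx
  let l := KernelFork.IsLimit.lift' h.fIsKernel x.hom hx'
  exact ⟨ObjectProperty.homMk l.1, ObjectProperty.hom_ext _ l.2⟩

theorem exists_resolution (M : RepPlus k Q) :
    ∃ (n m : ℕ) (c : Fin n → Paths Q) (b : Fin m → Paths Q) (d : free k c ⟶ free k b)
      (π : free k b ⟶ M) (w : d ≫ π = 0), (ShortComplex.mk d π w).ShortExact := by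
  obtain ⟨P₁, P₀, i, p, w, hS, h1, h0⟩ := M.property
  obtain ⟨n, c, ⟨e₁⟩⟩ := isFree_iff.2 h1
  obtain ⟨m, b, ⟨e₀⟩⟩ := isFree_iff.2 h0
  have w' : (e₁.inv ≫ i ≫ e₀.hom) ≫ e₀.inv ≫ p = 0 := by simp [w]
  refine ⟨n, m, c, b, ObjectProperty.homMk (e₁.inv ≫ i ≫ e₀.hom),
    ObjectProperty.homMk (e₀.inv ≫ p), ObjectProperty.hom_ext _ w', ?_⟩
  refine shortExact_of_hom _ _ _ w' ?_
  exact ShortComplex.shortExact_of_iso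
    (ShortComplex.isoMk (S₁ := ShortComplex.mk i p w)
      (S₂ := ShortComplex.mk (e₁.inv ≫ i ≫ e₀.hom) (e₀.inv ≫ p) w') e₁ e₀ (Iso.refl _)
      (by simp) (by simp)) hS

theorem hereditaryHoms : HereditaryHoms (RepPlus k Q) :=
  hereditaryHoms_of_resolutions fun M => by
    obtain ⟨n, m, c, b, d, π, w, h⟩ := exists_resolution M
    exact ⟨_, _, d, π, w, h, inferInstance, inferInstance⟩

omit [StronglyLocallyFinite Q] in
theorem finite_obj (M : RepPlus k Q) (x : Paths Q) : Module.Finite k (M.obj.obj x) := by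
  obtain ⟨P₁, P₀, i, p, w, hS, h1, h0⟩ := M.property
  have := hS.epi_g
  have := h0.2 x
  exact Module.Finite.of_surjective (p.app x).hom (app_surj p x)

/-- A morphism is determined by the images of finitely many generators, which lie in finite
dimensional spaces. -/
instance finite_hom (M N : RepPlus k Q) : Module.Finite k (M ⟶ N) := by
  obtain ⟨n, m, c, b, d, π, w, h⟩ := exists_resolution M
  have := h.epi_g
  have hπ : Epi π.hom := epi_hom π
  have := fun j => finite_obj N (b j)
  let l : (M ⟶ N) →ₗ[k] (∀ j, N.obj.obj (b j)) :=
    { toFun := fun f j => (π ≫ f).hom.app (b j) (gen b j (𝟙 _))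
      map_add' := fun f g => by
        funext j
        rw [Preadditive.comp_add]
        rfl
      map_smul' := fun r f => by
        funext j
        rw [Linear.comp_smul]
        rfl }
  refine Module.Finite.of_injective l fun f g hfg => ?_
  rw [← cancel_epi π]
  apply ObjectProperty.hom_ext
  exact Fr_hom_ext fun j => congrFun hfg j

end RepPlus

/-! ### Kőnig's lemma for paths. -/

section Paths

variable {Q : Type u} [Quiver.{u} Q] [StronglyLocallyFinite Q]

/-- If infinitely many paths end at `x`, then, since `x` has finitely many incoming arrows,
infinitely many end at one of its predecessors. Iterating produces a left infinite path. -/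
theorem finite_paths_to (h : ¬ Nonempty (LeftInfinitePath Q)) (x : Q) :
    Finite (Σ y : Q, Quiver.Path y x) := by
  by_contra hx
  have key : ∀ x : {x : Q // Infinite (Σ y : Q, Quiver.Path y x)},
      ∃ (z : {x : Q // Infinite (Σ y : Q, Quiver.Path y x)}), Nonempty (z.1 ⟶ x.1) := by
    rintro ⟨x, hx⟩
    by_contra! hz
    have hz' : ∀ z : Σ z : Q, z ⟶ x, Finite (Σ y : Q, Quiver.Path y z.1) := by
      rintro ⟨z, α⟩
      by_contra hz'
      exact (hz ⟨z, not_finite_iff_infinite.1 hz'⟩).false α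
    have := StronglyLocallyFinite.finite_in x
    refine hx.not_finite (Finite.of_surjective (α := Option (Σ z : Σ z : Q, z ⟶ x, Σ y : Q, Quiver.Path y z.1))
      (fun s => s.elim ⟨x, .nil⟩ fun s => ⟨s.2.1, s.2.2.cons s.1.2⟩) ?_)
    rintro ⟨y, p⟩
    cases p with
    | nil => exact ⟨none, rfl⟩
    | cons q α => exact ⟨some ⟨⟨_, α⟩, ⟨_, q⟩⟩, rfl⟩
  choose z hz using key
  let s : ℕ → {x : Q // Infinite (Σ y : Q, Quiver.Path y x)} :=
    fun n => z^[n] ⟨x, not_finite_iff_infinite.1 hx⟩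
  exact h ⟨⟨fun n => (s n).1, fun n => by
    simp only [s, Function.iterate_succ_apply']
    exact (hz _).some⟩⟩

theorem finite_paths_from (h : ¬ Nonempty (RightInfinitePath Q)) (x : Q) :
    Finite (Σ y : Q, Quiver.Path x y) := by
  by_contra hx
  have key : ∀ x : {x : Q // Infinite (Σ y : Q, Quiver.Path x y)},
      ∃ (z : {x : Q // Infinite (Σ y : Q, Quiver.Path x y)}), Nonempty (x.1 ⟶ z.1) := by
    rintro ⟨x, hx⟩
    by_contra! hz
    have hz' : ∀ z : Σ z : Q, x ⟶ z, Finite (Σ y : Q, Quiver.Path z.1 y) := by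
      rintro ⟨z, α⟩
      by_contra hz'
      exact (hz ⟨z, not_finite_iff_infinite.1 hz'⟩).false α
    have := StronglyLocallyFinite.finite_out x
    refine hx.not_finite (Finite.of_surjective (α := Option (Σ z : Σ z : Q, x ⟶ z, Σ y : Q, Quiver.Path z.1 y))
      (fun s => s.elim ⟨x, .nil⟩ fun s => ⟨s.2.1, s.1.2.toPath.comp s.2.2⟩) ?_)
    rintro ⟨y, p⟩
    cases hp : p.length with
    | zero =>
      obtain rfl := Quiver.Path.eq_of_length_zero p hp
      obtain rfl := Quiver.Path.eq_nil_of_length_zero p hp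
      exact ⟨none, rfl⟩
    | succ n =>
      obtain ⟨z, α, q, _, rfl⟩ := Quiver.Path.eq_toPath_comp_of_length_eq_succ p hp
      exact ⟨some ⟨⟨_, α⟩, ⟨_, q⟩⟩, rfl⟩
  choose z hz using key
  let s : ℕ → {x : Q // Infinite (Σ y : Q, Quiver.Path x y)} :=
    fun n => z^[n] ⟨x, not_finite_iff_infinite.1 hx⟩
  exact h ⟨⟨fun n => (s n).1, fun n => by
    simp only [s, Function.iterate_succ_apply']
    exact (hz _).some⟩⟩

end Paths

/-! ### Finite dimensional representations are finitely presented. -/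

namespace QuiverRep

variable {k Q : Type u} [Field k] [Quiver.{u} Q]

/-- `F` is the direct sum of the representations freely generated by the spaces `V i` placed at the
vertices `b i`. -/
structure IsFreeOnSpaces {ι : Type u} (b : ι → Paths Q) (V : ι → Type u)
    [∀ i, AddCommGroup (V i)] [∀ i, Module k (V i)] (F : QuiverRep k Q)
    (u : ∀ i, V i →ₗ[k] F.obj (b i)) : Prop where
  exists_hom {M : QuiverRep k Q} (m : ∀ i, V i →ₗ[k] M.obj (b i)) :
    ∃ φ : F ⟶ M, ∀ i, (φ.app (b i)).hom ∘ₗ u i = m i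
  hom_ext {M : QuiverRep k Q} {φ ψ : F ⟶ M}
    (h : ∀ i, (φ.app (b i)).hom ∘ₗ u i = (ψ.app (b i)).hom ∘ₗ u i) : φ = ψ

/-- The generators are the vectors of bases of the `V i`; only finitely many spaces contribute any.
-/
theorem exists_isFreeOnSpaces {ι : Type u} (b : ι → Paths Q) (V : ι → Type u)
    [∀ i, AddCommGroup (V i)] [∀ i, Module k (V i)] [∀ i, Module.Finite k (V i)]
    (hV : {i | Nontrivial (V i)}.Finite) :
    ∃ (F : QuiverRep k Q) (u : ∀ i, V i →ₗ[k] F.obj (b i)), IsFree F ∧ IsFreeOnSpaces b V F u := by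
  have : Finite {i | Nontrivial (V i)} := hV
  have : Finite (Σ i, Fin (Module.finrank k (V i))) := by
    refine Finite.of_injective (β := Σ i : {i | Nontrivial (V i)}, Fin (Module.finrank k (V i)))
      (fun s => ⟨⟨s.1, Module.nontrivial_of_finrank_pos (R := k) s.2.pos⟩, s.2⟩) ?_
    rintro ⟨i, l⟩ ⟨i', l'⟩ h
    simp only [Sigma.mk.injEq, Subtype.mk.injEq] at h
    obtain ⟨rfl, h⟩ := h
    rw [eq_of_heq h]
  obtain ⟨F, g, hF, hg⟩ := exists_isFreeOn (k := k)
    (fun s : Σ i, Fin (Module.finrank k (V i)) => b s.1)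
  let e := fun i => Module.finBasis k (V i)
  refine ⟨F, fun i => (e i).constr k fun l => g ⟨i, l⟩, hF, ⟨fun {M} m => ?_, fun {M φ ψ} h => ?_⟩⟩
  · obtain ⟨φ, hφ, -⟩ := hg M fun s => m s.1 (e s.1 s.2)
    refine ⟨φ, fun i => (e i).ext fun l => ?_⟩
    rw [LinearMap.comp_apply, Module.Basis.constr_basis]
    exact hφ ⟨i, l⟩
  · refine (hg M fun s => φ.app (b s.1) (g s)).unique (fun _ => rfl) fun s => ?_
    have := LinearMap.congr_fun (h s.1) (e s.1 s.2)
    rw [LinearMap.comp_apply, LinearMap.comp_apply, Module.Basis.constr_basis] at this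
    exact this.symm

/-- Arrows of a quiver. -/
abbrev Arrow (Q : Type u) [Quiver.{u} Q] := Σ x y : Paths Q, Quiver.Hom (V := Q) x y

/-- A family of linear maps compatible with arrows is a morphism of representations. -/
def homOfArrows {M N : QuiverRep k Q} (f : ∀ x, M.obj x →ₗ[k] N.obj x)
    (h : ∀ α : Arrow Q, f α.2.1 ∘ₗ (M.map (arrowPath α.2.2)).hom =
      (N.map (arrowPath α.2.2)).hom ∘ₗ f α.1) : M ⟶ N :=
  Paths.liftNatTrans (fun x => ModuleCat.ofHom (f x)) fun {x y} α => by
    ext v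
    exact LinearMap.congr_fun (h ⟨x, y, α⟩) v

variable [StronglyLocallyFinite Q]

theorem finite_arrow_source {S : Set (Paths Q)} (hS : S.Finite) : {α : Arrow Q | α.1 ∈ S}.Finite := by
  have : Finite S := hS
  have (x : S) : Finite (Σ y : Q, Quiver.Hom (V := Q) x.1 y) :=
    StronglyLocallyFinite.finite_out (Q := Q) x.1
  refine Set.Finite.subset (Set.finite_range (fun s : Σ x : S, Σ y : Q, Quiver.Hom (V := Q) x.1 y =>
    (⟨s.1.1, s.2⟩ : Arrow Q))) ?_
  rintro ⟨x, s⟩ hx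
  exact ⟨⟨⟨x, hx⟩, s⟩, rfl⟩

theorem finite_arrow_target {S : Set (Paths Q)} (hS : S.Finite) :
    {α : Arrow Q | α.2.1 ∈ S}.Finite := by
  have : Finite S := hS
  have (y : S) : Finite (Σ x : Q, Quiver.Hom (V := Q) x y.1) :=
    StronglyLocallyFinite.finite_in (Q := Q) y.1
  refine Set.Finite.subset (Set.finite_range (fun s : Σ y : S, Σ x : Q, Quiver.Hom (V := Q) x y.1 =>
    (⟨s.2.1, s.1.1, s.2.2⟩ : Arrow Q))) ?_
  rintro ⟨x, y, α⟩ hx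
  exact ⟨⟨⟨y, hx⟩, ⟨x, α⟩⟩, rfl⟩

/-- Finite dimensional representations are finitely presented. -/
theorem isFinitelyPresented_of_finite (M : QuiverRep k Q) [∀ x, Module.Finite k (M.obj x)]
    (hM : {x | Nontrivial (M.obj x)}.Finite) : IsFinitelyPresented k Q M := by
  obtain ⟨F₀, u₀, h₀, hu₀⟩ := exists_isFreeOnSpaces (k := k) (fun x : Paths Q => x)
    (fun x => M.obj x) hM
  obtain ⟨F₁, u₁, h₁, hu₁⟩ := exists_isFreeOnSpaces (k := k) (fun α : Arrow Q => α.2.1)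
    (fun α => M.obj α.1) (finite_arrow_source hM)
  -- The standard presentation: one generator for each vector at a vertex, and for each arrow `α`
  -- and vector `v` at its source the relation identifying `α` applied to the generator `v` with the
  -- generator `αv`.
  obtain ⟨d, hd⟩ := hu₁.exists_hom (M := F₀) fun α =>
    (F₀.map (arrowPath α.2.2)).hom ∘ₗ u₀ α.1 - u₀ α.2.1 ∘ₗ (M.map (arrowPath α.2.2)).hom
  obtain ⟨π, hπ⟩ := hu₀.exists_hom (M := M) fun x => LinearMap.id
  have hdπ : d ≫ π = 0 := hu₁.hom_ext fun α => by
    ext v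
    have e1 := LinearMap.congr_fun (hd α) v
    have e2 := LinearMap.congr_fun (hπ α.2.1) (M.map (arrowPath α.2.2) v)
    have e3 := NatTrans.naturality_apply π (arrowPath α.2.2) (u₀ α.1 v)
    have e4 := LinearMap.congr_fun (hπ α.1) v
    simp only [LinearMap.comp_apply, LinearMap.sub_apply, LinearMap.id_apply] at e1 e2 e4
    change (π.app _).hom ((d.app _).hom (u₁ α v)) = 0
    rw [e1, map_sub, e2]
    refine sub_eq_zero.2 (e3.trans ?_)
    exact congrArg _ e4
  -- Identifying `M` with the cokernel suffices; injectivity of `d` is not needed. The inverse sends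
  -- a vector to the class of its generator, and the relations make it natural.
  let ψ : cokernel d ⟶ M := cokernel.desc d π hdπ
  let f : ∀ x, M.obj x →ₗ[k] (cokernel d).obj x := fun x => ((cokernel.π d).app x).hom ∘ₗ u₀ x
  let σ : M ⟶ cokernel d := homOfArrows f fun α => by
    ext v
    have e1 := LinearMap.congr_fun (hd α) v
    have e2 : (cokernel.π d).app α.2.1 (d.app α.2.1 (u₁ α v)) = 0 := by
      rw [← ModuleCat.comp_apply, ← NatTrans.comp_app, cokernel.condition]
      rfl
    have e3 := NatTrans.naturality_apply (cokernel.π d) (arrowPath α.2.2) (u₀ α.1 v)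
    simp only [LinearMap.comp_apply, LinearMap.sub_apply] at e1
    change (cokernel.π d).app α.2.1 ((d.app α.2.1).hom (u₁ α v)) = 0 at e2
    rw [e1] at e2
    change ((cokernel.π d).app α.2.1).hom _ = _ at e2
    rw [map_sub] at e2
    exact (sub_eq_zero.1 e2).symm.trans e3
  have h1 : cokernel.π d ≫ ψ ≫ σ = cokernel.π d := by
    rw [cokernel.π_desc_assoc]
    refine hu₀.hom_ext fun x => ?_
    ext v
    exact congrArg (f x) (LinearMap.congr_fun (hπ x) v)
  have h2 : ψ ≫ σ = 𝟙 _ := by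
    rw [← cancel_epi (cokernel.π d), h1, Category.comp_id]
  have h3 : σ ≫ ψ = 𝟙 _ := by
    ext x v
    have : (cokernel.π d ≫ ψ).app x (u₀ x v) = v := by
      rw [cokernel.π_desc]
      exact LinearMap.congr_fun (hπ x) v
    exact this
  exact isFinitelyPresented_iff_pres.2 ((Pres.cokernel good_isFree d (pres_of_isFree h₁).fg
    (pres_of_isFree h₀)).of_iso ⟨ψ, σ, h2, h3⟩)

end QuiverRep

/-! ### The trace pairing. -/

section Trace

variable {k U V : Type*} [Field k] [AddCommGroup U] [Module k U] [Module.Finite k U]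
  [AddCommGroup V] [Module k V]

omit [Module.Finite k U] in
theorem comp_finset_sum {ι W : Type*} [AddCommGroup W] [Module k W] (s : Finset ι) (f : V →ₗ[k] U)
    (g : ι → W →ₗ[k] V) : f ∘ₗ ∑ i ∈ s, g i = ∑ i ∈ s, f ∘ₗ g i := by
  ext
  simp [LinearMap.sum_apply]

theorem trace_comp_smulRight (f : V →ₗ[k] U) (ξ : Module.Dual k U) (v : V) :
    LinearMap.trace k U (f ∘ₗ ξ.smulRight v) = ξ (f v) := by
  have : f ∘ₗ ξ.smulRight v = ξ.smulRight (f v) := by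
    ext
    simp
  rw [this, LinearMap.trace_smulRight]

theorem eq_zero_of_trace_comp_eq_zero (f : V →ₗ[k] U)
    (h : ∀ g : U →ₗ[k] V, LinearMap.trace k U (f ∘ₗ g) = 0) : f = 0 := by
  ext v
  refine (Module.forall_dual_apply_eq_zero_iff k _).1 fun ξ => ?_
  rw [← trace_comp_smulRight, h]

/-- Only `U` is finite dimensional. By reflexivity of `U` there is a vector `f v` with `ξ (f v) = l
(ξ.smulRight v)` for all `ξ`, and rank one maps span. -/
theorem exists_trace_comp_eq (l : (U →ₗ[k] V) →ₗ[k] k) :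
    ∃ f : V →ₗ[k] U, ∀ g, l g = LinearMap.trace k U (f ∘ₗ g) := by
  let f : V →ₗ[k] U := (Module.evalEquiv k U).symm.toLinearMap ∘ₗ
    { toFun := fun v => l ∘ₗ (LinearMap.smulRightₗ (R := k) (M := V) (M₂ := U)).flip v
      map_add' := fun v w => by ext; simp
      map_smul' := fun c v => by ext; simp }
  have hf : ∀ (ξ : Module.Dual k U) v, ξ (f v) = l (ξ.smulRight v) := fun ξ v =>
    Module.apply_evalEquiv_symm_apply _ _ _ _
  refine ⟨f, fun g => ?_⟩
  let e := Module.finBasis k U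
  have hg : g = ∑ i, (e.coord i).smulRight (g (e i)) := by
    refine e.ext fun j => ?_
    simp [LinearMap.sum_apply, Finsupp.single_apply, ite_smul]
  rw [hg, comp_finset_sum, map_sum, map_sum]
  exact Finset.sum_congr rfl fun i _ => by rw [trace_comp_smulRight, hf]

end Trace

/-! ### Cofree representations and sums over arrows. -/

namespace QuiverRep

variable {k Q : Type u} [Field k] [Quiver.{u} Q]

section Cofree

variable {J : Type} (b : J → Paths Q)

/-- The product of the representations dual to the spaces of paths ending at the `b j`. -/
def CofreeRep (k : Type u) [Field k] {J : Type} (b : J → Paths Q) : QuiverRep k Q where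
  obj x := ModuleCat.of k ((Σ j, x ⟶ b j) → k)
  map {x y} p := ModuleCat.ofHom (LinearMap.funLeft k k
    (fun s : Σ j, y ⟶ b j => (⟨s.1, p ≫ s.2⟩ : Σ j, x ⟶ b j)))
  map_id x := by
    ext v s
    exact congrArg v (congrArg (Sigma.mk s.1) (Category.id_comp s.2))
  map_comp {x y z} p q := by
    ext v s
    exact congrArg v (congrArg (Sigma.mk s.1) (Category.assoc p q s.2))

/-- The coordinate of a vector of a cofree representation at a path. -/
def coord {x : Paths Q} (j : J) (p : x ⟶ b j) : (CofreeRep k b).obj x →ₗ[k] k :=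
  LinearMap.proj (R := k) (φ := fun _ : Σ j, x ⟶ b j => k) ⟨j, p⟩

variable {b}

theorem coord_ext {x : Paths Q} {v w : (CofreeRep k b).obj x}
    (h : ∀ j p, coord b j p v = coord b j p w) : v = w :=
  funext fun s => h s.1 s.2

theorem coord_map {x y : Paths Q} (p : x ⟶ y) (j : J) (q : y ⟶ b j) (v : (CofreeRep k b).obj x) :
    coord b j q ((CofreeRep k b).map p v) = coord b j (p ≫ q) v := rfl

theorem coord_eq_coord_id {x : Paths Q} (j : J) (p : x ⟶ b j) (v : (CofreeRep k b).obj x) :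
    coord b j p v = coord b j (𝟙 _) ((CofreeRep k b).map p v) := by
  rw [coord_map, Category.comp_id]

/-- Only finitely many paths end at the `b j`, so the representation is finite dimensional in total.
-/
theorem isFinitelyPresented_cofreeRep [StronglyLocallyFinite Q]
    (h : ¬ Nonempty (LeftInfinitePath Q)) [Finite J] (b : J → Paths Q) :
    IsFinitelyPresented k Q (CofreeRep k b) := by
  have (x : Paths Q) : Module.Finite k ((CofreeRep k b).obj x) := by
    have (j : J) : Finite (x ⟶ b j) := StronglyLocallyFinite.finite_path (Q := Q) x (b j)
    exact inferInstanceAs (Module.Finite k ((Σ j, x ⟶ b j) → k))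
  refine isFinitelyPresented_of_finite _ ?_
  have (j : J) : Finite (Σ x : Paths Q, x ⟶ b j) := finite_paths_to h (b j)
  refine (Set.finite_range fun s : Σ j, Σ x : Paths Q, x ⟶ b j => s.2.1).subset fun x hx => ?_
  have : Nontrivial ((Σ j, x ⟶ b j) → k) := hx
  by_contra hs
  have : IsEmpty (Σ j, x ⟶ b j) := ⟨fun s => hs ⟨⟨s.1, x, s.2⟩, rfl⟩⟩
  exact not_subsingleton ((Σ j, x ⟶ b j) → k) inferInstance

end Cofree

section Sums

variable [StronglyLocallyFinite Q]

instance fintypeArrowsTo (z : Paths Q) : Fintype (Σ x : Paths Q, Quiver.Hom (V := Q) x z) := by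
  have : Finite (Σ x : Paths Q, Quiver.Hom (V := Q) x z) :=
    StronglyLocallyFinite.finite_in (Q := Q) z
  exact Fintype.ofFinite _

instance fintypeArrowsFrom (z : Paths Q) : Fintype (Σ y : Paths Q, Quiver.Hom (V := Q) z y) := by
  have : Finite (Σ y : Paths Q, Quiver.Hom (V := Q) z y) :=
    StronglyLocallyFinite.finite_out (Q := Q) z
  exact Fintype.ofFinite _

/-- With `sum_arrows_from`, this turns sums over vertices of incoming and outgoing arrows into sums
over one index set, where they can be compared term by term. -/
theorem sum_arrows_to {R : Type*} [AddCommMonoid R] (S : Finset (Paths Q)) (t : Arrow Q → R)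
    (ht : ∀ α, t α ≠ 0 → α.2.1 ∈ S) :
    ∑ z ∈ S, ∑ s : Σ x : Paths Q, Quiver.Hom (V := Q) x z, t ⟨s.1, z, s.2⟩ = ∑ᶠ α, t α := by
  rw [Finset.sum_sigma']
  let i : (Σ z : Paths Q, Σ x : Paths Q, Quiver.Hom (V := Q) x z) ↪ Arrow Q :=
    ⟨fun s => ⟨s.2.1, s.1, s.2.2⟩, by
      rintro ⟨z, x, α⟩ ⟨z', x', α'⟩ h
      cases h
      rfl⟩
  rw [finsum_eq_sum_of_support_subset (s := (S.sigma fun z => Finset.univ).map i), Finset.sum_map]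
  · rfl
  · rintro ⟨x, z, α⟩ h
    exact Finset.mem_coe.2 (Finset.mem_map.2 ⟨⟨z, x, α⟩,
      Finset.mem_sigma.2 ⟨ht _ h, Finset.mem_univ _⟩, rfl⟩)

theorem sum_arrows_from {R : Type*} [AddCommMonoid R] (S : Finset (Paths Q)) (t : Arrow Q → R)
    (ht : ∀ α, t α ≠ 0 → α.1 ∈ S) :
    ∑ z ∈ S, ∑ s : Σ y : Paths Q, Quiver.Hom (V := Q) z y, t ⟨z, s⟩ = ∑ᶠ α, t α := by
  rw [Finset.sum_sigma', finsum_eq_sum_of_support_subset (s := S.sigma fun z => Finset.univ)]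
  rintro ⟨z, s⟩ h
  exact Finset.mem_coe.2 (Finset.mem_sigma.2 ⟨ht _ h, Finset.mem_univ _⟩)

end Sums

end QuiverRep

/-! ### Duality between free and cofree objects; right almost split triangles. -/

namespace RepPlus

open QuiverRep

variable {k Q : Type u} [Field k] [Quiver.{u} Q] [StronglyLocallyFinite Q]

/-- Morphisms from a free representation are families of elements. -/
def freeHomEquiv {n : ℕ} (b : Fin n → Paths Q) (M : RepPlus k Q) :
    (∀ j, M.obj.obj (b j)) ≃ₗ[k] (free k b ⟶ M) :=
  LinearEquiv.symm
  { toFun := fun f j => f.hom.app (b j) (gen b j (𝟙 _))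
    map_add' := fun _ _ => rfl
    map_smul' := fun _ _ => rfl
    invFun := fun m => ObjectProperty.homMk (desc m)
    left_inv := fun _ => ObjectProperty.hom_ext _ (Fr_hom_ext fun j => desc_gen_nil _ j)
    right_inv := fun m => funext fun j => desc_gen_nil m j }

theorem freeHomEquiv_gen {n : ℕ} (b : Fin n → Paths Q) (M : RepPlus k Q) (m : ∀ j, M.obj.obj (b j))
    (j : Fin n) : (freeHomEquiv b M m).hom.app (b j) (gen b j (𝟙 _)) = m j :=
  desc_gen_nil m j

/-- Cofree representations as objects of `rep⁺(Q)`. -/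
def cofree (k : Type u) {Q : Type u} [Field k] [Quiver.{u} Q] [StronglyLocallyFinite Q]
    (h : ¬ Nonempty (LeftInfinitePath Q)) {n : ℕ} (b : Fin n → Paths Q) : RepPlus k Q :=
  ⟨CofreeRep k b, isFinitelyPresented_cofreeRep h b⟩

-- The form sums, over `j`, the coordinate at the trivial path of the image of the `j`-th generator.
variable (k) in
def cofreeTrace (h : ¬ Nonempty (LeftInfinitePath Q)) {n : ℕ} (b : Fin n → Paths Q) :
    (free k b ⟶ cofree k h b) →ₗ[k] k :=
  (∑ j, coord b j (𝟙 _) ∘ₗ LinearMap.proj (R := k)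
    (φ := fun j => (cofree k h b).obj.obj (b j)) j) ∘ₗ (freeHomEquiv b (cofree k h b)).symm.toLinearMap

theorem cofreeTrace_apply (h : ¬ Nonempty (LeftInfinitePath Q)) {n : ℕ} (b : Fin n → Paths Q)
    {W : RepPlus k Q} (m : ∀ j, W.obj.obj (b j)) (w : W ⟶ cofree k h b) :
    cofreeTrace k h b (freeHomEquiv b W m ≫ w) = ∑ j, coord b j (𝟙 _) (w.hom.app (b j) (m j)) := by
  simp only [cofreeTrace, LinearMap.comp_apply, LinearMap.sum_apply]
  refine Finset.sum_congr rfl fun j _ => ?_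
  exact congrArg (fun v => coord b j (𝟙 _) (w.hom.app (b j) v)) (freeHomEquiv_gen b W m j)

theorem cofreeTrace_single (h : ¬ Nonempty (LeftInfinitePath Q)) {n : ℕ} (b : Fin n → Paths Q)
    {W : RepPlus k Q} (j : Fin n) (m : W.obj.obj (b j)) (w : W ⟶ cofree k h b) :
    cofreeTrace k h b (freeHomEquiv b W (Pi.single j m) ≫ w) =
      coord b j (𝟙 _) (w.hom.app (b j) m) := by
  rw [cofreeTrace_apply, Finset.sum_eq_single_of_mem j (Finset.mem_univ j), Pi.single_eq_same]
  intro i _ hi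
  rw [Pi.single_eq_of_ne hi, map_zero]
  exact map_zero (coord b i (𝟙 _))

/-- Yoneda: by naturality the coordinate of `w a` at a path `p` is the trivial-path coordinate of
`w` applied to `p a`. So `w` amounts to a functional on each `W (b j)`, hence to one on `Hom(free,
W)`. -/
theorem isDualPair_cofreeTrace (h : ¬ Nonempty (LeftInfinitePath Q)) {n : ℕ}
    (b : Fin n → Paths Q) : IsDualPair (cofreeTrace k h b) := by
  intro W
  constructor
  · intro v w hvw
    replace hvw : ∀ s, cofreeTrace k h b (s ≫ v) = cofreeTrace k h b (s ≫ w) :=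
      fun s => LinearMap.congr_fun hvw s
    apply ObjectProperty.hom_ext
    ext x a
    refine coord_ext fun j p => ?_
    have := hvw (freeHomEquiv b W (Pi.single j (W.obj.map p a)))
    rw [cofreeTrace_single, cofreeTrace_single, NatTrans.naturality_apply,
      NatTrans.naturality_apply] at this
    exact (coord_eq_coord_id j p _).trans (this.trans (coord_eq_coord_id j p _).symm)
  · intro g
    let l := fun j => g ∘ₗ (freeHomEquiv b W).toLinearMap ∘ₗ
      LinearMap.single k (fun j => W.obj.obj (b j)) j
    let w : W ⟶ cofree k h b := ObjectProperty.homMk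
      { app := fun x => ModuleCat.ofHom
          (LinearMap.pi (φ := fun _ : Σ j, x ⟶ b j => k) fun s => l s.1 ∘ₗ (W.obj.map s.2).hom)
        naturality := fun x y p => by
          ext v
          funext s
          change l s.1 ((W.obj.map s.2) (W.obj.map p v)) = l s.1 (W.obj.map (p ≫ s.2) v)
          rw [W.obj.map_comp, ModuleCat.comp_apply] }
    have hw (j : Fin n) (m : W.obj.obj (b j)) : coord b j (𝟙 _) (w.hom.app (b j) m) = l j m := by
      change l j (W.obj.map (𝟙 _) m) = l j m
      rw [W.obj.map_id, ModuleCat.id_apply]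
    refine ⟨w, LinearMap.ext fun s => ?_⟩
    obtain ⟨m, rfl⟩ := (freeHomEquiv b W).surjective s
    change cofreeTrace k h b (freeHomEquiv b W m ≫ w) = _
    rw [cofreeTrace_apply]
    conv_rhs => rw [← Finset.univ_sum_single m, map_sum, map_sum]
    exact Finset.sum_congr rfl fun j _ => hw j (m j)

theorem hasRightAlmostSplitTriangles (h : ¬ Nonempty (LeftInfinitePath Q)) :
    HasRightAlmostSplitTriangles (DbRepPlus k Q) := by
  refine hasRightAlmostSplitTriangles_of_kills hereditaryHoms
    (fun M hM => localEnd_of_indecomposable k hM) fun M hM => ?_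
  obtain ⟨n, m, c, b, d, π, w, hS⟩ := exists_resolution M
  have := hS.epi_g
  obtain ⟨ν, θ, h1, h2⟩ := exists_dual_right (isDualPair_cofreeTrace h c)
    (isDualPair_cofreeTrace h b) d π w (fun N s hs => by
      obtain ⟨t, ht⟩ := CokernelCofork.IsColimit.desc' hS.gIsCokernel s hs
      exact ⟨t, ht.symm⟩) (localEnd_of_indecomposable k hM) hM.1
  have := (isDualPair_cofreeTrace (k := k) h b).injective
  exact exists_killsNonRetractions hereditaryHoms (isSumOfLocal_of_finite k) ν θ
    hom_eq_zero_of_injective h1 h2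

/-- The morphism from a free object given by linear maps on the generating spaces. -/
def liftSpaces {ι : Type u} {b : ι → Paths Q} {V : ι → Type u} [∀ i, AddCommGroup (V i)]
    [∀ i, Module k (V i)] {F : RepPlus k Q} {u : ∀ i, V i →ₗ[k] F.obj.obj (b i)}
    (hF : IsFreeOnSpaces b V F.obj u) (W : RepPlus k Q) :
    (F ⟶ W) ≃ₗ[k] (∀ i, V i →ₗ[k] W.obj.obj (b i)) :=
  LinearEquiv.ofBijective
    { toFun := fun φ i => (φ.hom.app (b i)).hom ∘ₗ u i
      map_add' := fun _ _ => rfl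
      map_smul' := fun _ _ => rfl }
    ⟨fun _ _ h => ObjectProperty.hom_ext _ (hF.hom_ext fun i => congrFun h i), fun m => by
      obtain ⟨φ, hφ⟩ := hF.exists_hom m
      exact ⟨ObjectProperty.homMk φ, funext hφ⟩⟩

end RepPlus

/-! ### Trace duality for finite support; left almost split triangles. -/

namespace RepPlus

open QuiverRep

variable {k Q : Type u} [Field k] [Quiver.{u} Q] [StronglyLocallyFinite Q]

theorem finite_support (h : ¬ Nonempty (RightInfinitePath Q)) (M : RepPlus k Q) :
    {x | Nontrivial (M.obj.obj x)}.Finite := by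
  obtain ⟨n, m, c, b, d, π, w, hS⟩ := exists_resolution M
  have := hS.epi_g
  have := epi_hom π
  have (j : Fin m) : Finite (Σ x : Paths Q, b j ⟶ x) := finite_paths_from h (b j)
  refine (Set.finite_range fun s : Σ j, Σ x : Paths Q, b j ⟶ x => s.2.1).subset fun x hx => ?_
  by_contra hs
  have : IsEmpty (Σ j, b j ⟶ x) := ⟨fun s => hs ⟨⟨s.1, x, s.2⟩, rfl⟩⟩
  have : Subsingleton ((free k b).obj.obj x) :=
    inferInstanceAs (Subsingleton ((Σ j, b j ⟶ x) →₀ k))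
  have : Nontrivial (M.obj.obj x) := hx
  have := (app_surj π.hom x).nontrivial
  exact not_subsingleton ((free k b).obj.obj x) inferInstance

/-- For `N` with finite support, the functor `Hom(-, N)` is dual to the cokernel of a morphism
between functors corepresented by free objects. -/
theorem exists_dual_presentation (N : RepPlus k Q) (hN : {x | Nontrivial (N.obj.obj x)}.Finite) :
    ∃ (F₀ F₁ : RepPlus k Q) (d : F₀ ⟶ F₁) (T : (F₀ ⟶ N) →ₗ[k] k), Projective F₀ ∧
      (∀ ⦃W : RepPlus k Q⦄ (f : W ⟶ N), (∀ β : F₀ ⟶ W, T (β ≫ f) = 0) → f = 0) ∧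
      (∀ γ : F₁ ⟶ N, T (d ≫ γ) = 0) ∧
      (∀ ⦃W : RepPlus k Q⦄ (β : F₀ ⟶ W), (∀ f : W ⟶ N, T (β ≫ f) = 0) →
        ∃ γ : F₁ ⟶ W, d ≫ γ = β) := by
  classical
  have := finite_obj N
  obtain ⟨F₀, u₀, h₀, hu₀⟩ := exists_isFreeOnSpaces (k := k) (fun x : Paths Q => x)
    (fun x => N.obj.obj x) hN
  obtain ⟨F₁, u₁, h₁, hu₁⟩ := exists_isFreeOnSpaces (k := k) (fun α : Arrow Q => α.1)
    (fun α => N.obj.obj α.2.1) (finite_arrow_target hN)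
  obtain ⟨F₀, rfl⟩ : ∃ F : RepPlus k Q, F.obj = F₀ :=
    ⟨⟨F₀, isFinitelyPresented_of_isFree h₀⟩, rfl⟩
  obtain ⟨F₁, rfl⟩ : ∃ F : RepPlus k Q, F.obj = F₁ :=
    ⟨⟨F₁, isFinitelyPresented_of_isFree h₁⟩, rfl⟩
  let L₀ := liftSpaces hu₀
  let L₁ := liftSpaces hu₁
  -- This is dual to the map `(f x) ↦ (f ∘ W(α) - N(α) ∘ f)` measuring the failure of a family of
  -- linear maps `W x → N x` to be natural.
  let d : F₀ ⟶ F₁ := (L₀ F₁).symm fun z =>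
    ∑ s : Σ x : Paths Q, Quiver.Hom (V := Q) x z,
      (F₁.obj.map (arrowPath s.2)).hom ∘ₗ u₁ ⟨s.1, z, s.2⟩ -
    ∑ s : Σ y : Paths Q, Quiver.Hom (V := Q) z y,
      u₁ ⟨z, s⟩ ∘ₗ (N.obj.map (arrowPath s.2)).hom
  have hd {W : RepPlus k Q} (γ : F₁ ⟶ W) (z : Paths Q) : L₀ W (d ≫ γ) z =
      ∑ s : Σ x : Paths Q, Quiver.Hom (V := Q) x z,
        (W.obj.map (arrowPath s.2)).hom ∘ₗ L₁ W γ ⟨s.1, z, s.2⟩ -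
      ∑ s : Σ y : Paths Q, Quiver.Hom (V := Q) z y,
        L₁ W γ ⟨z, s⟩ ∘ₗ (N.obj.map (arrowPath s.2)).hom := by
    change (γ.hom.app z).hom ∘ₗ (L₀ F₁ d z) = _
    rw [show L₀ F₁ d = _ from LinearEquiv.apply_symm_apply _ _, LinearMap.comp_sub,
      comp_finset_sum, comp_finset_sum]
    congr 1
    refine Finset.sum_congr rfl fun s _ => ?_
    ext v
    exact NatTrans.naturality_apply γ.hom (arrowPath s.2) (u₁ ⟨s.1, z, s.2⟩ v)
  have hsub {x : Paths Q} (hx : x ∉ hN.toFinset) : Subsingleton (N.obj.obj x) := by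
    simpa [not_nontrivial_iff_subsingleton] using hx
  have htr {x : Paths Q} (g : N.obj.obj x →ₗ[k] N.obj.obj x)
      (hg : LinearMap.trace k _ g ≠ 0) : x ∈ hN.toFinset := by
    by_contra hx
    have := hsub hx
    exact hg (by rw [Subsingleton.elim g 0, map_zero])
  -- The pairing is defined for arbitrary families `f`, not only natural ones; traces vanish off the
  -- support of `N`, so the sum is finite.
  let τ {W : RepPlus k Q} (f : ∀ x, W.obj.obj x →ₗ[k] N.obj.obj x) (φ : F₀ ⟶ W) : k :=
    ∑ x ∈ hN.toFinset, LinearMap.trace k _ (f x ∘ₗ L₀ W φ x)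
  have hτ {W : RepPlus k Q} (f : ∀ x, W.obj.obj x →ₗ[k] N.obj.obj x) (γ : F₁ ⟶ W) :
      τ f (d ≫ γ) = ∑ᶠ α : Arrow Q, LinearMap.trace k _
          (f α.2.1 ∘ₗ (W.obj.map (arrowPath α.2.2)).hom ∘ₗ L₁ W γ α) -
        ∑ᶠ α : Arrow Q, LinearMap.trace k _
          (f α.1 ∘ₗ L₁ W γ α ∘ₗ (N.obj.map (arrowPath α.2.2)).hom) := by
    rw [← sum_arrows_to hN.toFinset _ fun α h => htr _ h,
      ← sum_arrows_from hN.toFinset _ fun α h => htr _ h, ← Finset.sum_sub_distrib]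
    refine Finset.sum_congr rfl fun z _ => ?_
    rw [hd, LinearMap.comp_sub, comp_finset_sum, comp_finset_sum, map_sub, map_sum, map_sum]
  have hsingle {W : RepPlus k Q} (f : ∀ x, W.obj.obj x →ₗ[k] N.obj.obj x) (x : Paths Q)
      (g : N.obj.obj x →ₗ[k] W.obj.obj x) :
      τ f ((L₀ W).symm (Pi.single x g)) = LinearMap.trace k _ (f x ∘ₗ g) := by
    simp only [τ, LinearEquiv.apply_symm_apply]
    rw [Finset.sum_eq_single x, Pi.single_eq_same]
    · intro y _ hy
      rw [Pi.single_eq_of_ne hy, LinearMap.comp_zero, map_zero]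
    · intro hx
      by_contra h
      exact hx (htr _ h)
  let T : (F₀ ⟶ N) →ₗ[k] k := ∑ x ∈ hN.toFinset, LinearMap.trace k _ ∘ₗ
    LinearMap.proj (R := k) (φ := fun x => N.obj.obj x →ₗ[k] N.obj.obj x) x ∘ₗ (L₀ N).toLinearMap
  have hT {W : RepPlus k Q} (f : W ⟶ N) (β : F₀ ⟶ W) :
      T (β ≫ f) = τ (fun x => (f.hom.app x).hom) β := by
    simp only [T, τ, LinearMap.sum_apply]
    rfl
  have hT' (β : F₀ ⟶ N) : T β = τ (fun x => LinearMap.id) β := by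
    simp only [T, τ, LinearMap.sum_apply]
    rfl
  refine ⟨F₀, F₁, d, T, projective_of_isFree h₀, fun W f hf => ?_, fun γ => ?_, fun W β hβ => ?_⟩
  · apply ObjectProperty.hom_ext
    apply NatTrans.ext
    funext x
    apply ModuleCat.hom_ext
    refine eq_zero_of_trace_comp_eq_zero _ fun g => ?_
    rw [← hsingle (fun x => (f.hom.app x).hom), ← hT]
    exact hf _
  · rw [hT', hτ, sub_eq_zero]
    refine finsum_congr fun α => ?_
    rw [LinearMap.id_comp, LinearMap.id_comp]
    exact LinearMap.trace_comp_comm' _ _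
  -- A functional `Λ` that vanishes on the range of `d` but not at `β` is the trace pairing with
  -- some family `f`. Vanishing on the range makes `f` natural, so `f` is a morphism pairing
  -- nontrivially with `β`.
  · by_contra hβ'
    obtain ⟨Λ, hΛ, hle⟩ := Submodule.exists_le_ker_of_notMem
      (p := LinearMap.range (Linear.leftComp k W d)) (v := β) hβ'
    choose f hf using fun x => exists_trace_comp_eq (Λ ∘ₗ (L₀ W).symm.toLinearMap ∘ₗ
      LinearMap.single k (fun x => N.obj.obj x →ₗ[k] W.obj.obj x) x)
    have hΛτ (φ : F₀ ⟶ W) : Λ φ = τ f φ := by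
      obtain ⟨m, rfl⟩ := (L₀ W).symm.surjective φ
      have hm : m = ∑ x ∈ hN.toFinset, Pi.single x (m x) := by
        funext y
        rw [Finset.sum_apply]
        by_cases hy : y ∈ hN.toFinset
        · rw [Finset.sum_eq_single_of_mem y hy, Pi.single_eq_same]
          exact fun x _ hx => Pi.single_eq_of_ne' hx _
        · have := hsub hy
          exact LinearMap.ext fun v => by
            rw [Subsingleton.elim v 0, map_zero, map_zero]
      simp only [τ, LinearEquiv.apply_symm_apply]
      conv_lhs => rw [hm, map_sum, map_sum]
      exact Finset.sum_congr rfl fun x _ => hf x (m x)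
    have hnat (α : Arrow Q) : f α.2.1 ∘ₗ (W.obj.map (arrowPath α.2.2)).hom =
        (N.obj.map (arrowPath α.2.2)).hom ∘ₗ f α.1 := by
      rw [← sub_eq_zero]
      refine eq_zero_of_trace_comp_eq_zero _ fun g => ?_
      -- Testing on a morphism concentrated at the single arrow `α` isolates naturality at `α`.
      have h1 : τ f (d ≫ (L₁ W).symm (Pi.single α g)) = 0 := by
        rw [← hΛτ]
        exact hle ⟨_, rfl⟩
      rw [hτ, LinearEquiv.apply_symm_apply, finsum_eq_single _ α, finsum_eq_single _ α,
        Pi.single_eq_same] at h1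
      · rw [LinearMap.sub_comp, map_sub, ← h1]
        congr 1
        rw [LinearMap.comp_assoc, ← LinearMap.trace_comp_comm', LinearMap.comp_assoc]
      · intro α' h
        rw [Pi.single_eq_of_ne h, LinearMap.zero_comp, LinearMap.comp_zero, map_zero]
      · intro α' h
        rw [Pi.single_eq_of_ne h, LinearMap.comp_zero, LinearMap.comp_zero, map_zero]
    refine hΛ ?_
    rw [hΛτ]
    exact (hT (ObjectProperty.homMk (homOfArrows f hnat)) β).symm.trans (hβ _)

theorem hasLeftAlmostSplitTriangles (h : ¬ Nonempty (RightInfinitePath Q)) :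
    HasLeftAlmostSplitTriangles (DbRepPlus k Q) := by
  refine hasLeftAlmostSplitTriangles_of_kills hereditaryHoms
    (fun M hM => localEnd_of_indecomposable k hM) fun M hM => ?_
  obtain ⟨F₀, F₁, d, T, hF, hinj, hT, hann⟩ := exists_dual_presentation M (finite_support h M)
  obtain ⟨θ, h1, h2⟩ := exists_dual_left d T hinj hT hann (localEnd_of_indecomposable k hM) hM.1
  exact exists_killsNonSections hereditaryHoms (isSumOfLocal_of_finite k) d θ
    hom_eq_zero_of_projective h1 h2

end RepPlus

/-! ### Finiteness of nonzero morphisms in the derived category. -/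

section FiniteHoms

variable {A : Type*} [Category A] [Abelian A] [HasDerivedCategory A]

open DerivedCategory

/-- If the source varies in a family of projective objects, almost all of which have no nonzero
morphism to a given object of `A`, the same holds for the objects of the derived category. -/
theorem finite_nonzero_homs_from (hA : HereditaryHoms A) {ι : Type*} (P : ι → A)
    [∀ i, Projective (P i)] (h : ∀ M : A, {i | ∃ f : P i ⟶ M, f ≠ 0}.Finite) (X : Bounded A)
    (m : ℤ) : {i | ∃ f : (boundedSingle A).obj (P i) ⟶ X⟦m⟧, f ≠ 0}.Finite := by
  revert m
  refine bounded_induction hA (fun X => ∀ m : ℤ,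
    {i | ∃ f : (boundedSingle A).obj (P i) ⟶ X⟦m⟧, f ≠ 0}.Finite)
    (fun W hW m => ?_) (fun M n W e m => ?_) (fun X Y W e hX hY m => ?_) X
  · refine Set.finite_empty.subset ?_
    rintro i ⟨f, hf⟩
    exact hf ((Functor.map_isZero (shiftFunctor (Bounded A) m) hW).eq_of_tgt _ _)
  · refine (h M).subset ?_
    rintro i ⟨f, hf⟩
    let a : W⟦m⟧ ≅ ((boundedSingle A).obj M)⟦n + m⟧ :=
      (shiftFunctor (Bounded A) m).mapIso e ≪≫ ((shiftFunctorAdd (Bounded A) n m).app _).symm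
    have hf' : f ≫ a.hom ≠ 0 := fun h0 => hf (by rw [← cancel_mono a.hom, h0, zero_comp])
    have hnm : n + m = 0 := by
      by_contra hnm
      exact hf' (hom_eq_zero_of_projective M _ hnm _)
    let b : W⟦m⟧ ≅ (boundedSingle A).obj M :=
      a ≪≫ (shiftFunctorZero' (Bounded A) (n + m) hnm).app _
    obtain ⟨g, hg⟩ := (boundedSingle A).map_surjective (f ≫ b.hom)
    refine ⟨g, ?_⟩
    rintro rfl
    rw [Functor.map_zero] at hg
    exact hf (by rw [← cancel_mono b.hom, ← hg, zero_comp])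
  · refine ((hX m).union (hY m)).subset ?_
    rintro i ⟨f, hf⟩
    by_contra hi
    obtain ⟨h1, h2⟩ := not_or.1 hi
    replace h1 : f ≫ (e.hom ≫ biprod.fst)⟦m⟧' = 0 := by_contra fun h0 => h1 ⟨_, h0⟩
    replace h2 : f ≫ (e.hom ≫ biprod.snd)⟦m⟧' = 0 := by_contra fun h0 => h2 ⟨_, h0⟩
    have h3 : 𝟙 W = (e.hom ≫ biprod.fst) ≫ biprod.inl ≫ e.inv +
        (e.hom ≫ biprod.snd) ≫ biprod.inr ≫ e.inv := by
      calc 𝟙 W = e.hom ≫ 𝟙 (X ⊞ Y) ≫ e.inv := by simp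
        _ = _ := by
          rw [← biprod.total]
          simp only [Preadditive.add_comp, Preadditive.comp_add, Category.assoc]
    have h4 : f = f ≫ (𝟙 W)⟦m⟧' := by rw [CategoryTheory.Functor.map_id, Category.comp_id]
    refine hf ?_
    rw [h4, h3, Functor.map_add, Functor.map_comp, Functor.map_comp _ (e.hom ≫ biprod.snd),
      Preadditive.comp_add, reassoc_of% h1, reassoc_of% h2, zero_comp, zero_comp, add_zero]

/-- If the target varies in a family of objects, almost all of which receive no nonzero morphism
from a given object of a class providing projective resolutions of length one, the same holds for
the objects of the derived category. -/
theorem finite_nonzero_homs_to (R : A → Prop) (hR : ∀ P, R P → Projective P)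
    (hres : ∀ M : A, ∃ (P₁ P₀ : A) (d : P₁ ⟶ P₀) (π : P₀ ⟶ M) (w : d ≫ π = 0),
      (ShortComplex.mk d π w).ShortExact ∧ R P₁ ∧ R P₀)
    {ι : Type*} (N : ι → A) (h : ∀ P : A, R P → {i | ∃ f : P ⟶ N i, f ≠ 0}.Finite) (X : Bounded A)
    (m : ℤ) : {i | ∃ f : X ⟶ ((boundedSingle A).obj (N i))⟦m⟧, f ≠ 0}.Finite := by
  have hA : HereditaryHoms A := hereditaryHoms_of_resolutions fun M => by
    obtain ⟨P₁, P₀, d, π, w, hS, h1, h0⟩ := hres M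
    exact ⟨P₁, P₀, d, π, w, hS, hR _ h1, hR _ h0⟩
  have hproj (P : A) (hP : R P) (m : ℤ) :
      {i | ∃ f : (boundedSingle A).obj P ⟶ ((boundedSingle A).obj (N i))⟦m⟧, f ≠ 0}.Finite := by
    have := hR P hP
    refine (h P hP).subset ?_
    rintro i ⟨f, hf⟩
    have hm : m = 0 := by
      by_contra hm
      exact hf (hom_eq_zero_of_projective _ _ hm _)
    let b : ((boundedSingle A).obj (N i))⟦m⟧ ≅ (boundedSingle A).obj (N i) :=
      (shiftFunctorZero' (Bounded A) m hm).app _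
    obtain ⟨g, hg⟩ := (boundedSingle A).map_surjective (f ≫ b.hom)
    refine ⟨g, ?_⟩
    rintro rfl
    rw [Functor.map_zero] at hg
    exact hf (by rw [← cancel_mono b.hom, ← hg, zero_comp])
  have hsingle (M : A) (m : ℤ) :
      {i | ∃ f : (boundedSingle A).obj M ⟶ ((boundedSingle A).obj (N i))⟦m⟧, f ≠ 0}.Finite := by
    obtain ⟨P₁, P₀, d, π, w, hS, h1, h0⟩ := hres M
    obtain ⟨δ, hδ⟩ := boundedSingle_distinguished hS
    refine ((hproj P₀ h0 m).union (hproj P₁ h1 (m - 1))).subset ?_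
    rintro i ⟨f, hf⟩
    by_contra hi
    obtain ⟨h2, h3⟩ := not_or.1 hi
    -- A nonzero morphism from `M` is nonzero on `P₀`, or comes from `P₁⟦1⟧` and so gives a nonzero
    -- morphism from `P₁` in degree `m - 1`.
    obtain ⟨s, hs⟩ := Triangle.yoneda_exact₃ _ hδ f (by_contra fun h0 => h2 ⟨_, h0⟩)
    have h4 : s = 0 := shift_hom_eq_zero (n := m - 1)
      (fun g => by_contra fun h0 => h3 ⟨g, h0⟩) (by lia) s
    rw [hs, h4] at hf
    exact hf comp_zero
  revert m
  refine bounded_induction hA (fun X => ∀ m : ℤ,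
    {i | ∃ f : X ⟶ ((boundedSingle A).obj (N i))⟦m⟧, f ≠ 0}.Finite)
    (fun W hW m => ?_) (fun M n W e m => ?_) (fun X Y W e hX hY m => ?_) X
  · refine Set.finite_empty.subset ?_
    rintro i ⟨f, hf⟩
    exact hf (hW.eq_of_src _ _)
  · refine (hsingle M (m - n)).subset ?_
    rintro i ⟨f, hf⟩
    by_contra hi
    have h1 : e.inv ≫ f = 0 := shift_hom_eq_zero (n := m - n)
      (fun g => by_contra fun h0 => hi ⟨g, h0⟩) (by lia) _
    exact hf (by rw [← cancel_epi e.inv, h1, comp_zero])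
  · refine ((hX m).union (hY m)).subset ?_
    rintro i ⟨f, hf⟩
    by_contra hi
    obtain ⟨h1, h2⟩ := not_or.1 hi
    refine hf ?_
    rw [← cancel_epi e.inv, comp_zero]
    apply biprod.hom_ext'
    · rw [comp_zero]
      exact by_contra fun h0 => h1 ⟨_, h0⟩
    · rw [comp_zero]
      exact by_contra fun h0 => h2 ⟨_, h0⟩

end FiniteHoms

/-! ### Vertices along an infinite path. -/

section InfinitePaths

variable {Q : Type u} [Quiver.{u} Q]

namespace RightInfinitePath

variable (p : RightInfinitePath Q)

def path : ∀ n, Quiver.Path (p.vertex 0) (p.vertex n)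
  | 0 => .nil
  | n + 1 => (path n).cons (p.arrow n)

theorem length_path (n : ℕ) : (p.path n).length = n := by
  induction n with
  | zero => rfl
  | succ n ih => exact congrArg (· + 1) ih

/-- A path from the `n`-th vertex to `y` extends the initial segment of length `n`, and the finitely
many paths from the initial vertex to `y` have bounded length. -/
theorem finite_path_to [StronglyLocallyFinite Q] (y : Q) :
    {n | Nonempty (Quiver.Path (p.vertex n) y)}.Finite := by
  have := StronglyLocallyFinite.finite_path (p.vertex 0) y
  obtain ⟨L, hL⟩ := (Set.finite_range fun q : Quiver.Path (p.vertex 0) y => q.length).bddAbove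
  refine (Set.finite_Iic L).subset ?_
  rintro n ⟨q⟩
  have : ((p.path n).comp q).length ≤ L := hL ⟨_, rfl⟩
  rw [Quiver.Path.length_comp, length_path] at this
  exact (Nat.le_add_right _ _).trans this

end RightInfinitePath

namespace LeftInfinitePath

variable (p : LeftInfinitePath Q)

def path : ∀ n, Quiver.Path (p.vertex n) (p.vertex 0)
  | 0 => .nil
  | n + 1 => (p.arrow n).toPath.comp (path n)

theorem length_path (n : ℕ) : (p.path n).length = n := by
  induction n with
  | zero => rfl
  | succ n ih => rw [path, Quiver.Path.length_comp, ih, Quiver.Path.length_toPath, add_comm]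

theorem finite_path_from [StronglyLocallyFinite Q] (y : Q) :
    {n | Nonempty (Quiver.Path y (p.vertex n))}.Finite := by
  have := StronglyLocallyFinite.finite_path y (p.vertex 0)
  obtain ⟨L, hL⟩ := (Set.finite_range fun q : Quiver.Path y (p.vertex 0) => q.length).bddAbove
  refine (Set.finite_Iic L).subset ?_
  rintro n ⟨q⟩
  have : (q.comp (p.path n)).length ≤ L := hL ⟨_, rfl⟩
  rw [Quiver.Path.length_comp, length_path] at this
  exact (Nat.le_add_left _ _).trans this

end LeftInfinitePath

def DoubleInfinitePath.toRightInfinitePath (p : DoubleInfinitePath Q) : RightInfinitePath Q where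
  vertex n := p.vertex n
  arrow n := p.arrow n

end InfinitePaths

/-! ### Infinite paths obstruct almost split triangles. -/

namespace RepPlus

open QuiverRep

variable {k Q : Type u} [Field k] [Quiver.{u} Q] [StronglyLocallyFinite Q]

/-- The object `P_x` of `rep⁺(Q)`. -/
abbrev proj (k : Type u) {Q : Type u} [Field k] [Quiver.{u} Q] [StronglyLocallyFinite Q]
    (x : Paths Q) : RepPlus k Q := free k fun _ : Fin 1 => x

omit [StronglyLocallyFinite Q] in
theorem gen_ne_zero {n : ℕ} (b : Fin n → Paths Q) (j : Fin n) {x : Paths Q} (p : b j ⟶ x) :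
    gen (k := k) b j p ≠ 0 := fun h =>
  one_ne_zero (Finsupp.single_eq_zero.1 (show Finsupp.single (⟨j, p⟩ : Σ j, b j ⟶ x) (1 : k) = 0
    from h))

/-- Precomposition with `p` sends paths from `y` to paths from `x`, so the direction is reversed. -/
theorem exists_nonzero_hom {x y : Paths Q} (p : x ⟶ y) : ∃ f : proj k y ⟶ proj k x, f ≠ 0 := by
  refine ⟨freeHomEquiv _ _ fun _ => gen (fun _ : Fin 1 => x) 0 p, fun h => ?_⟩
  refine gen_ne_zero (k := k) (fun _ : Fin 1 => x) 0 p ?_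
  exact congrFun ((LinearEquiv.map_eq_zero_iff _).1 h) 0

theorem exists_path_of_ne_zero {x : Paths Q} {n : ℕ} {b : Fin n → Paths Q}
    (f : proj k x ⟶ free k b) (hf : f ≠ 0) : ∃ j, Nonempty (b j ⟶ x) := by
  by_contra! h
  have : Subsingleton ((free k b).obj.obj x) :=
    have : IsEmpty (Σ j, b j ⟶ x) := ⟨fun s => (h s.1).false s.2⟩
    inferInstanceAs (Subsingleton ((Σ j, b j ⟶ x) →₀ k))
  refine hf ((freeHomEquiv _ _).symm.injective ?_)
  exact funext fun j => Subsingleton.elim (α := (free k b).obj.obj x) _ _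

/-- The only closed path at `x` is trivial, so every endomorphism is a scalar. -/
theorem localEnd_proj (x : Paths Q) : LocalEnd (proj k x) := by
  intro e
  obtain ⟨m, rfl⟩ := (freeHomEquiv _ _).surjective e
  have : Subsingleton (Σ _ : Fin 1, x ⟶ x) := ⟨by
    rintro ⟨i, p⟩ ⟨j, q⟩
    obtain rfl := Subsingleton.elim i j
    obtain rfl : p = 𝟙 x := path_eq_nil (Q := Q) p
    obtain rfl : q = 𝟙 x := path_eq_nil (Q := Q) q
    rfl⟩
  obtain ⟨c, hc⟩ : ∃ c : k, m 0 = c • gen (fun _ : Fin 1 => x) 0 (𝟙 x) := by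
    let v : (Σ _ : Fin 1, x ⟶ x) →₀ k := m 0
    refine ⟨v ⟨0, 𝟙 x⟩, ?_⟩
    change v = v ⟨0, 𝟙 x⟩ • Finsupp.single ⟨0, 𝟙 x⟩ 1
    ext s
    obtain rfl := Subsingleton.elim s ⟨0, 𝟙 x⟩
    simp
  have hm : freeHomEquiv _ _ m = c • 𝟙 (proj k x) := by
    refine (freeHomEquiv _ _).symm.injective ?_
    rw [LinearEquiv.symm_apply_apply, map_smul]
    funext j
    obtain rfl := Subsingleton.elim j 0
    exact hc
  rw [hm]
  by_cases h : c = 0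
  · right
    rw [h, zero_smul, sub_zero]
    infer_instance
  · left
    exact ⟨c⁻¹ • 𝟙 _, by simp [smul_smul, h], by simp [smul_smul, h]⟩

theorem indecomposable_proj (x : Paths Q) :
    Indecomposable ((boundedSingle (RepPlus k Q)).obj (proj k x)) := by
  refine ((localEnd_proj x).of_map _).indecomposable fun h => ?_
  obtain ⟨f, hf⟩ := exists_nonzero_hom (k := k) (𝟙 x)
  exact hf ((boundedSingle (RepPlus k Q)).map_injective (h.eq_of_src _ _))

/-- The nonzero maps `P_{xₙ}⟦1⟧ ⟶ P_{x₀}⟦1⟧` all divide the connecting morphism, so `Z` maps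
nontrivially to every `P_{xₙ}⟦1⟧`. But a nonzero `P_b ⟶ P_{xₙ}` needs a path from `xₙ` to `b`, which
exists for finitely many `n` only. -/
theorem not_nonempty_rightInfinitePath
    (h : HasLeftAlmostSplitTriangles (DbRepPlus k Q)) : ¬ Nonempty (RightInfinitePath Q) := by
  rintro ⟨p⟩
  let S := boundedSingle (RepPlus k Q)
  obtain ⟨Y, Z, f, g, w, hT, hf, hg⟩ := h _ (indecomposable_proj (p.vertex 0))
  have hw : w ≠ 0 := fun hw => hg.2.1 (by
    obtain ⟨s, hs⟩ := exists_comp_mor₂_eq hT (𝟙 Z) (by rw [hw, comp_zero])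
    exact ⟨⟨⟨s, hs.symm⟩⟩⟩)
  refine Set.infinite_univ (α := ℕ) ((finite_nonzero_homs_to
    (fun P : RepPlus k Q => ∃ (n : ℕ) (b : Fin n → Paths Q), P = free k b) ?_ ?_
    (fun n => proj k (Q := Q) (p.vertex n)) ?_ Z 1).subset fun n _ => ?_)
  · rintro _ ⟨n, b, rfl⟩
    infer_instance
  · intro M
    obtain ⟨n, m, c, b, d, π, w, hS⟩ := exists_resolution M
    exact ⟨_, _, d, π, w, hS, ⟨n, c, rfl⟩, ⟨m, b, rfl⟩⟩
  · rintro _ ⟨n, b, rfl⟩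
    refine (Set.finite_iUnion fun j => p.finite_path_to (b j)).subset ?_
    rintro i ⟨f, hf⟩
    by_contra hi
    refine hf ((freeHomEquiv _ _).symm.injective (funext fun j => ?_))
    have : Subsingleton ((proj k (Q := Q) (p.vertex i)).obj.obj (b j)) :=
      have : IsEmpty (Σ _ : Fin 1, (show Paths Q from p.vertex i) ⟶ b j) :=
        ⟨fun s => hi (Set.mem_iUnion.2 ⟨j, ⟨s.2⟩⟩)⟩
      inferInstanceAs (Subsingleton ((Σ _ : Fin 1, (show Paths Q from p.vertex i) ⟶ b j) →₀ k))
    exact Subsingleton.elim _ _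
  · obtain ⟨q, hq⟩ := exists_nonzero_hom (k := k) (show (show Paths Q from p.vertex 0) ⟶ _ from p.path n)
    obtain ⟨s, hs⟩ := hf.2.exists_comp_eq hT ((S.map q)⟦(1 : ℤ)⟧') (fun h0 => hq
      (S.map_injective ((shiftFunctor (DbRepPlus k Q) (1 : ℤ)).map_injective
        (by rw [h0, Functor.map_zero, Functor.map_zero]))))
    refine ⟨s, ?_⟩
    rintro rfl
    exact hw (by rw [← hs, zero_comp])

/-- Here the connecting morphism factors through each nonzero `P_{x₀} ⟶ P_{xₙ}`, so every `P_{xₙ}`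
maps nontrivially to `X⟦1⟧`. But `Hom(P_{xₙ}, M) ≠ 0` needs a path to `xₙ` from one of the finitely
many generating vertices of `M`. -/
theorem not_nonempty_leftInfinitePath
    (h : HasRightAlmostSplitTriangles (DbRepPlus k Q)) : ¬ Nonempty (LeftInfinitePath Q) := by
  rintro ⟨p⟩
  let S := boundedSingle (RepPlus k Q)
  obtain ⟨X, Y, f, g, w, hT, hf, hg⟩ := h _ (indecomposable_proj (p.vertex 0))
  have hw : w ≠ 0 := fun hw => hg.2.1 (by
    obtain ⟨s, hs⟩ := exists_comp_mor₂_eq hT (𝟙 _) (by rw [hw, comp_zero])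
    exact ⟨⟨⟨s, hs.symm⟩⟩⟩)
  let v : ℕ → Paths Q := p.vertex
  have (n : ℕ) : Projective (proj k (v n)) := inferInstance
  refine Set.infinite_univ (α := ℕ) ((finite_nonzero_homs_from hereditaryHoms
    (fun n => proj k (v n)) (fun M => ?_) X 1).subset fun n _ => ?_)
  · obtain ⟨n, m, c, b, d, π, w, hS⟩ := exists_resolution M
    have := hS.epi_g
    refine (Set.finite_iUnion fun j => p.finite_path_from (b j)).subset ?_
    rintro i ⟨f, hf⟩
    obtain ⟨j, hj⟩ := exists_path_of_ne_zero (Projective.factorThru f π) fun h0 => hf (by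
      rw [← Projective.factorThru_comp f π, h0, zero_comp])
    exact Set.mem_iUnion.2 ⟨j, hj⟩
  · obtain ⟨q, hq⟩ := exists_nonzero_hom (k := k)
      (show (show Paths Q from p.vertex n) ⟶ p.vertex 0 from p.path n)
    obtain ⟨s, hs⟩ := hg.2.exists_comp_eq hT (S.map q) fun h0 => hq
      (S.map_injective (by rw [h0, Functor.map_zero]))
    refine ⟨s, ?_⟩
    rintro rfl
    exact hw (by rw [← hs, comp_zero])

end RepPlus

end

theorem mainTheorem12 (k Q : Type u) [Field k] [Quiver.{u} Q] [StronglyLocallyFinite Q] :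
    (HasLeftAlmostSplitTriangles (DbRepPlus k Q) ↔ ¬ Nonempty (RightInfinitePath Q)) ∧
    (HasRightAlmostSplitTriangles (DbRepPlus k Q) ↔ ¬ Nonempty (LeftInfinitePath Q)) ∧
    (HasAlmostSplitTriangles (DbRepPlus k Q) ↔ ¬ HasInfinitePath Q) := by
  have h1 : HasLeftAlmostSplitTriangles (DbRepPlus k Q) ↔ ¬ Nonempty (RightInfinitePath Q) :=
    ⟨RepPlus.not_nonempty_rightInfinitePath, RepPlus.hasLeftAlmostSplitTriangles⟩
  have h2 : HasRightAlmostSplitTriangles (DbRepPlus k Q) ↔ ¬ Nonempty (LeftInfinitePath Q) :=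
    ⟨RepPlus.not_nonempty_leftInfinitePath, RepPlus.hasRightAlmostSplitTriangles⟩
  refine ⟨h1, h2, ?_⟩
  rw [HasAlmostSplitTriangles, h1, h2, ← not_or, not_iff_not]
  refine ⟨fun h => ?_, fun h => ?_⟩
  · exact h.imp_right .inl
  · rcases h with h | h | ⟨⟨p⟩⟩
    · exact .inl h
    · exact .inr h
    -- The nonnegative half of a double infinite path is right infinite.
    · exact .inl ⟨p.toRightInfinitePath⟩
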